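/- Let $A$ be a finite alphabet and let $f$ be a finite word over $A$. A word is $f$-free if it does not contain $f$ as a factor (contiguous subword). The word $f$ is Hamming-isometric if for every $n\ge 1$ and all $f$-free words $u,v\in A^n$, the word $u$ can be transformed into $v$ by changing one by one the letters on which $u$ differs from $v$ (each directly into the corresponding letter of $v$, in some order) in such a way that all the words produced are $f$-free. For $A=\mathbb{Z}_2$, let $Q_n^2$ be the graph on $\mathbb{Z}_2^n$ in which two words are adjacent if and only if they differ in exactly one position, and let $Q_n^2(f)$ be its subgraph induced by the $f$-free words; $f$ is Lee-isometric if for every $n\ge 1$ the distance between any two vertices of $Q_n^2(f)$ is the same in $Q_n^2(f)$ as in $Q_n^2$. For every fixed finite alphabet $A$, it can be checked in linear time and space whether a word over $A$ is Hamming-isometric: there are a program of a random access machine and a constant $C$, depending only on $A$ (and on the numbering of its letters by $0,\dots,|A|-1$), such that for every word $f$ of length $n$ over $A$ the program, started with $n$ in a register and with $f$ in its memory, halts after at most $C(n+1)$ steps, uses at most $C(n+1)$ memory cells (the input included), and decides whether $f$ is Hamming-isometric. Here the machine has finitely many registers, words of $O(\log n)$ bits (all numbers that occur are less than $(n+2)^C$),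 and unit cost for each arithmetical operation ($+$, $-$, $\times$, integer division), comparison, load and store. Moreover, a binary word is Lee-isometric if and only if it is Hamming-isometric, so that it can also be checked in linear time and space whether a binary word is Lee-isometric. -/

import Mathlib

/-- A word `u` of length `n` is `f`-free if `f` is not a factor (contiguous subword) of `u`. -/
def IsFree {A : Type*} (f : List A) {n : ℕ} (u : Fin n → A) : Prop :=
  ¬ f <:+: List.ofFn u

/-- One step of an `f`-free transformation towards `v`: a letter of `x` that differs from the
letter of `v` at the same position is replaced by that letter of `v`, and the new word is
`f`-free. -/
def FreeStep {A : Type*} (f : List A) {n : ℕ} (v x y : Fin n → A) : Prop :=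
  ∃ i : Fin n, x i ≠ v i ∧ y = Function.update x i (v i) ∧ IsFree f y

/-- There is an `f`-free transformation from `u` to `v`: the letters on which `u` differs from
`v` are changed one by one into those of `v`, all the words produced being `f`-free. -/
def HasFreeTransformation {A : Type*} (f : List A) {n : ℕ} (u v : Fin n → A) : Prop :=
  Relation.ReflTransGen (FreeStep f v) u v

/-- `f` is `n`-Hamming-isometric. -/
def IsHammingIsometricAt {A : Type*} (f : List A) (n : ℕ) : Prop :=
  ∀ u v : Fin n → A, IsFree f u → IsFree f v → HasFreeTransformation f u v

/-- `f` is Hamming-isometric. -/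
def IsHammingIsometric {A : Type*} (f : List A) : Prop :=
  ∀ n : ℕ, 0 < n → IsHammingIsometricAt f n

/-- The `d`-ary `n`-cube: two words of length `n` over `ZMod d` are adjacent when they differ at
exactly one position, and there by one unit modulo `d`. -/
def dAryCube (d n : ℕ) : SimpleGraph (Fin n → ZMod d) where
  Adj u v := ∃ i : Fin n, u i ≠ v i ∧ (u i = v i + 1 ∨ u i = v i - 1) ∧ ∀ j, j ≠ i → u j = v j
  symm := ⟨by
    rintro u v ⟨i, hne, h, hj⟩
    refine ⟨i, hne.symm, ?_, fun j hji => (hj j hji).symm⟩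
    rcases h with h | h
    · exact Or.inr (by rw [h]; ring)
    · exact Or.inl (by rw [h]; ring)⟩
  loopless := ⟨by
    rintro u ⟨i, hne, _⟩
    exact hne rfl⟩

/-- The `d`-ary `n`-cube avoiding `f`: the vertices that contain `f` as a factor are deleted. -/
def dAryCubeAvoiding (d n : ℕ) (f : List (ZMod d)) :
    SimpleGraph {u : Fin n → ZMod d | IsFree f u} :=
  (dAryCube d n).induce {u | IsFree f u}

/-- `f` is Lee-isometric: for all `n ≥ 1` the distance between two vertices of the `d`-ary
`n`-cube avoiding `f` is the same in it and in the whole cube.  The distance is the extended one,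
so that it is `⊤` for vertices that no path joins. -/
def IsLeeIsometric (d : ℕ) (f : List (ZMod d)) : Prop :=
  ∀ n : ℕ, 0 < n → ∀ u v : {u : Fin n → ZMod d | IsFree f u},
    (dAryCubeAvoiding d n f).edist u v = (dAryCube d n).edist (u : Fin n → ZMod d) v

/-- The state of a random access machine: the registers, and the memory that is addressed by
natural numbers. -/
structure RamState where
  reg : ℕ → ℕ
  mem : ℕ → ℕ

/-- Set register `r` to `x`. -/
def RamState.setReg (s : RamState) (r x : ℕ) : RamState :=
  { s with reg := Function.update s.reg r x }

/-- Set the memory cell with address `a` to `x`. -/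
def RamState.setMem (s : RamState) (a x : ℕ) : RamState :=
  { s with mem := Function.update s.mem a x }

/-- The arithmetical operations of the machine. -/
inductive RamOp where
  | add
  | sub
  | mul
  | div

/-- Natural number arithmetic: `sub` is truncated at `0`, `div` rounds down and `x / 0 = 0`. -/
def RamOp.eval : RamOp → ℕ → ℕ → ℕ
  | add, x, y => x + y
  | sub, x, y => x - y
  | mul, x, y => x * y
  | div, x, y => x / y

/-- Programs of the random access machine.  A program is a finite object: it does not depend on
the input, and it mentions only finitely many registers and finitely many constants. -/
inductive RamProg where
  /-- do nothing -/
  | skip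
  /-- `const r c`: put the constant `c` into register `r` -/
  | const (r c : ℕ)
  /-- `arith o r a b`: put the result of `o` on registers `a` and `b` into register `r` -/
  | arith (o : RamOp) (r a b : ℕ)
  /-- `load r a`: put the content of the cell whose address is in register `a` into `r` -/
  | load (r a : ℕ)
  /-- `store a r`: put register `r` into the cell whose address is in register `a` -/
  | store (a r : ℕ)
  /-- sequential composition -/
  | seq (p q : RamProg)
  /-- `ifLt a b p q`: if register `a` is smaller than register `b` run `p`, otherwise run `q` -/
  | ifLt (a b : ℕ) (p q : RamProg)
  /-- `whileLt a b p`: while register `a` is smaller than register `b` run `p` -/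
  | whileLt (a b : ℕ) (p : RamProg)

/-- `RamExec W S p s s' t`: on a machine whose words hold the numbers below `W` and whose memory
consists of the cells with addresses below `S`, the program `p` started in state `s` halts in
state `s'` after exactly `t` steps.  Each instruction and each test is one step.  An instruction
whose result does not fit into a word, or that addresses a cell outside the memory, cannot be
executed, and then there is no halting run. -/
inductive RamExec (W S : ℕ) : RamProg → RamState → RamState → ℕ → Prop where
  | skip (s : RamState) : RamExec W S .skip s s 1
  | const (s : RamState) (r c : ℕ) (h : c < W) :
      RamExec W S (.const r c) s (s.setReg r c) 1
  | arith (s : RamState) (o : RamOp) (r a b : ℕ) (h : o.eval (s.reg a) (s.reg b) < W) :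
      RamExec W S (.arith o r a b) s (s.setReg r (o.eval (s.reg a) (s.reg b))) 1
  | load (s : RamState) (r a : ℕ) (h : s.reg a < S) :
      RamExec W S (.load r a) s (s.setReg r (s.mem (s.reg a))) 1
  | store (s : RamState) (a r : ℕ) (h : s.reg a < S) :
      RamExec W S (.store a r) s (s.setMem (s.reg a) (s.reg r)) 1
  | seq (s s' s'' : RamState) (p q : RamProg) (t t' : ℕ)
      (hp : RamExec W S p s s' t) (hq : RamExec W S q s' s'' t') :
      RamExec W S (.seq p q) s s'' (t + t')
  | ifTrue (s s' : RamState) (a b : ℕ) (p q : RamProg) (t : ℕ) (h : s.reg a < s.reg b)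
      (hp : RamExec W S p s s' t) : RamExec W S (.ifLt a b p q) s s' (t + 1)
  | ifFalse (s s' : RamState) (a b : ℕ) (p q : RamProg) (t : ℕ) (h : ¬ s.reg a < s.reg b)
      (hq : RamExec W S q s s' t) : RamExec W S (.ifLt a b p q) s s' (t + 1)
  | whileFalse (s : RamState) (a b : ℕ) (p : RamProg) (h : ¬ s.reg a < s.reg b) :
      RamExec W S (.whileLt a b p) s s 1
  | whileTrue (s s' s'' : RamState) (a b : ℕ) (p : RamProg) (t t' : ℕ)
      (h : s.reg a < s.reg b) (hp : RamExec W S p s s' t)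
      (hw : RamExec W S (.whileLt a b p) s' s'' t') :
      RamExec W S (.whileLt a b p) s s'' (t + t' + 1)

/-- The initial state on input `w`: register `0` holds the length of `w`, the cell with address
`i < |w|` holds the number of the letter `w[i]`, and everything else is `0`. -/
def ramInput {A : Type*} {q : ℕ} (e : A ≃ Fin q) (w : List A) : RamState where
  reg := fun r => if r = 0 then w.length else 0
  mem := fun i => if h : i < w.length then (e w[i] : ℕ) else 0

/-- The property `L` of words over the finite alphabet `A`, whose letters are numbered by
`0, …, |A| - 1` in any way, can be checked in linear time and space: some program and some
constant `C`, both independent of the word, are such that on every word of length `n`, with words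
of `O(log n)` bits (the input must fit into them too) and `C * (n + 1)` memory cells (the input
included), the program halts after at most `C * (n + 1)` steps, with `1` in register `0` if the
word has the property and `0` if it has not. -/
def CheckableInLinearTimeAndSpace {A : Type*} [Fintype A] (L : List A → Prop) : Prop :=
  ∀ e : A ≃ Fin (Fintype.card A), ∃ (p : RamProg) (C : ℕ), ∀ w : List A,
    (w.length < (w.length + 2) ^ C ∧ Fintype.card A ≤ (w.length + 2) ^ C ∧
      w.length ≤ C * (w.length + 1)) ∧
    ∃ (s : RamState) (t : ℕ),
      RamExec ((w.length + 2) ^ C) (C * (w.length + 1)) p (ramInput e w) s t ∧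
      t ≤ C * (w.length + 1) ∧
      (L w → s.reg 0 = 1) ∧ (¬ L w → s.reg 0 = 0)

/-! Call a position where `f[0..m-p)` and `f[p..m)` disagree an error of the shift `p`, where `m` is
the length of `f`. The combinatorial core is `isHammingIsometric_iff`: `f` is Hamming-isometric
exactly when no shift has exactly two errors. If no single change of `u` towards `v` keeps it free,
then every differing position lies in a copy of `f` that its change creates, and this copy covers a
second differing position because `v` is free. Two positions lying in each other's copies yield a
two-error shift, and an extremal argument finds them (`exists_twoErrorShift_of_stuck`).

Conversely, two copies of `f` that overlap with two errors can be merged in two crossed ways. The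
words `a` and `b` so obtained differ at two positions, and either change of `a` completes a copy of
`f`. The word `a` is always free; `b` can fail only if `p = 2 * t` and `f` has period `t` up to a
single break. In that case either a larger shift has two errors as well, which allows an induction,
or one residue class modulo `t` reads `xxyy` in `f`, and an explicit pair of words of length `m + 3
* t` is stuck (`TwoErrorShift.hasStuckPair`).

In the binary cube the distance is the Hamming distance. A path of that length changes differing
letters only, each of them once, so it is a free transformation (`isLeeIsometric_two_iff`).

It remains to search for two-error shifts in linear time. Overlaps `l, ..., l + h - 1` are treated
together, with `q = l / 3` and `h` about `q / 2`. Two errors spare one of three consecutive blocks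
of length `q`, so it suffices to look at exact occurrences of the blocks at `0`, `q` and `2 * q`;
the Z-algorithm finds them for all `h` shifts at once. They are less than `q / 2` apart, so their
distances are multiples of the least period of the block. The surroundings of the block and of its
occurrences are therefore compared with one common periodic continuation. A mismatch requires a
deviation from it on at least one side, and a deviation on just one side is a mismatch. Jumping from
deviation to deviation settles a comparison in three rounds, unless one of the first three
deviations on one side meets one of the first three on the other, which happens for at most nine
shifts (`countMismatches_spec`, `card_le_of_earlyCollision`). A group thus costs order `q`, which is
the order of its size `h`, and the sum over all groups is linear (`checkLongOverlaps_spec`). The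
test is written in a small language whose compilation and step counts are verified. -/

set_option linter.constructorNameAsVariable false

/-! ### Words without two-error shifts -/

/-- The words `F[0..m-p)` and `F[p..m)` differ at exactly two positions. -/
def TwoErrorShift {B : Type*} (F : ℕ → B) (m p : ℕ) : Prop :=
  ∃ i j, i < j ∧ j + p < m ∧ F i ≠ F (i + p) ∧ F j ≠ F (j + p) ∧
    ∀ x, x + p < m → x ≠ i → x ≠ j → F x = F (x + p)

/-- The word `F[0..m)` occurs in `w[0..n)` at position `t`. -/
def OccursAt {B : Type*} (F : ℕ → B) (m : ℕ) (w : ℕ → B) (n t : ℕ) : Prop :=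
  t + m ≤ n ∧ ∀ x < m, w (t + x) = F x

theorem isFree_iff_not_occursAt {A : Type*} {f : List A} {F : ℕ → A}
    (hF : ∀ x, (h : x < f.length) → f[x] = F x) {n : ℕ} (w : ℕ → A) :
    IsFree f (fun i : Fin n => w i) ↔ ∀ t, ¬ OccursAt F f.length w n t := by
  unfold IsFree OccursAt
  rw [List.infix_iff_getElem?, ← not_exists, not_iff_not]
  refine exists_congr fun t => ?_
  simp only [List.length_ofFn]
  rw [add_comm]
  refine and_congr_right fun ht => forall_congr' fun x => forall_congr' fun hx => ?_
  have h1 : x + t < n := by omega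
  rw [List.getElem?_ofFn, dif_pos h1, hF x hx, Option.some.injEq, add_comm t x]

/-- On their overlap the two occurrences read two words that both come from `u` by one change, at
`i` and at `j`. These words differ exactly at `i` and `j`, which are thus the errors of the shift `b
- a`. -/
theorem twoErrorShift_of_update {A : Type*} {F : ℕ → A} {m n : ℕ} {u v : ℕ → A} {i j a b : ℕ}
    (hab : a < b) (hij : i ≠ j) (hui : u i ≠ v i) (huj : u j ≠ v j)
    (ha : OccursAt F m (Function.update u i (v i)) n a)
    (hb : OccursAt F m (Function.update u j (v j)) n b)
    (hi : b ≤ i ∧ i < a + m) (hj : b ≤ j ∧ j < a + m) : ∃ p, TwoErrorShift F m p := by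
  have key : ∀ x, x + (b - a) < m → (F x = F (x + (b - a)) ↔ (b + x ≠ i ∧ b + x ≠ j)) := by
    intro x hx
    have h1 := hb.2 x (by omega)
    have h2 := ha.2 (x + (b - a)) hx
    rw [show a + (x + (b - a)) = b + x by omega] at h2
    rw [← h1, ← h2]
    by_cases e1 : b + x = i
    · rw [e1]; simp [hij, hui]
    · by_cases e2 : b + x = j
      · rw [e2]; simp [hij.symm, huj.symm]
      · simp [e1, e2]
  rcases lt_or_gt_of_ne hij with h | h
  · refine ⟨b - a, i - b, j - b, by omega, by omega, ?_, ?_, fun x hx h1 h2 => ?_⟩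
    · rw [Ne, key _ (by omega)]; omega
    · rw [Ne, key _ (by omega)]; omega
    · rw [key _ hx]; omega
  · refine ⟨b - a, j - b, i - b, by omega, by omega, ?_, ?_, fun x hx h1 h2 => ?_⟩
    · rw [Ne, key _ (by omega)]; omega
    · rw [Ne, key _ (by omega)]; omega
    · rw [key _ hx]; omega

/-- If every single change of `u` towards `v` creates an occurrence of `F[0..m)`, then that word
has a shift with two errors. -/
theorem exists_twoErrorShift_of_stuck {A : Type*} {F : ℕ → A} {m n : ℕ} {u v : ℕ → A}
    (hv : ∀ t, ¬ OccursAt F m v n t) (hu : ∀ t, ¬ OccursAt F m u n t)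
    (hD : ∃ i < n, u i ≠ v i)
    (h : ∀ i < n, u i ≠ v i → ∃ t, OccursAt F m (Function.update u i (v i)) n t) :
    ∃ p, TwoErrorShift F m p := by
  by_contra hno
  -- An occurrence created by the change at `i` covers `i`, since `u` is free.
  have hmem : ∀ i < n, u i ≠ v i → ∀ t, OccursAt F m (Function.update u i (v i)) n t →
      t ≤ i ∧ i < t + m := by
    intro i _ _ t ht
    by_contra hc
    refine hu t ⟨ht.1, fun x hx => ?_⟩
    rw [← ht.2 x hx, Function.update_of_ne (by omega)]
  -- It also covers a second differing position, since otherwise it would already be present in `v`.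
  have hother : ∀ i < n, u i ≠ v i → ∀ t, OccursAt F m (Function.update u i (v i)) n t →
      ∃ j < n, u j ≠ v j ∧ j ≠ i ∧ t ≤ j ∧ j < t + m := by
    intro i _ _ t ht
    by_contra hc
    push Not at hc
    refine hv t ⟨ht.1, fun x hx => ?_⟩
    rw [← ht.2 x hx]
    by_cases e : t + x = i
    · rw [e]; simp
    · rw [Function.update_of_ne e]
      by_contra hne
      have := hc (t + x) (by have := ht.1; omega) (fun h => hne h.symm) e (by omega)
      omega
  -- No two differing positions lie in each other's occurrences: different starts would give a
  -- two-error shift, and equal starts would force `u i = v i`.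
  have hpair : ∀ i j a b, i < n → j < n → i ≠ j → u i ≠ v i → u j ≠ v j →
      OccursAt F m (Function.update u i (v i)) n a →
      OccursAt F m (Function.update u j (v j)) n b →
      a ≤ j → j < a + m → b ≤ i → i < b + m → False := by
    intro i j a b hi hj hij hui huj ha hb h1 h2 h3 h4
    have h5 := hmem i hi hui a ha
    have h6 := hmem j hj huj b hb
    rcases lt_trichotomy a b with hlt | heq | hgt
    · exact hno (twoErrorShift_of_update hlt hij hui huj ha hb ⟨h3, h5.2⟩ ⟨h6.1, h2⟩)
    · subst heq
      have e1 := ha.2 (i - a) (by omega)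
      have e2 := hb.2 (i - a) (by omega)
      rw [← e2, show a + (i - a) = i by omega] at e1
      simp [hij] at e1
      exact hui e1.symm
    · exact hno (twoErrorShift_of_update hgt hij.symm huj hui hb ha ⟨h1, h6.2⟩ ⟨h5.1, h4⟩)
  -- The occurrence of `i` also covers a differing position to the right of `i`. If not, let `k` be
  -- the nearest differing position on the left: by induction the occurrence of `k` reaches beyond
  -- `k`, hence at least to `i`, while that of `i` reaches down to `k`, against `hpair`.
  have hup : ∀ i, i < n → u i ≠ v i → ∀ t, OccursAt F m (Function.update u i (v i)) n t →
      ∃ j < n, u j ≠ v j ∧ i < j ∧ j < t + m := by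
    intro i
    induction i using Nat.strong_induction_on with
    | _ i ih =>
      intro hi hui t ht
      by_contra hc
      push Not at hc
      obtain ⟨j, hj, huj, hne, h1, h2⟩ := hother i hi hui t ht
      have hji : j < i := by
        by_contra h3
        have := hc j hj huj (by omega)
        omega
      classical
      let E := (Finset.range i).filter (fun x => u x ≠ v x)
      have hE : E.Nonempty := ⟨j, by simp [E, hji, huj]⟩
      have hk := E.max'_mem hE
      have hjk : j ≤ E.max' hE := E.le_max' j (by simp [E, hji, huj])
      set k := E.max' hE with hkdef
      simp only [E, Finset.mem_filter, Finset.mem_range] at hk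
      obtain ⟨s, hs⟩ := h k (by omega) hk.2
      obtain ⟨l, hl, hul, hkl, hls⟩ := ih k hk.1 (by omega) hk.2 s hs
      have hil : i ≤ l := by
        by_contra h3
        have := E.le_max' l (by simp [E, hul]; omega)
        omega
      have := hmem k (by omega) hk.2 s hs
      have := hmem i hi hui t ht
      exact hpair i k t s hi (by omega) (by omega) hui hk.2 ht hs (by omega) (by omega)
        (by omega) (by omega)
  classical
  let E := (Finset.range n).filter (fun x => u x ≠ v x)
  obtain ⟨i, hi, hui⟩ := hD
  have hE : E.Nonempty := ⟨i, by simp [E, hi, hui]⟩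
  have hk := E.max'_mem hE
  set k := E.max' hE with hkdef
  simp only [E, Finset.mem_filter, Finset.mem_range] at hk
  obtain ⟨s, hs⟩ := h k hk.1 hk.2
  -- The largest differing position has none to its right.
  obtain ⟨l, hl, hul, hkl, -⟩ := hup k hk.1 hk.2 s hs
  have := E.le_max' l (by simp [E, hul, hl])
  omega

theorem hammingDist_update_add_one {A : Type*} [DecidableEq A] {n : ℕ} {u v : Fin n → A} {i : Fin n}
    (hi : u i ≠ v i) : hammingDist (Function.update u i (v i)) v + 1 = hammingDist u v := by
  have : (Finset.univ.filter fun j => Function.update u i (v i) j ≠ v j) =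
      (Finset.univ.filter fun j => u j ≠ v j).erase i := by
    ext j
    by_cases e : j = i
    · subst e; simp
    · simp [e]
  unfold hammingDist
  rw [this, Finset.card_erase_add_one (by simp [hi])]

/-- A word without two-error shifts is Hamming-isometric. -/
theorem isHammingIsometric_of_forall_not_twoErrorShift {A : Type*} {f : List A} {F : ℕ → A}
    (hF : ∀ x, (h : x < f.length) → f[x] = F x) (h : ∀ p, ¬ TwoErrorShift F f.length p) :
    IsHammingIsometric f := by
  classical
  intro n _ u v hu hv
  suffices H : ∀ k, ∀ u : Fin n → A, hammingDist u v = k → IsFree f u →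
      HasFreeTransformation f u v from H _ u rfl hu
  clear u hu
  intro k
  induction k with
  | zero =>
    intro u hk hu
    rw [hammingDist_eq_zero] at hk
    subst hk
    exact Relation.ReflTransGen.refl
  | succ k ih =>
    intro u hk hu
    by_cases hstep : ∃ i, u i ≠ v i ∧ IsFree f (Function.update u i (v i))
    · obtain ⟨i, hi, hfree⟩ := hstep
      refine Relation.ReflTransGen.head ⟨i, hi, rfl, hfree⟩ (ih _ ?_ hfree)
      have := hammingDist_update_add_one hi
      omega
    · exfalso
      push Not at hstep
      have hne : u ≠ v := by
        intro e
        rw [e, hammingDist_self] at hk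
        omega
      obtain ⟨i₀, hi₀⟩ := Function.ne_iff.mp hne
      -- The letter beyond position `n` is irrelevant; `u i₀` merely shows that there is one.
      let ext : (Fin n → A) → ℕ → A := fun w x => if hx : x < n then w ⟨x, hx⟩ else u i₀
      have hext : ∀ w : Fin n → A, (fun i : Fin n => ext w i) = w := by
        intro w; funext i; simp [ext]
      have hfree : ∀ w, IsFree f w → ∀ t, ¬ OccursAt F f.length (ext w) n t := by
        intro w hw
        rwa [← isFree_iff_not_occursAt hF, hext]
      obtain ⟨p, hp⟩ := exists_twoErrorShift_of_stuck (hfree v hv) (hfree u hu)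
        ⟨i₀, i₀.2, by simpa [ext] using hi₀⟩ (fun i hi hui => by
          have h1 := hstep ⟨i, hi⟩ (by simpa [ext, hi] using hui)
          have h2 : Function.update u ⟨i, hi⟩ (v ⟨i, hi⟩) =
              fun j : Fin n => Function.update (ext u) i (ext v i) j := by
            funext j
            by_cases e : j = ⟨i, hi⟩
            · subst e; simp [ext, hi]
            · have e' : (j : ℕ) ≠ i := fun h => e (Fin.ext h)
              simp [e, e', ext]
          rw [h2, isFree_iff_not_occursAt hF] at h1
          push Not at h1
          exact h1)
      exact h p hp

/-! ### From a two-error shift to a stuck pair of words -/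

/-- An occurrence strictly between two overlapping occurrences with one error each. -/
theorem OccursAt.shift_eq {A : Type*} {F w : ℕ → A} {m p e₀ e₁ t : ℕ}
    (h0 : ∀ y < m, y ≠ e₀ → w y = F y) (he0 : e₀ < m) (hw0 : w e₀ ≠ F e₀)
    (hp : ∀ x < m, p + x ≠ e₁ → w (p + x) = F x) (he1 : p ≤ e₁ ∧ e₁ < p + m)
    (hw1 : w e₁ ≠ F (e₁ - p)) (ht : OccursAt F m w (m + p) t) :
    0 < t ∧ t < p ∧ (∀ x, x + t < m → x + t ≠ e₀ → F x = F (x + t)) ∧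
      ∀ x, x + (p - t) < m → x + p ≠ e₁ → F x = F (x + (p - t)) := by
  have htp : t ≤ p := by have := ht.1; omega
  have ht0 : t ≠ 0 := by
    rintro rfl
    have := ht.2 e₀ he0
    rw [zero_add] at this
    exact hw0 this
  have htp' : t ≠ p := by
    rintro rfl
    have := ht.2 (e₁ - t) (by omega)
    rw [show t + (e₁ - t) = e₁ by omega] at this
    exact hw1 this
  -- Compared with the first copy, the occurrence gives `F` the period `t`; compared with the second
  -- one, the period `p - t`; each with one position excepted.
  refine ⟨by omega, by omega, fun x hx hne => ?_, fun x hx hne => ?_⟩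
  · rw [← ht.2 x (by omega), ← h0 (x + t) hx hne, add_comm]
  · rw [← ht.2 (x + (p - t)) hx, show t + (x + (p - t)) = p + x by omega, hp x (by omega) (by omega)]

/-- A pair of distinct `F`-free words such that every single change of the first one towards the
second one creates an occurrence of `F[0..m)`. -/
def HasStuckPair {A : Type*} (F : ℕ → A) (m : ℕ) : Prop :=
  ∃ (n : ℕ) (u v : ℕ → A), (∀ t, ¬ OccursAt F m u n t) ∧ (∀ t, ¬ OccursAt F m v n t) ∧
    (∃ i < n, u i ≠ v i) ∧
    ∀ i < n, u i ≠ v i → ∃ t, OccursAt F m (Function.update u i (v i)) n t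

theorem not_isHammingIsometric_of_hasStuckPair {A : Type*} {f : List A} {F : ℕ → A}
    (hF : ∀ x, (h : x < f.length) → f[x] = F x) (h : HasStuckPair F f.length) :
    ¬ IsHammingIsometric f := by
  obtain ⟨n, u, v, hu, hv, ⟨i, hi, hne⟩, hstuck⟩ := h
  intro hiso
  have hT := hiso n (by omega) (fun i : Fin n => u i) (fun i : Fin n => v i)
    ((isFree_iff_not_occursAt hF u).2 hu) ((isFree_iff_not_occursAt hF v).2 hv)
  rcases Relation.ReflTransGen.cases_head hT with heq | ⟨y, ⟨j, hj, rfl, hfree⟩, -⟩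
  · exact hne (congrFun heq ⟨i, hi⟩)
  · obtain ⟨t, ht⟩ := hstuck j j.2 hj
    have h2 : Function.update (fun i : Fin n => u i) j (v j) =
        fun k : Fin n => Function.update u j (v j) k := by
      funext k
      by_cases e : k = j
      · subst e; simp
      · have e' : (k : ℕ) ≠ j := fun h => e (Fin.ext h)
        simp [e, e']
    rw [h2, isFree_iff_not_occursAt hF] at hfree
    exact hfree t ht

/-! ### The exceptional case: a period with one break -/

/-- `F[0..m)` has period `t` up to one single error, between `i + t` and `i + 2 * t`, which is at
distance at least `2 * t` from both ends of its residue class. -/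
structure OneBreakPeriodic {A : Type*} (F : ℕ → A) (m i t : ℕ) : Prop where
  pos : 0 < t
  lt : i + 3 * t < m
  ne : F (i + t) ≠ F (i + 2 * t)
  eq : ∀ x, x + t < m → x ≠ i + t → F x = F (x + t)

/-- The two words that merge the two copies of `F` at distance `p`. -/
theorem TwoErrorShift.hasStuckPair_or {A : Type*} {F : ℕ → A} {m p : ℕ}
    (h : TwoErrorShift F m p) :
    HasStuckPair F m ∨ ∃ i t, p = 2 * t ∧ OneBreakPeriodic F m i t := by
  obtain ⟨i, j, hij, hj, hi', hj', heq⟩ := h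
  -- At `p + i` the copy at `0` requires `F (i + p)` and the copy at `p` requires `F i`; similarly
  -- at `p + j`. The word `a` follows the first copy at `p + i` and the second one at `p + j`, and
  -- `b` does the opposite. So in `a` each copy has one error, which one change towards `b` repairs.
  let a : ℕ → A := fun y => if y < p + j then F y else F (y - p)
  let b : ℕ → A := fun y => if y = p + i then F i else if y ≤ p + j then F y else F (y - p)
  have ai : a (p + i) = F (i + p) := by simp [a, hij, add_comm]
  have aj : a (p + j) = F j := by simp [a]
  have bi : b (p + i) = F i := by simp [b]
  have bj : b (p + j) = F (j + p) := by
    simp only [b]; rw [if_neg (by omega), if_pos le_rfl, add_comm]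
  have a0 : ∀ y < m, y ≠ p + j → a y = F y := by
    intro y hy hne
    simp only [a]
    split_ifs with h1
    · rfl
    · rw [heq (y - p) (by omega) (by omega) (by omega)]; congr 1; omega
  have ap : ∀ x < m, p + x ≠ p + i → a (p + x) = F x := by
    intro x hx hne
    simp only [a]
    split_ifs with h1
    · rw [heq x (by omega) (by omega) (by omega), add_comm]
    · congr 1; omega
  have b0 : ∀ y < m, y ≠ p + i → b y = F y := by
    intro y hy hne
    simp only [b]
    rw [if_neg hne]
    split_ifs with h1
    · rfl
    · rw [heq (y - p) (by omega) (by omega) (by omega)]; congr 1; omega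
  have bp : ∀ x < m, p + x ≠ p + j → b (p + x) = F x := by
    intro x hx hne
    simp only [b]
    split_ifs with h1 h2
    · congr 1; omega
    · rw [heq x (by omega) (by omega) (by omega), add_comm]
    · congr 1; omega
  have hab : ∀ y < m + p, a y ≠ b y → y = p + i ∨ y = p + j := by
    intro y hy hne
    by_contra hc
    push Not at hc
    apply hne
    by_cases h1 : y < m
    · rw [a0 y h1 hc.2, b0 y h1 hc.1]
    · have h2 := ap (y - p) (by omega) (by omega)
      have h3 := bp (y - p) (by omega) (by omega)
      rw [show p + (y - p) = y by omega] at h2 h3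
      rw [h2, h3]
  -- Going from `i` to `i + p` by way of `i + t` avoids both exceptional positions, so `F i = F (i +
  -- p)` would follow.
  have afree : ∀ t, ¬ OccursAt F m a (m + p) t := by
    intro t ht
    obtain ⟨h1, h2, h3, h4⟩ := ht.shift_eq a0 (by omega) (by rw [aj, add_comm]; exact hj') ap
      (by omega) (by rw [ai]; simpa using hi'.symm)
    by_cases h5 : i + t = p + j
    · omega
    · apply hi'
      rw [h3 i (by omega) h5, h4 (i + t) (by omega) (by omega)]
      congr 1; omega
  by_cases bfree : ∀ t, ¬ OccursAt F m b (m + p) t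
  · left
    refine ⟨m + p, a, b, afree, bfree, ⟨p + i, by omega, by rw [ai, bi]; exact hi'.symm⟩, ?_⟩
    intro y hy hne
    rcases hab y hy hne with rfl | rfl
    · refine ⟨p, by omega, fun x hx => ?_⟩
      by_cases e : x = i
      · subst e; simp [bi]
      · rw [Function.update_of_ne (by omega), ap x hx (by omega)]
    · refine ⟨0, by omega, fun x hx => ?_⟩
      by_cases e : x = p + j
      · subst e; simp [bj, add_comm]
      · rw [Function.update_of_ne (by omega), zero_add, a0 x hx e]
  · right
    push Not at bfree
    obtain ⟨t, ht⟩ := bfree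
    obtain ⟨h1, h2, h3, h4⟩ := ht.shift_eq b0 (by omega) (by rw [bi, add_comm]; exact hi') bp
      (by omega) (by rw [bj]; simpa using hj'.symm)
    -- For `b` the detour from `i` is blocked only if `i + t = j`, and the detour from `j` only if
    -- `j + t = i + p`. Together these give `p = 2 * t`.
    have hji : j = i + t := by
      by_contra h5
      apply hi'
      rw [h3 i (by omega) (by omega), h4 (i + t) (by omega) (by omega)]
      congr 1; omega
    have hpt : p = 2 * t := by
      by_contra h5
      apply hj'
      rw [h3 j (by omega) (by omega), h4 (j + t) (by omega) (by omega)]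
      congr 1; omega
    subst hji hpt
    have h5 := h3 i (by omega) (by omega)
    refine ⟨i, t, rfl, h1, by omega, ?_, fun x hx hne => h3 x hx (by omega)⟩
    rwa [← h5]

namespace OneBreakPeriodic

variable {A : Type*} {F : ℕ → A} {m i t : ℕ}

theorem eq_add_mul (h : OneBreakPeriodic F m i t) {y : ℕ} (k : ℕ) (hy : y + k * t < m)
    (hne : ∀ l < k, y + l * t ≠ i + t) : F y = F (y + k * t) := by
  induction k with
  | zero => simp
  | succ k ih =>
    rw [add_mul] at hy
    rw [ih (by omega) (fun l hl => hne l (by omega)), h.eq (y + k * t) (by omega) (hne k (by omega))]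
    congr 1; ring

/-- A larger shift with two errors, unless there are just two letters on each side of the break. -/
theorem exists_twoErrorShift (h : OneBreakPeriodic F m i t) (hlong : t ≤ i ∨ i + 4 * t < m) :
    ∃ p, 2 * t < p ∧ TwoErrorShift F m p := by
  have ht := h.pos
  have hm := h.lt
  obtain ⟨i₀, r, hi₀, rfl⟩ : ∃ i₀ r, i₀ < t ∧ i = i₀ + r * t :=
    ⟨i % t, i / t, Nat.mod_lt _ ht, by rw [mul_comm]; exact (Nat.mod_add_div i t).symm⟩
  -- The residue class of `i` has the `k + 2` positions `i₀ + l * t` with `l ≤ k + 1`. Within it the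
  -- shift by `k * t` compares just the first two letters with the last two.
  obtain ⟨k, hk1, hk2⟩ : ∃ k, i₀ + (k + 1) * t < m ∧ m ≤ i₀ + (k + 2) * t := by
    refine ⟨(m - 1 - i₀) / t - 1, ?_, ?_⟩
    · have h1 : 1 ≤ (m - 1 - i₀) / t := by
        rw [Nat.le_div_iff_mul_le ht]; have := Nat.zero_le (r * t); omega
      rw [Nat.sub_add_cancel h1]
      have := Nat.div_mul_le_self (m - 1 - i₀) t
      have := Nat.zero_le (r * t)
      omega
    · have h1 : 1 ≤ (m - 1 - i₀) / t := by
        rw [Nat.le_div_iff_mul_le ht]; have := Nat.zero_le (r * t); omega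
      rw [show (m - 1 - i₀) / t - 1 + 2 = (m - 1 - i₀) / t + 1 by omega]
      have := Nat.lt_div_mul_add (a := m - 1 - i₀) ht
      rw [add_mul]
      omega
  have hrk : r + 2 ≤ k := by
    by_contra hc
    have : (k + 2) * t ≤ (r + 3) * t := Nat.mul_le_mul_right _ (by omega)
    nlinarith
  have hk3 : 3 ≤ k := by
    by_contra hc
    have h1 : (k + 2) * t ≤ 4 * t := Nat.mul_le_mul_right _ (by omega)
    have h2 : r = 0 := by omega
    subst h2
    omega
  -- The class is constant up to index `r + 1` and, with another letter, from `r + 2` on. As `r + 2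
  -- ≤ k`, its first two and last two letters lie on different sides of the break.
  have e1 : ∀ l ≤ r + 1, F (i₀ + l * t) = F (i₀ + r * t + t) := by
    intro l hl
    have h2 : i₀ + l * t + (r + 1 - l) * t = i₀ + r * t + t := by
      obtain ⟨s, hs⟩ := Nat.exists_eq_add_of_le hl
      rw [hs, show l + s - l = s by omega]
      have : r = l + s - 1 := by omega
      calc i₀ + l * t + s * t = i₀ + (l + s) * t := by ring
        _ = i₀ + (r + 1) * t := by rw [hs]
        _ = _ := by ring
    rw [h.eq_add_mul (y := i₀ + l * t) (r + 1 - l) (by omega), h2]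
    intro l' hl'
    have : l' * t + t ≤ (r + 1 - l) * t := by
      calc l' * t + t = (l' + 1) * t := by ring
        _ ≤ _ := Nat.mul_le_mul_right _ (by omega)
    omega
  have e2 : ∀ l, r + 2 ≤ l → i₀ + l * t < m → F (i₀ + l * t) = F (i₀ + r * t + 2 * t) := by
    intro l hl hlm
    obtain ⟨s, rfl⟩ := Nat.exists_eq_add_of_le hl
    have h2 : i₀ + (r + 2 + s) * t = i₀ + r * t + 2 * t + s * t := by ring
    rw [h2, ← h.eq_add_mul s (by omega)]
    intro l' hl'
    have := Nat.zero_le (l' * t)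
    omega
  have hkt : (k + 1) * t = k * t + t := by ring
  have hkt2 : (k + 2) * t = k * t + 2 * t := by ring
  refine ⟨k * t, ?_, i₀, i₀ + t, by omega, by omega, ?_, ?_, ?_⟩
  · have : 3 * t ≤ k * t := Nat.mul_le_mul_right _ hk3
    omega
  · have h1 := e1 0 (by omega)
    rw [zero_mul, add_zero] at h1
    rw [h1, e2 k hrk (by omega)]
    exact h.ne
  · have h1 := e1 1 (by omega)
    rw [one_mul] at h1
    have h2 := e2 (k + 1) (by omega) (by omega)
    rw [show i₀ + (k + 1) * t = i₀ + t + k * t by ring] at h2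
    rw [h1, h2]
    exact h.ne
  · intro x hx h1 h2
    -- If the break were met on the way, `x` would lie in the class of `i₀` with index at least `2`,
    -- and `x + k * t` would be beyond the end.
    refine h.eq_add_mul k hx fun l hl hc => ?_
    have hmod : x % t = i₀ := by
      have h3 := congrArg (· % t) hc
      simpa [Nat.mod_eq_of_lt hi₀, Nat.add_mod] using h3
    have hx2 := Nat.mod_add_div x t
    rw [hmod] at hx2
    have h3 : 2 ≤ x / t := by
      by_contra h4
      have h5 : x / t = 0 ∨ x / t = 1 := Nat.le_one_iff_eq_zero_or_eq_one.1 (by omega)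
      rcases h5 with h5 | h5
      · rw [h5] at hx2; omega
      · rw [h5] at hx2; omega
    have : t * 2 ≤ t * (x / t) := Nat.mul_le_mul_left _ h3
    omega

/-- The word of period `t` outside the class of `i`, on which it is given by `K`. -/
def fill (F : ℕ → A) (i t : ℕ) (K : ℕ → A) (y : ℕ) : A :=
  if y % t = i then K (y / t) else F (y % t)

/-- As `i < t`, the class starts at `i` itself, and the break lies between its indices `1` and `2`.
-/
theorem eq_fill (h : OneBreakPeriodic F m i t) (hi : i < t) {y : ℕ} (hy : y < m) :
    F y = fill F i t (fun k => if k ≤ 1 then F i else F (i + 2 * t)) y := by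
  have ht := h.pos
  have hm := h.lt
  have hy2 := Nat.mod_add_div y t
  unfold fill
  by_cases h1 : y % t = i
  on_goal 1 =>
    rw [if_pos h1]
    change F y = if y / t ≤ 1 then F i else F (i + 2 * t)
    split_ifs with h2
  · have h3 : y / t = 0 ∨ y / t = 1 := Nat.le_one_iff_eq_zero_or_eq_one.1 (by omega)
    rcases h3 with h3 | h3
    · rw [h3] at hy2; congr 1; omega
    · rw [h3] at hy2; rw [h.eq i (by omega) (by omega)]; congr 1; omega
  · obtain ⟨s, hs⟩ := Nat.exists_eq_add_of_le (show 2 ≤ y / t by omega)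
    rw [hs, h1] at hy2
    have h4 : i + 2 * t + s * t = y := by rw [← hy2]; ring
    rw [h.eq_add_mul (y := i + 2 * t) s (by omega), h4]
    intro l' hl'
    have := Nat.zero_le (l' * t)
    omega
  · rw [mul_comm] at hy2
    rw [if_neg h1]
    symm
    rw [h.eq_add_mul (y := y % t) (y / t) (by omega), hy2]
    intro l hl hc
    apply h1
    have h3 := congrArg (· % t) hc
    simpa [Nat.mod_eq_of_lt hi, Nat.add_mod] using h3

/-- In `F` the class of `i` carries two different letters, whereas every other class of the filled
word is constant; so an occurrence starts at a multiple of `t`. It then depends on four consecutive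
letters of `K` only, because `m ≤ i + 4 * t` leaves just four letters of `F` in the class. -/
theorem occursAt_fill_iff (h : OneBreakPeriodic F m i t) (hi : i < t) (hm : m ≤ i + 4 * t)
    (K : ℕ → A) : (∃ s, OccursAt F m (fill F i t K) (m + 3 * t) s) ↔
      ∃ k ≤ 3, K k = F i ∧ K (k + 1) = F i ∧ K (k + 2) = F (i + 2 * t) ∧
        K (k + 3) = F (i + 2 * t) := by
  have ht := h.pos
  have hm' := h.lt
  have hne : F i ≠ F (i + 2 * t) := by
    rw [h.eq i (by omega) (by omega)]; exact h.ne
  have hdiv : ∀ k l : ℕ, (t * k + (i + l * t)) / t = k + l ∧ (t * k + (i + l * t)) % t = i := by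
    intro k l
    rw [show t * k + (i + l * t) = i + t * (k + l) by ring]
    simp [Nat.add_mul_div_left _ _ ht, Nat.div_eq_of_lt hi, Nat.mod_eq_of_lt hi]
  constructor
  · rintro ⟨s, hs, hocc⟩
    have hs2 := Nat.mod_add_div s t
    by_cases hmod : s % t = 0
    · rw [hmod, zero_add] at hs2
      have hk : s / t ≤ 3 := by
        by_contra hc
        have : t * 4 ≤ t * (s / t) := Nat.mul_le_mul_left _ (by omega)
        omega
      have key : ∀ l, i + l * t < m → K (s / t + l) = if l ≤ 1 then F i else F (i + 2 * t) := by
        intro l hl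
        have h1 := hocc (i + l * t) hl
        rw [h.eq_fill hi hl, ← hs2] at h1
        have h2 := hdiv 0 l
        rw [mul_zero, zero_add, zero_add] at h2
        simpa [fill, hdiv, h2] using h1
      exact ⟨s / t, hk, by simpa using key 0 (by omega), by simpa using key 1 (by omega),
        by simpa using key 2 (by omega), by simpa using key 3 (by omega)⟩
    · exfalso
      have hcl : ∀ l, (s + (i + l * t)) % t = (s + i) % t := by
        intro l; rw [← add_assoc]; simp
      have hni : (s + i) % t ≠ i := by
        intro hc
        apply hmod
        have h1 : (s + i) % t = (0 + i) % t := by rw [hc, zero_add, Nat.mod_eq_of_lt hi]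
        have h2 : s ≡ 0 [MOD t] := Nat.ModEq.add_right_cancel' i h1
        simpa [Nat.ModEq] using h2
      have h1 := hocc (i + 0 * t) (by omega)
      have h2 := hocc (i + 2 * t) (by omega)
      unfold fill at h1 h2
      rw [hcl, if_neg hni] at h1 h2
      apply hne
      rw [← h2, h1]; simp
  · rintro ⟨k, hk, h0, h1, h2, h3⟩
    refine ⟨t * k, ?_, fun x hx => ?_⟩
    · have : t * k ≤ t * 3 := Nat.mul_le_mul_left _ hk
      omega
    · rw [h.eq_fill hi hx]
      unfold fill
      rw [Nat.mul_add_mod, Nat.mul_add_div ht]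
      by_cases h4 : x % t = i
      on_goal 1 =>
        rw [if_pos h4, if_pos h4]
        change K (k + x / t) = if x / t ≤ 1 then F i else F (i + 2 * t)
        split_ifs with h5
      · have h6 : x / t = 0 ∨ x / t = 1 := Nat.le_one_iff_eq_zero_or_eq_one.1 (by omega)
        rcases h6 with h6 | h6 <;> rw [h6]
        · simpa using h0
        · exact h1
      · have h6 : x / t < 4 := by
          rw [Nat.div_lt_iff_lt_mul ht]
          have := Nat.mod_add_div x t
          by_contra hc
          have h7 : x - 4 * t < t * 0 + i := by omega
          have h8 : (x - 4 * t + 4 * t) % t = x % t := by congr 1; omega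
          rw [Nat.add_mul_mod_self_right, h4, Nat.mod_eq_of_lt (by omega)] at h8
          omega
        have h7 : x / t = 2 ∨ x / t = 3 := by omega
        rcases h7 with h7 | h7 <;> rw [h7]
        · exact h2
        · exact h3
      · rw [if_neg h4, if_neg h4]

/-- With `a` and `b` for the letters before and after the break, occurrences correspond to factors
`aabb` of `K`. The words `aababbb` and `aaababb` have no such factor and differ at the indices `2`,
`3`, `4`; changing just one of these letters in the first word creates `aabb` at index `2`, `0` or
`3`, respectively. -/
theorem hasStuckPair (h : OneBreakPeriodic F m i t) (hi : i < t) (hm : m ≤ i + 4 * t) :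
    HasStuckPair F m := by
  classical
  have ht := h.pos
  have hm' := h.lt
  have hne : F i ≠ F (i + 2 * t) := by
    rw [h.eq i (by omega) (by omega)]; exact h.ne
  set a := F i with ha
  set b := F (i + 2 * t) with hb
  let U : ℕ → A := fun k => if k = 0 ∨ k = 1 ∨ k = 3 then a else b
  let V : ℕ → A := fun k => if k ≤ 2 ∨ k = 4 then a else b
  have hfree : ∀ K : ℕ → A, (¬ ∃ k ≤ 3, K k = a ∧ K (k + 1) = a ∧ K (k + 2) = b ∧ K (k + 3) = b) →
      ∀ s, ¬ OccursAt F m (fill F i t K) (m + 3 * t) s := by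
    intro K hK s hs
    exact hK ((h.occursAt_fill_iff hi hm K).1 ⟨s, hs⟩)
  refine ⟨m + 3 * t, fill F i t U, fill F i t V, hfree U ?_, hfree V ?_, ⟨i + 2 * t, by omega, ?_⟩, ?_⟩
  · rintro ⟨k, hk, h0, h1, h2, h3⟩
    interval_cases k <;> simp [U, hne, hne.symm] at h0 h1 h2 h3
  · rintro ⟨k, hk, h0, h1, h2, h3⟩
    interval_cases k <;> simp [V, hne, hne.symm] at h0 h1 h2 h3
  · have h1 : (i + 2 * t) % t = i := by simp [Nat.mod_eq_of_lt hi]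
    have h2 : (i + 2 * t) / t = 2 := by
      rw [Nat.add_mul_div_right _ _ ht, Nat.div_eq_of_lt hi]
    simp [fill, h1, h2, U, V, hne.symm]
  · intro y hy hUV
    have hyi : y % t = i := by
      by_contra hc
      simp [fill, hc] at hUV
    have hy7 : y / t < 7 := by
      rw [Nat.div_lt_iff_lt_mul ht]
      by_contra hc
      have h8 : (y - 7 * t + 7 * t) % t = y % t := by congr 1; omega
      rw [Nat.add_mul_mod_self_right, hyi, Nat.mod_eq_of_lt (by omega)] at h8
      omega
    have hy2 := Nat.mod_add_div y t
    have hupd : Function.update (fill F i t U) y (fill F i t V y) =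
        fill F i t (Function.update U (y / t) (V (y / t))) := by
      funext z
      by_cases e : z = y
      · subst e; simp [fill, hyi]
      · rw [Function.update_of_ne e]
        unfold fill
        split_ifs with h1
        · rw [Function.update_of_ne]
          intro hc
          apply e
          rw [← Nat.mod_add_div z t, ← hy2, hc, h1, hyi]
        · rfl
    rw [hupd, h.occursAt_fill_iff hi hm]
    simp only [fill, hyi, if_true] at hUV
    generalize y / t = k at *
    interval_cases k <;> simp [U, V] at hUV
    · exact ⟨2, by omega, by simp [U, V, ← ha, ← hb]⟩
    · exact ⟨0, by omega, by simp [U, V, ← ha, ← hb]⟩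
    · exact ⟨3, by omega, by simp [U, V, ← ha, ← hb]⟩

end OneBreakPeriodic

/-- Induction on `m - p`: where the merged words fail, there is a larger two-error shift or the
explicit pair applies. -/
theorem TwoErrorShift.hasStuckPair {A : Type*} {F : ℕ → A} {m p : ℕ} (h : TwoErrorShift F m p) :
    HasStuckPair F m := by
  have hlt : ∀ p, TwoErrorShift F m p → p < m := by
    rintro p ⟨i, j, -, hj, -⟩
    omega
  by_contra hc
  suffices H : ∀ k p, m - p = k → ¬ TwoErrorShift F m p from H _ p rfl h
  intro k
  induction k using Nat.strong_induction_on with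
  | _ k ih =>
    intro p hk hp
    rcases hp.hasStuckPair_or with h1 | ⟨i, t, rfl, h1⟩
    · exact hc h1
    · by_cases hl : t ≤ i ∨ i + 4 * t < m
      · obtain ⟨p', hp', hp2⟩ := h1.exists_twoErrorShift hl
        have := hlt _ hp
        exact ih (m - p') (by omega) p' rfl hp2
      · push Not at hl
        exact hc (h1.hasStuckPair hl.1 hl.2)

/-- A word is Hamming-isometric if and only if none of its shifts has exactly two errors. -/
theorem isHammingIsometric_iff {A : Type*} {f : List A} {F : ℕ → A}
    (hF : ∀ x, (h : x < f.length) → f[x] = F x) :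
    IsHammingIsometric f ↔ ∀ p, ¬ TwoErrorShift F f.length p :=
  ⟨fun h _ hp => not_isHammingIsometric_of_hasStuckPair hF hp.hasStuckPair h,
    isHammingIsometric_of_forall_not_twoErrorShift hF⟩

/-! ### Distances in the binary cube -/

theorem dAryCube_two_adj_iff {n : ℕ} {u w : Fin n → ZMod 2} :
    (dAryCube 2 n).Adj u w ↔ ∃ i, u i ≠ w i ∧ w = Function.update u i (w i) := by
  have h2 : ∀ a b : ZMod 2, a ≠ b → (a = b + 1 ∨ a = b - 1) := by decide
  constructor
  · rintro ⟨i, hne, -, h⟩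
    refine ⟨i, hne, ?_⟩
    funext j
    by_cases e : j = i
    · subst e; simp
    · simp [e, h j e]
  · rintro ⟨i, hne, h⟩
    refine ⟨i, hne, h2 _ _ hne, fun j hj => ?_⟩
    rw [h, Function.update_of_ne hj]

theorem hammingDist_update_of_eq {A : Type*} [DecidableEq A] {n : ℕ} {u v : Fin n → A} {i : Fin n}
    {a : A} (hi : u i = v i) (ha : a ≠ v i) :
    hammingDist (Function.update u i a) v = hammingDist u v + 1 := by
  have := hammingDist_update_add_one (u := Function.update u i a) (v := v) (i := i) (by simpa using ha)
  rw [← this, Function.update_idem, ← hi, Function.update_eq_self]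

theorem hammingDist_le_of_adj {n : ℕ} {u w : Fin n → ZMod 2} (v : Fin n → ZMod 2)
    (h : (dAryCube 2 n).Adj u w) : hammingDist u v ≤ hammingDist w v + 1 := by
  obtain ⟨i, hne, h⟩ := dAryCube_two_adj_iff.1 h
  have h1 : hammingDist u w = 1 := by
    have := hammingDist_update_add_one hne
    rw [← h, hammingDist_self] at this
    omega
  have := hammingDist_triangle u w v
  omega

theorem hammingDist_le_length {n : ℕ} {u v : Fin n → ZMod 2} (p : (dAryCube 2 n).Walk u v) :
    hammingDist u v ≤ p.length := by
  induction p with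
  | nil => simp
  | cons h p ih =>
    rw [SimpleGraph.Walk.length_cons]
    exact (hammingDist_le_of_adj _ h).trans (by omega)

theorem exists_walk_dAryCube_two {n : ℕ} (v : Fin n → ZMod 2) (k : ℕ) :
    ∀ u, hammingDist u v = k → ∃ p : (dAryCube 2 n).Walk u v, p.length = k := by
  induction k with
  | zero =>
    intro u hu
    rw [hammingDist_eq_zero] at hu
    subst hu
    exact ⟨.nil, rfl⟩
  | succ k ih =>
    intro u hu
    have hne : u ≠ v := by
      rintro rfl
      simp at hu
    obtain ⟨i, hi⟩ := Function.ne_iff.mp hne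
    have h1 := hammingDist_update_add_one hi
    obtain ⟨p, hp⟩ := ih (Function.update u i (v i)) (by omega)
    refine ⟨.cons (dAryCube_two_adj_iff.2 ⟨i, by simpa using hi, by simp⟩) p, ?_⟩
    simp [hp]

theorem edist_dAryCube_two {n : ℕ} (u v : Fin n → ZMod 2) :
    (dAryCube 2 n).edist u v = hammingDist u v := by
  apply le_antisymm
  · obtain ⟨p, hp⟩ := exists_walk_dAryCube_two v _ u rfl
    rw [← hp]
    exact SimpleGraph.edist_le p
  · by_cases h : (dAryCube 2 n).edist u v = ⊤
    · rw [h]; exact le_top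
    · obtain ⟨p, hp⟩ := SimpleGraph.exists_walk_of_edist_ne_top h
      rw [← hp]
      exact_mod_cast hammingDist_le_length p

/-- Forget that the words of a walk are `f`-free. -/
def dAryCubeAvoidingHom (d n : ℕ) (f : List (ZMod d)) : dAryCubeAvoiding d n f →g dAryCube d n where
  toFun u := u.1
  map_rel' h := h

theorem hammingDist_le_edist_dAryCubeAvoiding {n : ℕ} {f : List (ZMod 2)}
    (u v : {u : Fin n → ZMod 2 | IsFree f u}) :
    (hammingDist u.1 v.1 : ℕ∞) ≤ (dAryCubeAvoiding 2 n f).edist u v := by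
  by_cases h : (dAryCubeAvoiding 2 n f).edist u v = ⊤
  · rw [h]; exact le_top
  · obtain ⟨p, hp⟩ := SimpleGraph.exists_walk_of_edist_ne_top h
    rw [← hp]
    have := hammingDist_le_length (p.map (dAryCubeAvoidingHom 2 n f))
    rw [SimpleGraph.Walk.length_map] at this
    exact_mod_cast this

theorem exists_walk_of_hasFreeTransformation {n : ℕ} {f : List (ZMod 2)} {u v : Fin n → ZMod 2}
    (h : HasFreeTransformation f u v) (hu : IsFree f u) (hv : IsFree f v) :
    ∃ p : (dAryCubeAvoiding 2 n f).Walk ⟨u, hu⟩ ⟨v, hv⟩, p.length = hammingDist u v := by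
  induction h using Relation.ReflTransGen.head_induction_on with
  | refl => exact ⟨.nil, by simp⟩
  | head hstep _ ih =>
    obtain ⟨i, hi, rfl, hfree⟩ := hstep
    obtain ⟨p, hp⟩ := ih hfree
    rename_i x _
    have hadj : (dAryCube 2 n).Adj x (Function.update x i (v i)) :=
      dAryCube_two_adj_iff.2 ⟨i, by simpa using hi, by simp⟩
    have hadj' : (dAryCubeAvoiding 2 n f).Adj ⟨x, hu⟩ ⟨_, hfree⟩ := hadj
    exact ⟨.cons hadj' p, by
      rw [SimpleGraph.Walk.length_cons, hp, hammingDist_update_add_one hi]⟩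

/-- A step lowers the Hamming distance to `v` by at most one, so on a path this short every step
must lower it. Such a step changes a differing letter, and over two letters the new one can only be
that of `v`. -/
theorem hasFreeTransformation_of_walk {n : ℕ} {f : List (ZMod 2)}
    {u v : {u : Fin n → ZMod 2 | IsFree f u}} (p : (dAryCubeAvoiding 2 n f).Walk u v)
    (hp : p.length ≤ hammingDist u.1 v.1) : HasFreeTransformation f u.1 v.1 := by
  induction p with
  | nil => exact Relation.ReflTransGen.refl
  | @cons u w v h p ih =>
    have hlen := hammingDist_le_length (p.map (dAryCubeAvoidingHom 2 n f))
    rw [SimpleGraph.Walk.length_map] at hlen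
    change hammingDist w.1 v.1 ≤ p.length at hlen
    rw [SimpleGraph.Walk.length_cons] at hp
    obtain ⟨i, hne, hw⟩ := dAryCube_two_adj_iff.1 (show (dAryCube 2 n).Adj u.1 w.1 from h)
    have h3 : ∀ a b c : ZMod 2, a ≠ b → a ≠ c → b = c := by decide
    by_cases hi : u.1 i = v.1 i
    · have := hammingDist_update_of_eq (a := w.1 i) hi (by rw [← hi]; exact hne.symm)
      rw [← hw] at this
      omega
    · have hwv := h3 _ _ _ hne hi
      rw [hwv] at hw
      refine Relation.ReflTransGen.head ⟨i, hi, hw, w.2⟩ (ih ?_)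
      have := hammingDist_update_add_one hi
      rw [← hw] at this
      omega

/-- For binary words, Lee-isometric means Hamming-isometric. -/
theorem isLeeIsometric_two_iff (f : List (ZMod 2)) : IsLeeIsometric 2 f ↔ IsHammingIsometric f := by
  refine forall_congr' fun n => forall_congr' fun _ => ⟨fun h u v hu hv => ?_, fun h u v => ?_⟩
  · have h1 := h ⟨u, hu⟩ ⟨v, hv⟩
    rw [edist_dAryCube_two] at h1
    obtain ⟨p, hp⟩ := SimpleGraph.exists_walk_of_edist_eq_coe h1
    exact hasFreeTransformation_of_walk p hp.le
  · rw [edist_dAryCube_two]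
    apply le_antisymm _ (hammingDist_le_edist_dAryCubeAvoiding u v)
    obtain ⟨p, hp⟩ := exists_walk_of_hasFreeTransformation (h u.1 v.1 u.2 v.2) u.2 v.2
    rw [← hp]
    exact SimpleGraph.edist_le p

/-! ### A small imperative language on top of the random access machine -/

/-- The variables of the language, each kept in a register. -/
inductive Var where
  | n | res | l0 | q | hh | p0 | c | len | k | z | l | r | go | per | i | fst | lst | found
  | up | dn | ua | ub | la | lb | anc | x | y | d | lim | cnt
  deriving DecidableEq

/-- The arrays of the language, each of the same length. -/
inductive Arr where
  | F | W | Z | A | B | NA | NB | Cnt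
  deriving DecidableEq

/-- The register of a variable. -/
def Var.idx (v : Var) : ℕ := v.ctorIdx + 2

theorem Var.idx_injective {v w : Var} (h : v.idx = w.idx) : v = w := by
  have h : v.ctorIdx = w.ctorIdx := by simpa [Var.idx] using h
  rw [← Var.ofNat_ctorIdx v, ← Var.ofNat_ctorIdx w, h]

/-- The registers `0` and `1` are kept for the input length and the stride; those from `60` on are
working space for expressions. -/
theorem Var.idx_lt (v : Var) : v.idx < 60 := by cases v <;> decide

theorem Var.two_le_idx (v : Var) : 2 ≤ v.idx := by unfold Var.idx; omega

/-- The position of an array in the memory. -/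
def Arr.idx (k : Arr) : ℕ := k.ctorIdx

theorem Arr.idx_injective {k l : Arr} (h : k.idx = l.idx) : k = l := by
  rw [← Arr.ofNat_ctorIdx k, ← Arr.ofNat_ctorIdx l]; exact congrArg _ h

theorem Arr.idx_lt (k : Arr) : k.idx < 8 := by cases k <;> decide

/-- The values of the variables and of the arrays. -/
structure HState where
  var : Var → ℕ
  arr : Arr → ℕ → ℕ

namespace HState

/-- Assign to a variable. -/
def setV (s : HState) (v : Var) (x : ℕ) : HState := { s with var := Function.update s.var v x }

/-- Assign to an array element. -/
def setA (s : HState) (k : Arr) (i x : ℕ) : HState :=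
  { s with arr := Function.update s.arr k (Function.update (s.arr k) i x) }

@[simp] theorem setV_var (s : HState) (v w : Var) (x : ℕ) :
    (s.setV v x).var w = if w = v then x else s.var w := by
  simp [setV, Function.update_apply]

@[simp] theorem setV_arr (s : HState) (v : Var) (x : ℕ) : (s.setV v x).arr = s.arr := rfl

@[simp] theorem setA_var (s : HState) (k : Arr) (i x : ℕ) : (s.setA k i x).var = s.var := rfl

@[simp] theorem setA_arr_self (s : HState) (k : Arr) (i x j : ℕ) :
    (s.setA k i x).arr k j = if j = i then x else s.arr k j := by
  simp [setA, Function.update_apply]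

theorem setA_arr_of_ne (s : HState) {k l : Arr} (i x : ℕ) (h : l ≠ k) :
    (s.setA k i x).arr l = s.arr l := by
  simp [setA, h]

end HState

/-- Expressions. -/
inductive Exp where
  | lit (c : ℕ)
  | var (v : Var)
  | op (o : RamOp) (a b : Exp)
  | mod (a b : Exp)
  | get (k : Arr) (e : Exp)

prefix:max "⇡" => Exp.var

namespace Exp

instance : Add Exp := ⟨.op .add⟩
instance : Sub Exp := ⟨.op .sub⟩
instance : Mul Exp := ⟨.op .mul⟩
instance : Div Exp := ⟨.op .div⟩
instance (c : ℕ) : OfNat Exp c := ⟨.lit c⟩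

/-- The smaller one of two values. -/
protected def min (a b : Exp) : Exp := a - (a - b)

/-- The value of an expression. -/
def eval (s : HState) : Exp → ℕ
  | lit c => c
  | var v => s.var v
  | op o a b => o.eval (a.eval s) (b.eval s)
  | mod a b => a.eval s % b.eval s
  | get k e => s.arr k (e.eval s)

/-- The number of steps that the evaluation takes. -/
def cost : Exp → ℕ
  | lit _ => 1
  | var _ => 2
  | op _ a b => a.cost + b.cost + 1
  | mod a b => a.cost + b.cost + 3
  | get _ e => e.cost + 4

/-- Evaluation into register `t`, with the registers from `t` on as working space. -/
def compile : Exp → ℕ → RamProg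
  | lit c, t => .const t c
  -- In the absence of an instruction that copies a register, `0` is added to it.
  | var v, t => .seq (.const t 0) (.arith .add t v.idx t)
  | op o a b, t => .seq (a.compile t) (.seq (b.compile (t + 1)) (.arith o t t (t + 1)))
  | mod a b, t => .seq (a.compile t) (.seq (b.compile (t + 1))
      (.seq (.arith .div (t + 2) t (t + 1)) (.seq (.arith .mul (t + 2) (t + 2) (t + 1))
        (.arith .sub t t (t + 2)))))
  | get k e, t => .seq (e.compile t) (.seq (.const (t + 1) k.idx)
      (.seq (.arith .mul (t + 1) (t + 1) 1) (.seq (.arith .add t t (t + 1)) (.load t t))))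

section eval
variable (s : HState) (a b : Exp)
@[simp] theorem eval_add : (a + b).eval s = a.eval s + b.eval s := rfl
@[simp] theorem eval_sub : (a - b).eval s = a.eval s - b.eval s := rfl
@[simp] theorem eval_mul : (a * b).eval s = a.eval s * b.eval s := rfl
@[simp] theorem eval_div : (a / b).eval s = a.eval s / b.eval s := rfl
@[simp] theorem eval_min : (Exp.min a b).eval s = min (a.eval s) (b.eval s) := by
  change a.eval s - (a.eval s - b.eval s) = _
  omega
@[simp] theorem eval_mod : (Exp.mod a b).eval s = a.eval s % b.eval s := rfl
@[simp] theorem eval_get (k : Arr) : (Exp.get k a).eval s = s.arr k (a.eval s) := rfl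
@[simp] theorem eval_var (v : Var) : (Exp.var v).eval s = s.var v := rfl
@[simp] theorem eval_ofNat (c : ℕ) : (no_index (OfNat.ofNat c) : Exp).eval s = c := rfl
end eval

end Exp

/-- Word bound, number of memory cells, and length of each array. -/
structure Machine where
  W : ℕ
  S : ℕ
  D : ℕ
  pos : 0 < D
  word : 8 * D ≤ W
  space : 8 * D ≤ S

/-- All intermediate results fit into words and all indices are in range. -/
def Exp.Ok (M : Machine) (s : HState) : Exp → Prop
  | lit c => c < M.W
  | var _ => True
  | op o a b => a.Ok M s ∧ b.Ok M s ∧ o.eval (a.eval s) (b.eval s) < M.W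
  | mod a b => a.Ok M s ∧ b.Ok M s ∧ a.eval s < M.W
  | get _ e => e.Ok M s ∧ e.eval s < M.D

namespace Exp
section ok
variable (M : Machine) (s : HState) (a b : Exp)
@[simp] theorem ok_add : (a + b).Ok M s ↔ a.Ok M s ∧ b.Ok M s ∧ a.eval s + b.eval s < M.W := Iff.rfl
@[simp] theorem ok_sub : (a - b).Ok M s ↔ a.Ok M s ∧ b.Ok M s ∧ a.eval s - b.eval s < M.W := Iff.rfl
@[simp] theorem ok_mul : (a * b).Ok M s ↔ a.Ok M s ∧ b.Ok M s ∧ a.eval s * b.eval s < M.W := Iff.rfl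
@[simp] theorem ok_div : (a / b).Ok M s ↔ a.Ok M s ∧ b.Ok M s ∧ a.eval s / b.eval s < M.W := Iff.rfl
@[simp] theorem ok_mod : (Exp.mod a b).Ok M s ↔ a.Ok M s ∧ b.Ok M s ∧ a.eval s < M.W := Iff.rfl
@[simp] theorem ok_get (k : Arr) : (Exp.get k a).Ok M s ↔ a.Ok M s ∧ a.eval s < M.D := Iff.rfl
@[simp] theorem ok_var (v : Var) : (Exp.var v).Ok M s ↔ True := Iff.rfl
@[simp] theorem ok_ofNat (c : ℕ) : (no_index (OfNat.ofNat c) : Exp).Ok M s ↔ c < M.W := Iff.rfl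
@[simp] theorem ok_min : (Exp.min a b).Ok M s ↔
    a.Ok M s ∧ b.Ok M s ∧ a.eval s - b.eval s < M.W ∧ min (a.eval s) (b.eval s) < M.W := by
  unfold Exp.min
  simp only [ok_sub, eval_sub]
  rw [show a.eval s - (a.eval s - b.eval s) = min (a.eval s) (b.eval s) by omega]
  tauto
end ok
end Exp

/-- The machine state `σ` represents `s`. -/
structure Represents (M : Machine) (σ : RamState) (s : HState) : Prop where
  stride : σ.reg 1 = M.D
  var : ∀ v : Var, σ.reg v.idx = s.var v
  lt : ∀ v : Var, s.var v < M.W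
  arr : ∀ (k : Arr) (i : ℕ), i < M.D → σ.mem (k.idx * M.D + i) = s.arr k i

/-- Evaluating an expression touches working registers only, so the represented state survives it.
-/
theorem Represents.congr {M : Machine} {σ σ' : RamState} {s : HState} (h : Represents M σ s)
    (hreg : ∀ r < 60, σ'.reg r = σ.reg r) (hmem : σ'.mem = σ.mem) : Represents M σ' s where
  stride := by rw [hreg 1 (by norm_num), h.stride]
  var v := by rw [hreg _ v.idx_lt, h.var]
  lt := h.lt
  arr k i hi := by rw [hmem, h.arr k i hi]

theorem Machine.address_lt (M : Machine) (k : Arr) {i : ℕ} (hi : i < M.D) :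
    k.idx * M.D + i < 8 * M.D := by
  have := Nat.mul_le_mul_right M.D (show k.idx ≤ 7 by have := k.idx_lt; omega)
  omega

theorem RamState.setReg_reg (s : RamState) (r x r' : ℕ) :
    (s.setReg r x).reg r' = if r' = r then x else s.reg r' := by
  simp [RamState.setReg, Function.update_apply]

theorem RamState.setReg_mem (s : RamState) (r x : ℕ) : (s.setReg r x).mem = s.mem := rfl

theorem Exp.exec_compile (M : Machine) (s : HState) (e : Exp) (he : e.Ok M s) :
    ∀ (t : ℕ) (_ : 60 ≤ t) (σ : RamState), Represents M σ s →
      ∃ σ', RamExec M.W M.S (e.compile t) σ σ' e.cost ∧ σ'.reg t = e.eval s ∧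
        (∀ r < t, σ'.reg r = σ.reg r) ∧ σ'.mem = σ.mem := by
  have hW := M.word
  have hS := M.space
  have hD := M.pos
  induction e with
  | lit c =>
    intro t ht σ hσ
    exact ⟨_, .const σ t c he, by simp [RamState.setReg_reg, Exp.eval],
      fun r hr => by rw [RamState.setReg_reg, if_neg (by omega)], rfl⟩
  | var v =>
    intro t ht σ hσ
    have hv := v.idx_lt
    have h1 : RamOp.add.eval ((σ.setReg t 0).reg v.idx) ((σ.setReg t 0).reg t) = s.var v := by
      simp only [RamOp.eval, RamState.setReg_reg]
      rw [if_neg (by omega), hσ.var]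
      simp
    refine ⟨_, .seq _ _ _ _ _ 1 1 (.const σ t 0 (by omega)) (.arith _ .add t v.idx t ?_), ?_, ?_, rfl⟩
    · rw [h1]; exact hσ.lt v
    · rw [h1]; simp [RamState.setReg_reg, Exp.eval]
    · intro r hr
      simp [RamState.setReg_reg, show r ≠ t by omega]
  | op o a b iha ihb =>
    intro t ht σ hσ
    obtain ⟨ha, hb, hv⟩ := he
    obtain ⟨σ₁, e₁, v₁, f₁, m₁⟩ := iha ha t ht σ hσ
    have hσ₁ := hσ.congr (fun r hr => f₁ r (by omega)) m₁
    obtain ⟨σ₂, e₂, v₂, f₂, m₂⟩ := ihb hb (t + 1) (by omega) σ₁ hσ₁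
    have h1 : o.eval (σ₂.reg t) (σ₂.reg (t + 1)) = o.eval (a.eval s) (b.eval s) := by
      rw [v₂, f₂ t (by omega), v₁]
    refine ⟨σ₂.setReg t (o.eval (σ₂.reg t) (σ₂.reg (t + 1))), ?_, ?_, ?_, ?_⟩
    · have e := RamExec.seq _ _ _ _ _ _ _ e₁
        (.seq _ _ _ _ _ _ 1 e₂ (.arith _ o t t (t + 1) (by rw [h1]; exact hv)))
      rw [← Nat.add_assoc] at e
      exact e
    · rw [h1]; simp [RamState.setReg_reg, Exp.eval]
    · intro r hr
      rw [RamState.setReg_reg, if_neg (by omega), f₂ r (by omega), f₁ r hr]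
    · rw [RamState.setReg_mem, m₂, m₁]
  | mod a b iha ihb =>
    intro t ht σ hσ
    obtain ⟨ha, hb, hv⟩ := he
    obtain ⟨σ₁, e₁, v₁, f₁, m₁⟩ := iha ha t ht σ hσ
    have hσ₁ := hσ.congr (fun r hr => f₁ r (by omega)) m₁
    obtain ⟨σ₂, e₂, v₂, f₂, m₂⟩ := ihb hb (t + 1) (by omega) σ₁ hσ₁
    have ha' : σ₂.reg t = a.eval s := by rw [f₂ t (by omega), v₁]
    set x := a.eval s
    set y := b.eval s
    -- Neither the quotient nor its product with `y` exceeds `x`, so a bound for the dividend is all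
    -- that is needed, even if `y = 0`.
    have hdiv : x / y ≤ x := Nat.div_le_self _ _
    have hmul : x / y * y ≤ x := Nat.div_mul_le_self _ _
    let σ₃ := σ₂.setReg (t + 2) (x / y)
    let σ₄ := σ₃.setReg (t + 2) (x / y * y)
    have e₃ : RamExec M.W M.S (.arith .div (t + 2) t (t + 1)) σ₂ σ₃ 1 := by
      have := RamExec.arith (W := M.W) (S := M.S) σ₂ .div (t + 2) t (t + 1)
        (by rw [ha', v₂]; simp only [RamOp.eval]; omega)
      rwa [ha', v₂] at this
    have r₃ : σ₃.reg (t + 2) = x / y ∧ σ₃.reg (t + 1) = y := by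
      simp [σ₃, RamState.setReg_reg, v₂]
    have e₄ : RamExec M.W M.S (.arith .mul (t + 2) (t + 2) (t + 1)) σ₃ σ₄ 1 := by
      have := RamExec.arith (W := M.W) (S := M.S) σ₃ .mul (t + 2) (t + 2) (t + 1)
        (by rw [r₃.1, r₃.2]; simp only [RamOp.eval]; omega)
      rwa [r₃.1, r₃.2] at this
    have r₄ : σ₄.reg t = x ∧ σ₄.reg (t + 2) = x / y * y := by
      simp [σ₄, σ₃, RamState.setReg_reg, ha']
    have hval : RamOp.sub.eval (σ₄.reg t) (σ₄.reg (t + 2)) = x % y := by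
      rw [r₄.1, r₄.2]
      have := Nat.div_add_mod x y
      rw [mul_comm] at this
      simp only [RamOp.eval]
      omega
    refine ⟨σ₄.setReg t (x % y), ?_, ?_, ?_, ?_⟩
    · have e₅ := RamExec.arith (W := M.W) (S := M.S) σ₄ .sub t t (t + 2)
        (by rw [hval]; exact (Nat.mod_le x y).trans_lt hv)
      rw [hval] at e₅
      have e := RamExec.seq _ _ _ _ _ _ _ e₁
        (.seq _ _ _ _ _ _ 3 e₂ (.seq _ _ _ _ _ 1 2 e₃ (.seq _ _ _ _ _ 1 1 e₄ e₅)))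
      rw [← Nat.add_assoc] at e
      exact e
    · simp [RamState.setReg_reg, Exp.eval, x, y]
    · intro r hr
      simp only [σ₄, σ₃, RamState.setReg_reg]
      rw [if_neg (by omega), if_neg (by omega), if_neg (by omega), f₂ r (by omega), f₁ r hr]
    · simp only [σ₄, σ₃, RamState.setReg_mem, m₂, m₁]
  | get k e ih =>
    intro t ht σ hσ
    obtain ⟨ha, hi⟩ := he
    obtain ⟨σ₁, e₁, v₁, f₁, m₁⟩ := ih ha t ht σ hσ
    set i := e.eval s
    have hk := k.idx_lt
    have hadr := M.address_lt k hi
    have h0 : k.idx * M.D ≤ k.idx * M.D + i := Nat.le_add_right _ _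
    let σ₂ := σ₁.setReg (t + 1) k.idx
    let σ₃ := σ₂.setReg (t + 1) (k.idx * M.D)
    let σ₄ := σ₃.setReg t (k.idx * M.D + i)
    have r₂ : σ₂.reg (t + 1) = k.idx ∧ σ₂.reg 1 = M.D := by
      constructor
      · simp [σ₂, RamState.setReg_reg]
      · simp only [σ₂, RamState.setReg_reg]
        rw [if_neg (by omega), f₁ 1 (by omega), hσ.stride]
    have e₃ : RamExec M.W M.S (.arith .mul (t + 1) (t + 1) 1) σ₂ σ₃ 1 := by
      have := RamExec.arith (W := M.W) (S := M.S) σ₂ .mul (t + 1) (t + 1) 1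
        (by rw [r₂.1, r₂.2]; simp only [RamOp.eval]; omega)
      rwa [r₂.1, r₂.2] at this
    have r₃ : σ₃.reg t = i ∧ σ₃.reg (t + 1) = k.idx * M.D := by
      simp [σ₃, σ₂, RamState.setReg_reg, v₁]
    have e₄ : RamExec M.W M.S (.arith .add t t (t + 1)) σ₃ σ₄ 1 := by
      have := RamExec.arith (W := M.W) (S := M.S) σ₃ .add t t (t + 1)
        (by rw [r₃.1, r₃.2]; simp only [RamOp.eval]; omega)
      rw [r₃.1, r₃.2] at this
      simpa only [RamOp.eval, σ₄, add_comm] using this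
    have r₄ : σ₄.reg t = k.idx * M.D + i := by simp [σ₄, RamState.setReg_reg]
    have e₅ := RamExec.load (W := M.W) (S := M.S) σ₄ t t (by rw [r₄]; omega)
    have hval : σ₄.mem (σ₄.reg t) = s.arr k i := by
      rw [r₄]
      simp only [σ₄, σ₃, σ₂, RamState.setReg_mem, m₁]
      exact hσ.arr k i hi
    rw [hval] at e₅
    refine ⟨_, .seq _ _ _ _ _ _ 4 e₁ (.seq _ _ _ _ _ 1 3 (.const _ _ _ (by omega))
      (.seq _ _ _ _ _ 1 2 e₃ (.seq _ _ _ _ _ 1 1 e₄ e₅))), ?_, ?_, ?_⟩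
    · simp [RamState.setReg_reg, Exp.eval, i]
    · intro r hr
      simp only [σ₄, σ₃, σ₂, RamState.setReg_reg]
      rw [if_neg (by omega), if_neg (by omega), if_neg (by omega), if_neg (by omega), f₁ r hr]
    · simp only [σ₄, σ₃, σ₂, RamState.setReg_mem, m₁]

/-- Statements. -/
inductive Stmt where
  | skip
  | set (v : Var) (e : Exp)
  | put (k : Arr) (i e : Exp)
  | seq (P Q : Stmt)
  | ifLt (a b : Exp) (P Q : Stmt)
  | ifEq (a b : Exp) (P Q : Stmt)
  | loop (a b : Exp) (P : Stmt)

infixr:60 " ;; " => Stmt.seq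
infix:62 " ≔ " => Stmt.set

namespace Stmt

/-- Count the variable `v` up from `0` to the value of `N`. -/
def count (v N : Var) (P : Stmt) : Stmt := v ≔ 0 ;; loop ⇡v ⇡N (P ;; v ≔ ⇡v + 1)

/-- The program of a statement. -/
def compile : Stmt → RamProg
  | skip => .skip
  | set v e => .seq (e.compile 60) (.seq (.const 61 0) (.arith .add v.idx 60 61))
  | put k i e => .seq (i.compile 60) (.seq (.const 61 k.idx) (.seq (.arith .mul 61 61 1)
      (.seq (.arith .add 60 60 61) (.seq (e.compile 61) (.store 60 61)))))
  | seq P Q => .seq P.compile Q.compile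
  | ifLt a b P Q => .seq (a.compile 60) (.seq (b.compile 61) (.ifLt 60 61 P.compile Q.compile))
  | ifEq a b P Q => .seq (a.compile 60) (.seq (b.compile 61)
      (.ifLt 60 61 Q.compile (.ifLt 61 60 Q.compile P.compile)))
  -- `whileLt` compares registers, so both sides of the test are evaluated before the loop and again
  -- at the end of every round.
  | loop a b P => .seq (.seq (a.compile 60) (b.compile 61))
      (.whileLt 60 61 (.seq P.compile (.seq (a.compile 60) (b.compile 61))))

/-- A bound for the number of steps of a statement without loops. -/
def cost : Stmt → ℕ
  | skip => 1
  | set _ e => e.cost + 2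
  | put _ i e => i.cost + e.cost + 4
  | seq P Q => P.cost + Q.cost
  | ifLt a b P Q => a.cost + b.cost + 1 + max P.cost Q.cost
  | ifEq a b P Q => a.cost + b.cost + 2 + max P.cost Q.cost
  | loop _ _ _ => 0

/-- The variables to which a statement may assign. -/
def writes : Stmt → Var → Bool
  | skip, _ => false
  | set v _, w => decide (w = v)
  | put _ _ _, _ => false
  | seq P Q, w => P.writes w || Q.writes w
  | ifLt _ _ P Q, w => P.writes w || Q.writes w
  | ifEq _ _ P Q, w => P.writes w || Q.writes w
  | loop _ _ P, w => P.writes w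

/-- The arrays to which a statement may assign. -/
def puts : Stmt → Arr → Bool
  | skip, _ => false
  | set _ _, _ => false
  | put k _ _, l => decide (l = k)
  | seq P Q, l => P.puts l || Q.puts l
  | ifLt _ _ P Q, l => P.puts l || Q.puts l
  | ifEq _ _ P Q, l => P.puts l || Q.puts l
  | loop _ _ P, l => P.puts l

/-- The weakest precondition of a statement without loops. -/
def wp (M : Machine) : Stmt → (HState → Prop) → HState → Prop
  | skip, Q, s => Q s
  | set v e, Q, s => e.Ok M s ∧ e.eval s < M.W ∧ Q (s.setV v (e.eval s))
  | put k i e, Q, s => i.Ok M s ∧ e.Ok M s ∧ i.eval s < M.D ∧ Q (s.setA k (i.eval s) (e.eval s))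
  | seq P P', Q, s => P.wp M (P'.wp M Q) s
  | ifLt a b P P', Q, s => a.Ok M s ∧ b.Ok M s ∧ (a.eval s < b.eval s → P.wp M Q s) ∧
      (¬ a.eval s < b.eval s → P'.wp M Q s)
  | ifEq a b P P', Q, s => a.Ok M s ∧ b.Ok M s ∧ (a.eval s = b.eval s → P.wp M Q s) ∧
      (a.eval s ≠ b.eval s → P'.wp M Q s)
  | loop _ _ _, _, _ => False

end Stmt

attribute [simp] Stmt.wp

/-! ### Total correctness with step bounds -/

/-- What a statement does not assign to is unchanged. -/
def Frame (P : Stmt) (s s' : HState) : Prop :=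
  (∀ v, P.writes v = false → s'.var v = s.var v) ∧ ∀ k, P.puts k = false → s'.arr k = s.arr k

theorem Frame.refl (P : Stmt) (s : HState) : Frame P s s := ⟨fun _ _ => rfl, fun _ _ => rfl⟩

theorem Frame.trans {P : Stmt} {s s' s'' : HState} (h : Frame P s s') (h' : Frame P s' s'') :
    Frame P s s'' :=
  ⟨fun v hv => (h'.1 v hv).trans (h.1 v hv), fun k hk => (h'.2 k hk).trans (h.2 k hk)⟩

theorem Frame.mono {P P' : Stmt} {s s' : HState} (h : Frame P s s')
    (hv : ∀ v, P'.writes v = false → P.writes v = false)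
    (hk : ∀ k, P'.puts k = false → P.puts k = false) : Frame P' s s' :=
  ⟨fun v h' => h.1 v (hv v h'), fun k h' => h.2 k (hk k h')⟩

/-- Started in `s`, the statement `P` halts after at most `T` steps in a state that satisfies `Q`. -/
def HT (M : Machine) (P : Stmt) (s : HState) (T : ℕ) (Q : HState → Prop) : Prop :=
  ∀ σ, Represents M σ s → ∃ σ' t s', RamExec M.W M.S P.compile σ σ' t ∧ t ≤ T ∧
    Represents M σ' s' ∧ Frame P s s' ∧ Q s'

namespace HT

variable {M : Machine} {P P' : Stmt} {s : HState} {T T' : ℕ} {Q Q' : HState → Prop} {a b : Exp}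

theorem mono (h : HT M P s T Q) (hT : T ≤ T') (hQ : ∀ s', Frame P s s' → Q s' → Q' s') :
    HT M P s T' Q' := by
  intro σ hσ
  obtain ⟨σ', t, s', h1, h2, h3, h4, h5⟩ := h σ hσ
  exact ⟨σ', t, s', h1, h2.trans hT, h3, h4, hQ s' h4 h5⟩

theorem skip (h : Q s) : HT M .skip s 1 Q :=
  fun σ hσ => ⟨σ, 1, s, .skip σ, le_rfl, hσ, Frame.refl _ _, h⟩

theorem set {v : Var} {e : Exp} (hok : e.Ok M s) (hlt : e.eval s < M.W)
    (h : Q (s.setV v (e.eval s))) : HT M (v ≔ e) s (e.cost + 2) Q := by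
  intro σ hσ
  have hW := M.word
  have hD := M.pos
  obtain ⟨σ₁, e₁, v₁, f₁, m₁⟩ := e.exec_compile M s hok 60 le_rfl σ hσ
  have hσ₁ := hσ.congr f₁ m₁
  have e₂ := RamExec.arith (W := M.W) (S := M.S) (σ₁.setReg 61 0) .add v.idx 60 61
    (by simpa [RamState.setReg_reg, RamOp.eval, v₁] using hlt)
  have hval : RamOp.add.eval ((σ₁.setReg 61 0).reg 60) ((σ₁.setReg 61 0).reg 61) = e.eval s := by
    simp [RamState.setReg_reg, RamOp.eval, v₁]
  rw [hval] at e₂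
  refine ⟨_, _, s.setV v (e.eval s), .seq _ _ _ _ _ _ 2 e₁ (.seq _ _ _ _ _ 1 1
    (.const _ _ _ (by omega)) e₂), le_rfl, ?_, ?_, h⟩
  · have hv := v.idx_lt
    have hv2 := v.two_le_idx
    refine ⟨?_, fun w => ?_, fun w => ?_, fun k i hi => ?_⟩
    · simp only [RamState.setReg_reg]
      rw [if_neg (by omega), if_neg (by omega), hσ₁.stride]
    · simp only [RamState.setReg_reg, HState.setV_var]
      by_cases hw : w = v
      · subst hw; simp
      · rw [if_neg (fun h => hw (Var.idx_injective h)), if_neg (by have := w.idx_lt; omega), if_neg hw,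
          hσ₁.var]
    · simp only [HState.setV_var]
      split_ifs
      · exact hlt
      · exact hσ.lt w
    · exact hσ₁.arr k i hi
  · exact ⟨fun w hw => by simp [Stmt.writes] at hw; simp [hw], fun k _ => rfl⟩

theorem put {k : Arr} {i e : Exp} (hoki : i.Ok M s) (hok : e.Ok M s) (hlt : i.eval s < M.D)
    (h : Q (s.setA k (i.eval s) (e.eval s))) : HT M (.put k i e) s (i.cost + e.cost + 4) Q := by
  intro σ hσ
  have hW := M.word
  have hS := M.space
  have hD := M.pos
  have hadr := M.address_lt k hlt
  have hk := k.idx_lt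
  have h0 : k.idx * M.D ≤ k.idx * M.D + i.eval s := Nat.le_add_right _ _
  obtain ⟨σ₁, e₁, v₁, f₁, m₁⟩ := i.exec_compile M s hoki 60 le_rfl σ hσ
  let σ₂ := σ₁.setReg 61 k.idx
  let σ₃ := σ₂.setReg 61 (k.idx * M.D)
  let σ₄ := σ₃.setReg 60 (k.idx * M.D + i.eval s)
  have r₂ : σ₂.reg 61 = k.idx ∧ σ₂.reg 1 = M.D := by
    constructor
    · simp [σ₂, RamState.setReg_reg]
    · simp only [σ₂, RamState.setReg_reg]
      rw [if_neg (by omega), f₁ 1 (by omega), hσ.stride]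
  have e₃ : RamExec M.W M.S (.arith .mul 61 61 1) σ₂ σ₃ 1 := by
    have := RamExec.arith (W := M.W) (S := M.S) σ₂ .mul 61 61 1
      (by rw [r₂.1, r₂.2]; simp only [RamOp.eval]; omega)
    rwa [r₂.1, r₂.2] at this
  have r₃ : σ₃.reg 60 = i.eval s ∧ σ₃.reg 61 = k.idx * M.D := by
    simp [σ₃, σ₂, RamState.setReg_reg, v₁]
  have e₄ : RamExec M.W M.S (.arith .add 60 60 61) σ₃ σ₄ 1 := by
    have := RamExec.arith (W := M.W) (S := M.S) σ₃ .add 60 60 61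
      (by rw [r₃.1, r₃.2]; simp only [RamOp.eval]; omega)
    rw [r₃.1, r₃.2] at this
    simpa only [RamOp.eval, σ₄, add_comm] using this
  have f₄ : ∀ r < 60, σ₄.reg r = σ.reg r := by
    intro r hr
    simp only [σ₄, σ₃, σ₂, RamState.setReg_reg]
    rw [if_neg (by omega), if_neg (by omega), if_neg (by omega), f₁ r hr]
  have hσ₄ : Represents M σ₄ s := hσ.congr f₄ m₁
  have r₄ : σ₄.reg 60 = k.idx * M.D + i.eval s := by simp [σ₄, RamState.setReg_reg]
  obtain ⟨σ₅, e₅, v₅, f₅, m₅⟩ := e.exec_compile M s hok 61 (by norm_num) σ₄ hσ₄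
  have hσ₅ := hσ₄.congr (fun r hr => f₅ r (by omega)) m₅
  have r₅ : σ₅.reg 60 = k.idx * M.D + i.eval s := by rw [f₅ 60 (by norm_num), r₄]
  have e₆ := RamExec.store (W := M.W) (S := M.S) σ₅ 60 61 (by rw [r₅]; omega)
  rw [r₅, v₅] at e₆
  refine ⟨_, i.cost + (1 + (1 + (1 + (e.cost + 1)))), s.setA k (i.eval s) (e.eval s),
    .seq _ _ _ _ _ _ _ e₁ (.seq _ _ _ _ _ _ _ (.const _ _ _ (by omega))
      (.seq _ _ _ _ _ _ _ e₃ (.seq _ _ _ _ _ _ _ e₄ (.seq _ _ _ _ _ _ _ e₅ e₆)))), by omega,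
    ⟨hσ₅.stride, hσ₅.var, hσ₅.lt, fun l j hj => ?_⟩, ?_, h⟩
  · simp only [RamState.setMem, Function.update_apply]
    by_cases hl : l = k
    · subst hl
      simp [hσ₅.arr l j hj]
    · rw [HState.setA_arr_of_ne _ _ _ hl, if_neg, hσ₅.arr l j hj]
      intro hc
      apply hl
      apply Arr.idx_injective
      -- Division by the stride recovers the array from the address, so different arrays do not
      -- overlap.
      have h1 : (l.idx * M.D + j) / M.D = (k.idx * M.D + i.eval s) / M.D := by rw [hc]
      rwa [mul_comm, mul_comm k.idx, Nat.mul_add_div hD, Nat.mul_add_div hD, Nat.div_eq_of_lt hj,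
        Nat.div_eq_of_lt hlt] at h1
  · exact ⟨fun w _ => rfl, fun l hl => HState.setA_arr_of_ne _ _ _ (by simpa [Stmt.puts] using hl)⟩

theorem seq {R : HState → Prop} (h : HT M P s T R)
    (h' : ∀ s', Frame P s s' → R s' → HT M P' s' T' Q) : HT M (P ;; P') s (T + T') Q := by
  intro σ hσ
  obtain ⟨σ', t, s', h1, h2, h3, h4, h5⟩ := h σ hσ
  obtain ⟨σ'', t', s'', h1', h2', h3', h4', h5'⟩ := h' s' h4 h5 σ' h3
  refine ⟨σ'', t + t', s'', .seq _ _ _ _ _ _ _ h1 h1', by omega, h3', ?_, h5'⟩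
  refine (h4.mono ?_ ?_).trans (h4'.mono ?_ ?_) <;> simp +contextual [Stmt.writes, Stmt.puts]

theorem eval_pair (ha : a.Ok M s) (hb : b.Ok M s) {σ : RamState} (hσ : Represents M σ s) :
    ∃ σ₁ σ₂, RamExec M.W M.S (a.compile 60) σ σ₁ a.cost ∧
      RamExec M.W M.S (b.compile 61) σ₁ σ₂ b.cost ∧ σ₂.reg 60 = a.eval s ∧ σ₂.reg 61 = b.eval s ∧
      Represents M σ₂ s := by
  obtain ⟨σ₁, e₁, v₁, f₁, m₁⟩ := a.exec_compile M s ha 60 le_rfl σ hσ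
  have hσ₁ := hσ.congr f₁ m₁
  obtain ⟨σ₂, e₂, v₂, f₂, m₂⟩ := b.exec_compile M s hb 61 (by norm_num) σ₁ hσ₁
  exact ⟨σ₁, σ₂, e₁, e₂, by rw [f₂ 60 (by norm_num), v₁], v₂,
    hσ₁.congr (fun r hr => f₂ r (by omega)) m₂⟩

theorem ifLt (ha : a.Ok M s) (hb : b.Ok M s) (h : a.eval s < b.eval s → HT M P s T Q)
    (h' : ¬ a.eval s < b.eval s → HT M P' s T Q) :
    HT M (.ifLt a b P P') s (a.cost + b.cost + 1 + T) Q := by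
  intro σ hσ
  obtain ⟨σ₁, σ₂, e₁, e₂, r₁, r₂, hσ₂⟩ := eval_pair ha hb hσ
  by_cases hc : a.eval s < b.eval s
  · obtain ⟨σ', t, s', h1, h2, h3, h4, h5⟩ := h hc σ₂ hσ₂
    refine ⟨σ', _, s', .seq _ _ _ _ _ _ _ e₁ (.seq _ _ _ _ _ _ _ e₂
      (.ifTrue _ _ _ _ _ _ _ (by rwa [r₁, r₂]) h1)), by omega, h3, h4.mono ?_ ?_, h5⟩ <;>
    simp +contextual [Stmt.writes, Stmt.puts]
  · obtain ⟨σ', t, s', h1, h2, h3, h4, h5⟩ := h' hc σ₂ hσ₂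
    refine ⟨σ', _, s', .seq _ _ _ _ _ _ _ e₁ (.seq _ _ _ _ _ _ _ e₂
      (.ifFalse _ _ _ _ _ _ _ (by rwa [r₁, r₂]) h1)), by omega, h3, h4.mono ?_ ?_, h5⟩ <;>
    simp +contextual [Stmt.writes, Stmt.puts]

theorem ifEq (ha : a.Ok M s) (hb : b.Ok M s) (h : a.eval s = b.eval s → HT M P s T Q)
    (h' : a.eval s ≠ b.eval s → HT M P' s T Q) :
    HT M (.ifEq a b P P') s (a.cost + b.cost + 2 + T) Q := by
  intro σ hσ
  obtain ⟨σ₁, σ₂, e₁, e₂, r₁, r₂, hσ₂⟩ := eval_pair ha hb hσ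
  rcases lt_trichotomy (a.eval s) (b.eval s) with hc | hc | hc
  · obtain ⟨σ', t, s', h1, h2, h3, h4, h5⟩ := h' hc.ne σ₂ hσ₂
    refine ⟨σ', _, s', .seq _ _ _ _ _ _ _ e₁ (.seq _ _ _ _ _ _ _ e₂
      (.ifTrue _ _ _ _ _ _ _ (by rwa [r₁, r₂]) h1)), by omega, h3, h4.mono ?_ ?_, h5⟩ <;>
    simp +contextual [Stmt.writes, Stmt.puts]
  · obtain ⟨σ', t, s', h1, h2, h3, h4, h5⟩ := h hc σ₂ hσ₂
    refine ⟨σ', _, s', .seq _ _ _ _ _ _ _ e₁ (.seq _ _ _ _ _ _ _ e₂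
      (.ifFalse _ _ _ _ _ _ _ (by rw [r₁, r₂, hc]; exact lt_irrefl _)
      (.ifFalse _ _ _ _ _ _ _ (by rw [r₁, r₂, hc]; exact lt_irrefl _) h1))),
      by omega, h3, h4.mono ?_ ?_, h5⟩ <;>
    simp +contextual [Stmt.writes, Stmt.puts]
  · obtain ⟨σ', t, s', h1, h2, h3, h4, h5⟩ := h' hc.ne' σ₂ hσ₂
    refine ⟨σ', _, s', .seq _ _ _ _ _ _ _ e₁ (.seq _ _ _ _ _ _ _ e₂
      (.ifFalse _ _ _ _ _ _ _ (by rw [r₁, r₂]; exact hc.le.not_gt)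
      (.ifTrue _ _ _ _ _ _ _ (by rwa [r₁, r₂]) h1))),
      by omega, h3, h4.mono ?_ ?_, h5⟩ <;>
    simp +contextual [Stmt.writes, Stmt.puts]

theorem of_wp (h : P.wp M Q s) : HT M P s P.cost Q := by
  induction P generalizing Q s with
  | skip => exact skip h
  | set v e => exact set h.1 h.2.1 h.2.2
  | put k i e => exact put h.1 h.2.1 h.2.2.1 h.2.2.2
  | seq P P' ih ih' => exact seq (ih h) fun s' _ hs' => ih' hs'
  | ifLt a b P P' ih ih' =>
    exact ifLt h.1 h.2.1 (fun hc => (ih (h.2.2.1 hc)).mono (le_max_left _ _) fun _ _ h => h)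
      (fun hc => (ih' (h.2.2.2 hc)).mono (le_max_right _ _) fun _ _ h => h)
  | ifEq a b P P' ih ih' =>
    exact ifEq h.1 h.2.1 (fun hc => (ih (h.2.2.1 hc)).mono (le_max_left _ _) fun _ _ h => h)
      (fun hc => (ih' (h.2.2.2 hc)).mono (le_max_right _ _) fun _ _ h => h)
  | loop a b P ih => exact h.elim

theorem of_wp_le (h : P.wp M Q s) (hT : P.cost ≤ T) : HT M P s T Q :=
  (of_wp h).mono hT fun _ _ h => h

/-- The loop rule: the invariant depends on the number of steps that are left. -/
theorem loop (Inv : ℕ → HState → Prop)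
    (h : ∀ T s', Frame P s s' → Inv T s' → a.Ok M s' ∧ b.Ok M s' ∧
      (a.eval s' < b.eval s' → ∃ T₁ T₂, T₁ + T₂ + (a.cost + b.cost + 1) ≤ T ∧
        HT M P s' T₁ (Inv T₂)) ∧
      (¬ a.eval s' < b.eval s' → 1 ≤ T ∧ Q s'))
    (h₀ : Inv T s) : HT M (.loop a b P) s (T + (a.cost + b.cost)) Q := by
  -- Here the registers `60` and `61` already hold the two sides of the test. The induction is on
  -- the number of steps left, which decreases in every round because the test itself costs steps.
  have key : ∀ T s' σ, Frame P s s' → Inv T s' → Represents M σ s' →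
      σ.reg 60 = a.eval s' → σ.reg 61 = b.eval s' →
      ∃ σ' t s'', RamExec M.W M.S (.whileLt 60 61 (.seq P.compile (.seq (a.compile 60)
        (b.compile 61)))) σ σ' t ∧ t ≤ T ∧ Represents M σ' s'' ∧ Frame P s s'' ∧ Q s'' := by
    intro T
    induction T using Nat.strong_induction_on with
    | _ T ih =>
      intro s' σ hF hI hσ r₁ r₂
      obtain ⟨-, -, h1, h2⟩ := h T s' hF hI
      by_cases hc : a.eval s' < b.eval s'
      · obtain ⟨T₁, T₂, hT, hP⟩ := h1 hc
        obtain ⟨σ', t, s'', e, ht, hσ', hF', hI'⟩ := hP σ hσ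
        obtain ⟨ha, hb, -, -⟩ := h T₂ s'' (hF.trans hF') hI'
        obtain ⟨σ₁, σ₂, e₁, e₂, q₁, q₂, hσ₂⟩ := eval_pair ha hb hσ'
        obtain ⟨σ₃, t₃, s₃, e₃, ht₃, hσ₃, hF₃, hQ⟩ :=
          ih T₂ (by omega) s'' σ₂ (hF.trans hF') hI' hσ₂ q₁ q₂
        exact ⟨σ₃, _, s₃, .whileTrue _ _ _ _ _ _ _ _ (by rwa [r₁, r₂])
          (.seq _ _ _ _ _ _ _ e (.seq _ _ _ _ _ _ _ e₁ e₂)) e₃, by omega, hσ₃, hF₃, hQ⟩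
      · obtain ⟨hT, hQ⟩ := h2 hc
        exact ⟨σ, 1, s', .whileFalse _ _ _ _ (by rwa [r₁, r₂]), hT, hσ, hF, hQ⟩
  intro σ hσ
  obtain ⟨ha, hb, -, -⟩ := h T s (Frame.refl _ _) h₀
  obtain ⟨σ₁, σ₂, e₁, e₂, q₁, q₂, hσ₂⟩ := eval_pair ha hb hσ
  obtain ⟨σ₃, t₃, s₃, e₃, ht₃, hσ₃, hF₃, hQ⟩ := key T s σ₂ (Frame.refl _ _) h₀ hσ₂ q₁ q₂
  exact ⟨σ₃, _, s₃, .seq _ _ _ _ _ _ _ (.seq _ _ _ _ _ _ _ e₁ e₂) e₃, by omega, hσ₃, hF₃, hQ⟩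

/-- The rule for a loop with a known number of iterations. -/
theorem loop_range (N : ℕ) (I : ℕ → HState → Prop) (C : ℕ → ℕ)
    (h : ∀ i < N, ∀ s', Frame P s s' → I i s' → a.Ok M s' ∧ b.Ok M s' ∧ a.eval s' < b.eval s' ∧
      HT M P s' (C i) (I (i + 1)))
    (h' : ∀ s', Frame P s s' → I N s' → a.Ok M s' ∧ b.Ok M s' ∧ ¬ a.eval s' < b.eval s')
    (h₀ : I 0 s) :
    HT M (.loop a b P) s
      (∑ i ∈ Finset.range N, C i + (N + 1) * (a.cost + b.cost + 1)) (I N) := by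
  set c := a.cost + b.cost with hc
  have := loop (M := M) (P := P) (s := s) (a := a) (b := b) (Q := I N)
    (T := ∑ i ∈ Finset.range N, C i + N * (c + 1) + 1)
    (fun T s' => ∃ i ≤ N, I i s' ∧ T = ∑ j ∈ Finset.Ico i N, C j + (N - i) * (c + 1) + 1) ?_
    ⟨0, Nat.zero_le _, h₀, by simp⟩
  · refine this.mono ?_ fun _ _ h => h
    rw [add_mul]; omega
  · rintro T s' hF ⟨i, hi, hI, rfl⟩
    rcases hi.lt_or_eq with hlt | rfl
    · obtain ⟨ha, hb, hab, hP⟩ := h i hlt s' hF hI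
      refine ⟨ha, hb, fun _ => ⟨C i, _, ?_, hP.mono le_rfl fun s'' _ hs => ⟨i + 1, hlt, hs, rfl⟩⟩,
        fun hn => absurd hab hn⟩
      rw [Finset.sum_eq_sum_Ico_succ_bot hlt, show N - i = N - (i + 1) + 1 by omega, add_mul]
      omega
    · obtain ⟨ha, hb, hab⟩ := h' s' hF hI
      exact ⟨ha, hb, fun h => absurd h hab, fun _ => ⟨by omega, hI⟩⟩

/-- Only states whose values fit into words are represented, so this may be assumed of the initial
state. -/
theorem of_lt (h : (∀ v, s.var v < M.W) → HT M P s T Q) : HT M P s T Q :=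
  fun σ hσ => h hσ.lt σ hσ

/-- Besides the body, a round costs `6` for the increment and `5` for the test; `8` pays for the
initialization and the last test. -/
theorem count {v N : Var} (I : ℕ → HState → Prop) (C : ℕ → ℕ) (hvN : v ≠ N)
    (hv : P.writes v = false) (hN : P.writes N = false)
    (hI : ∀ i s' x, I i s' → I i (s'.setV v x))
    (h : ∀ i < s.var N, ∀ s', Frame (.count v N P) s s' → s'.var v = i → I i s' →
      HT M P s' (C i) (I (i + 1)))
    (h₀ : I 0 s) :
    HT M (.count v N P) s (∑ i ∈ Finset.range (s.var N), C i + 11 * s.var N + 8) (I (s.var N)) := by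
  refine of_lt fun hlt => ?_
  have hW := M.word
  have hD := M.pos
  have hsN := hlt N
  have hvN' : N ≠ v := hvN.symm
  have hfr : ∀ s', Frame (.loop ⇡v ⇡N (P ;; v ≔ ⇡v + 1)) (s.setV v 0) s' → s'.var N = s.var N := by
    intro s' hF
    rw [hF.1 N (by simp [Stmt.writes, hN, hvN'])]
    simp [hvN']
  have h0 : HT M (v ≔ 0) s 3 (· = s.setV v 0) :=
    set (e := 0) (show 0 < M.W by omega) (show 0 < M.W by omega) rfl
  refine (seq h0 ?_).mono
    (T := 3 + (∑ i ∈ Finset.range (s.var N), (C i + 6) + (s.var N + 1) * 5)) ?_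
    (Q := fun s' => s'.var v = s.var N ∧ I (s.var N) s') fun _ _ h => h.2
  · rintro s₁ - rfl
    refine loop_range (a := ⇡v) (b := ⇡N) (s.var N) (fun i s' => s'.var v = i ∧ I i s')
      (fun i => C i + 6) ?_ ?_ ⟨by simp, hI _ _ _ h₀⟩
    · rintro i hi s' hF ⟨hi', hI'⟩
      have hN' := hfr s' hF
      refine ⟨trivial, trivial, by simp [hi', hN', hi], ?_⟩
      refine seq (h i hi s' ?_ hi' hI') fun s'' hF'' hI'' => (set ?_ ?_ ?_ : HT _ _ _ 6 _)
      · refine ⟨fun w hw => ?_, fun k hk => ?_⟩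
        · have hw' : P.writes w = false ∧ w ≠ v := by
            simpa [Stmt.count, Stmt.writes, and_comm] using hw
          rw [hF.1 w (by simp [Stmt.writes, hw'])]
          simp [hw'.2]
        · rw [hF.2 k (by simpa [Stmt.count, Stmt.puts] using hk)]
          rfl
      · have h1 := hF''.1 v hv
        simp [h1, hi']; omega
      · have h1 := hF''.1 v hv
        simp [h1, hi']; omega
      · have h1 := hF''.1 v hv
        exact ⟨by simp [h1, hi'], hI _ _ _ hI''⟩
    · rintro s' hF ⟨h1, h2⟩
      exact ⟨trivial, trivial, by simp [h1, hfr s' hF]⟩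
  · rw [Finset.sum_add_distrib]
    simp
    omega

end HT

/-! ### Mismatches of two nearly periodic words -/

open Stmt in
/-- Copy a segment of the input, forwards or backwards. -/
def copySegment (dst : Arr) (base len : Var) : Stmt :=
  -- The pair `up`, `dn` is `1`, `0` for reading forwards and `0`, `1` for reading backwards.
  count .x len (put dst ⇡.x (.get .F ((⇡base + ⇡.up * ⇡.x) - ⇡.dn * ⇡.x)))

theorem copySegment_spec (M : Machine) (dst : Arr) (base len : Var) (s : HState) (hdst : dst ≠ .F)
    (hb : base ≠ .x) (hl : len ≠ .x) (hlen : s.var len < M.D) (hup : s.var .up ≤ 1)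
    (hdn : s.var .dn ≤ 1)
    (h : ∀ x < s.var len, s.var base + s.var .up * x < M.D) :
    HT M (copySegment dst base len) s (40 * s.var len + 40) (fun s' => ∀ x < s.var len,
      s'.arr dst x = s.arr .F (s.var base + s.var .up * x - s.var .dn * x)) := by
  have hW := M.word
  have hD := M.pos
  refine (HT.count (fun i s' => ∀ x < i,
      s'.arr dst x = s.arr .F (s.var base + s.var .up * x - s.var .dn * x)) (fun _ => 24) hl.symm rfl rfl
      (fun _ _ _ h => h) ?_ (by simp)).mono ?_ fun _ _ h => h
  · intro i hi s' hF hx hI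
    have e1 := hF.1 base (by simp [Stmt.count, Stmt.writes, hb])
    have e2 := hF.1 .up rfl
    have e3 := hF.1 .dn rfl
    have e4 := hF.2 .F (by simp [Stmt.count, Stmt.puts, hdst.symm])
    have h1 := h i hi
    have h2 : s.var .up * i ≤ i := by nlinarith
    have h3 : s.var .dn * i ≤ i := by nlinarith
    refine HT.of_wp_le ?_ (Nat.le_of_ble_eq_true rfl)
    simp only [Stmt.wp, Exp.ok_add, Exp.ok_sub, Exp.ok_mul, Exp.ok_get, Exp.ok_var, Exp.eval_add, Exp.eval_sub,
      Exp.eval_mul, Exp.eval_get, Exp.eval_var, HState.setA_arr_self, e1, e2, e3, e4, hx]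
    refine ⟨trivial, by grind, by grind, ?_⟩
    intro x hx
    split_ifs with hxi
    · rw [hxi]
    · exact hI x (by omega)
  · simp; omega

/-- The letter at `x` differs from that at the same place of the first period. -/
def Deviates (g : ℕ → ℕ) (π x : ℕ) : Prop := g x ≠ g (x % π)

instance (g : ℕ → ℕ) (π : ℕ) : DecidablePred (Deviates g π) :=
  fun x => inferInstanceAs (Decidable (g x ≠ g (x % π)))

/-- `v` is the first position from `x` on where `g` deviates, or `len` if there is none. -/
structure IsNextDeviation (g : ℕ → ℕ) (π len x v : ℕ) : Prop where
  le : x ≤ v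
  le_len : v ≤ len
  deviates : v < len → Deviates g π v
  not_deviates : ∀ y, x ≤ y → y < v → ¬ Deviates g π y

open Stmt in
/-- Compute the next deviations. -/
def nextDeviation (src dst : Arr) (len : Var) : Stmt :=
  (put dst ⇡len ⇡len ;; .x ≔ ⇡len) ;;
  loop 0 ⇡.x (.x ≔ ⇡.x - 1 ;;
    ifEq (.get src ⇡.x) (.get src (.mod ⇡.x ⇡.per)) (put dst ⇡.x (.get dst (⇡.x + 1)))
      (put dst ⇡.x ⇡.x))

/-- The table is filled from right to left, starting from the sentinel `len` at index `len`: a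
position that does not deviate inherits the entry of its successor. -/
theorem nextDeviation_spec (M : Machine) (src dst : Arr) (len : Var) (s : HState) (hne : src ≠ dst)
    (hlen : s.var len < M.D) {g : ℕ → ℕ}
    (hg : ∀ x < s.var len, s.arr src x = g x) :
    HT M (nextDeviation src dst len) s (60 * s.var len + 60) (fun s' => ∀ x ≤ s.var len,
      IsNextDeviation g (s.var .per) (s.var len) x (s'.arr dst x)) := by
  have hW := M.word
  have hD := M.pos
  refine (HT.seq (HT.of_wp (Q := fun s' => s'.var .x = s.var len ∧ s'.arr dst (s.var len) = s.var len) ?_)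
    fun s₁ hF₁ h₁ => (HT.loop_range (s.var len) (fun i s' => s'.var .x + i = s.var len ∧
      ∀ x ≤ s.var len, s'.var .x ≤ x →
        IsNextDeviation g (s.var .per) (s.var len) x (s'.arr dst x)) (fun _ => 40) ?_ ?_ ?_)).mono
        ?_ (fun s' _ h => fun x hx => h.2 x hx (by omega))
  · simp [hlen]; omega
  · rintro i hi s' hF ⟨hx, hI⟩
    have e1 : s'.var .per = s.var .per := (hF.1 _ rfl).trans (hF₁.1 _ rfl)
    have e2 : s'.arr src = s.arr src :=
      (hF.2 _ (by simp [Stmt.puts, hne])).trans (hF₁.2 _ (by simp [Stmt.puts, hne]))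
    have e3 := Nat.mod_le (s'.var .x - 1) (s.var .per)
    refine ⟨by simp; omega, trivial, by simp; omega, HT.of_wp_le ?_ (Nat.le_of_ble_eq_true rfl)⟩
    have h4 : s.arr src (s'.var .x - 1) = g (s'.var .x - 1) := hg _ (by omega)
    have h5 : s.arr src ((s'.var .x - 1) % s.var .per) = g ((s'.var .x - 1) % s.var .per) :=
      hg _ (by omega)
    simp only [Stmt.wp, Exp.ok_add, Exp.ok_sub, Exp.ok_mod, Exp.ok_get, Exp.ok_var, Exp.ok_ofNat,
      Exp.eval_add, Exp.eval_sub, Exp.eval_mod, Exp.eval_get, Exp.eval_var, Exp.eval_ofNat,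
      HState.setV_var, HState.setV_arr, HState.setA_var, HState.setA_arr_self, if_true, reduceCtorEq,
      if_false, e1, e2, h4, h5, true_and]
    have hnext : s'.var .x - 1 + 1 = s'.var .x := by omega
    refine ⟨⟨by omega, by omega⟩, by omega, by omega, ⟨by omega, by omega⟩, fun heq => ?_, fun heq => ?_⟩
    · refine ⟨⟨⟨by omega, by omega⟩, by omega⟩, by omega, by omega, fun x hx hx' => ?_⟩
      rw [hnext]
      split_ifs with hc
      · have h6 := hI (s'.var .x) (by omega) le_rfl
        refine ⟨by have := h6.le; omega, h6.le_len, h6.deviates, fun y h7 h8 => ?_⟩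
        by_cases hy : y = s'.var .x - 1
        · rw [hy]; exact not_not.2 heq
        · exact h6.not_deviates y (by omega) h8
      · exact hI x hx (by omega)
    · refine ⟨by omega, by omega, fun x hx hx' => ?_⟩
      split_ifs with hc
      · rw [hc]
        exact ⟨le_rfl, by omega, fun _ => heq, fun y h7 h8 => by omega⟩
      · exact hI x hx (by omega)
  · rintro s' hF ⟨hx, hI⟩
    simp; omega
  · refine ⟨by omega, fun x hx hx' => ?_⟩
    obtain rfl : x = s.var len := by omega
    rw [h₁.2]
    exact ⟨le_rfl, le_rfl, fun h => absurd h (lt_irrefl _), fun y h1 h2 => by omega⟩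
  · have hc : Stmt.cost (.put dst ⇡len ⇡len ;; .x ≔ ⇡len) = 12 := rfl
    have hc' : Exp.cost 0 + Exp.cost ⇡Var.x + 1 = 4 := rfl
    rw [hc, hc']
    simp; omega

theorem count_eq_of_forall_not {p : ℕ → Prop} [DecidablePred p] {a b : ℕ} (hab : a ≤ b)
    (h : ∀ y, a ≤ y → y < b → ¬ p y) : Nat.count p a = Nat.count p b := by
  induction b, hab using Nat.le_induction with
  | base => rfl
  | succ b hab ih =>
    rw [Nat.count_succ, if_neg (h b hab (by omega)), add_zero]
    exact ih fun y h1 h2 => h y h1 (by omega)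

/-- The number of mismatches of `gA[0..m)` with `gB[d..d+m)`. -/
def mismatches (gA gB : ℕ → ℕ) (d m : ℕ) : ℕ := Nat.count (fun x => gA x ≠ gB (x + d)) m

/-- One of the first three deviations of `gA` meets one of the first three of `gB`. -/
def EarlyCollision (gA gB : ℕ → ℕ) (π d m : ℕ) : Prop :=
  ∃ x < m, Deviates gA π x ∧ Deviates gB π (x + d) ∧ Nat.count (Deviates gA π) x < 3 ∧
    Nat.count (Deviates gB π) (x + d) < 3

open Stmt in
/-- Count the mismatches up to three, going from one deviation to the next. -/
def countMismatches : Stmt :=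
  loop ⇡.x ⇡.lim
    (.y ≔ Exp.min (.get .NA ⇡.x) (.get .NB (⇡.x + ⇡.d) - ⇡.d) ;;
     ifLt ⇡.y ⇡.lim (ifEq (.get .A ⇡.y) (.get .B (⇡.y + ⇡.d)) skip (.cnt ≔ ⇡.cnt + 1)) skip ;;
     ifLt ⇡.cnt 3 (.x ≔ ⇡.y + 1) (.x ≔ ⇡.lim))

-- Where neither word deviates, both agree with their periodic continuations, and these coincide
-- under the shift by `hR`. So mismatches occur only at deviations, and a deviation of just one word
-- is a mismatch. Without an early collision every round that stays below `lim` adds a mismatch, and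
-- three rounds suffice. With one, deviations may cancel, and only the bound by `lim` remains.
open Classical in
theorem countMismatches_spec (M : Machine) (s : HState) {gA gB : ℕ → ℕ} {π la lb : ℕ}
    (hla : la < M.D) (hlb : lb < M.D) (hlim : s.var .lim ≤ la) (hlim' : s.var .lim + s.var .d ≤ lb)
    (hA : ∀ x < la, s.arr .A x = gA x) (hB : ∀ x < lb, s.arr .B x = gB x)
    (hNA : ∀ x ≤ la, IsNextDeviation gA π la x (s.arr .NA x))
    (hNB : ∀ x ≤ lb, IsNextDeviation gB π lb x (s.arr .NB x))
    (hx : s.var .x = 0) (hcnt : s.var .cnt = 0)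
    (hrun : ∀ y < s.var .d, ¬ Deviates gB π y)
    (hR : ∀ x < s.var .lim, gA (x % π) = gB ((x + s.var .d) % π)) :
    HT M countMismatches s
      (100 * (if EarlyCollision gA gB π (s.var .d) (s.var .lim) then s.var .lim else 3) + 10)
      (fun s' => s'.var .cnt = min 3 (mismatches gA gB (s.var .d) (s.var .lim))) := by
  have hW := M.word
  have hD := M.pos
  set d := s.var .d with hd
  set m := s.var .lim with hm
  set bad := EarlyCollision gA gB π d m with hbad
  -- The first alternative describes a running count, whose budget is the number of positions left
  -- or of mismatches still allowed; the second one describes a settled result.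
  refine (HT.loop (fun T s' =>
    (s'.var .x ≤ m ∧ s'.var .cnt = mismatches gA gB d (s'.var .x) ∧ s'.var .cnt < 3 ∧
      (¬ bad → s'.var .cnt = Nat.count (Deviates gA π) (s'.var .x) +
        Nat.count (Deviates gB π) (s'.var .x + d)) ∧
      T = 100 * (if bad then m - s'.var .x else 3 - s'.var .cnt) + 1) ∨
    (m ≤ s'.var .x ∧ s'.var .x ≤ M.D ∧ s'.var .cnt = min 3 (mismatches gA gB d m) ∧ T = 1))
    (T := 100 * (if bad then m else 3) + 1) ?_ ?_).mono ?_ (Q := fun s' =>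
      s'.var .cnt = min 3 (mismatches gA gB d m)) fun _ _ h => h
  · intro T s' hF hI
    have e1 : s'.var .lim = m := hF.1 _ rfl
    have e2 : s'.var .d = d := hF.1 _ rfl
    have e3 : s'.arr .A = s.arr .A := hF.2 _ rfl
    have e4 : s'.arr .B = s.arr .B := hF.2 _ rfl
    have e5 : s'.arr .NA = s.arr .NA := hF.2 _ rfl
    have e6 : s'.arr .NB = s.arr .NB := hF.2 _ rfl
    refine ⟨trivial, trivial, fun hlt => ?_, fun hnlt => ?_⟩
    · simp only [Exp.eval_var, e1] at hlt
      rcases hI with ⟨-, h2, h3, h4, rfl⟩ | ⟨h1, -⟩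
      swap
      · omega
      set x := s'.var .x with hxdef
      set c := s'.var .cnt with hcdef
      have ha := hNA x (by omega)
      have hb := hNB (x + d) (by omega)
      set a := s.arr .NA x with hadef
      set b := s.arr .NB (x + d) with hbdef
      have hale := ha.le
      have hale' := ha.le_len
      have hble := hb.le
      have hble' := hb.le_len
      -- Nothing is missed by jumping to the next deviation of either word.
      have hskip : ∀ t, x ≤ t → t ≤ min a (b - d) → t ≤ m →
          mismatches gA gB d t = c ∧ Nat.count (Deviates gA π) t = Nat.count (Deviates gA π) x ∧
            Nat.count (Deviates gB π) (t + d) = Nat.count (Deviates gB π) (x + d) := by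
        intro t h5 h6 h7
        refine ⟨?_, (count_eq_of_forall_not h5 fun z h8 h9 => ha.not_deviates z h8 (by omega)).symm,
          (count_eq_of_forall_not (by omega) fun z h8 h9 => hb.not_deviates z h8 (by omega)).symm⟩
        rw [h2]
        refine (count_eq_of_forall_not h5 fun z h8 h9 => not_not.2 ?_).symm
        have h10 := ha.not_deviates z h8 (by omega)
        have h11 := hb.not_deviates (z + d) (by omega) (by omega)
        unfold Deviates at h10 h11
        push Not at h10 h11
        rw [h10, h11, hR z (by omega)]
      have hwp : ∀ Q : HState → Prop, (m ≤ min a (b - d) → Q ((s'.setV .y (min a (b - d))).setV .x (min a (b - d) + 1))) →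
        (min a (b - d) < m → gA (min a (b - d)) = gB (min a (b - d) + d) → Q ((s'.setV .y (min a (b - d))).setV .x (min a (b - d) + 1))) →
        (min a (b - d) < m → gA (min a (b - d)) ≠ gB (min a (b - d) + d) → c + 1 < 3 → Q (((s'.setV .y (min a (b - d))).setV .cnt (c + 1)).setV .x (min a (b - d) + 1))) →
        (min a (b - d) < m → gA (min a (b - d)) ≠ gB (min a (b - d) + d) → ¬ c + 1 < 3 → Q (((s'.setV .y (min a (b - d))).setV .cnt (c + 1)).setV .x m)) → 
        HT M (.y ≔ Exp.min (.get .NA ⇡.x) (.get .NB (⇡.x + ⇡.d) - ⇡.d) ;;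
     Stmt.ifLt ⇡.y ⇡.lim (.ifEq (.get .A ⇡.y) (.get .B (⇡.y + ⇡.d)) .skip (.cnt ≔ ⇡.cnt + 1)) .skip ;;
     .ifLt ⇡.cnt 3 (.x ≔ ⇡.y + 1) (.x ≔ ⇡.lim)) s' 95 Q := by
        intro Q q1 q2 q3 q4
        refine HT.of_wp_le ?_ (Nat.le_of_ble_eq_true rfl)
        generalize hy : min a (b - d) = y at *
        simp only [Stmt.wp, Exp.ok_add, Exp.ok_sub, Exp.ok_min, Exp.ok_get, Exp.ok_var, Exp.ok_ofNat,
          Exp.eval_add, Exp.eval_sub, Exp.eval_min, Exp.eval_get, Exp.eval_var, Exp.eval_ofNat,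
          HState.setV_var, HState.setV_arr, if_true, reduceCtorEq, if_false, e1, e2, e3, e4, e5, e6, true_and, ← hxdef, ← hadef, ← hbdef, ← hcdef, hy]
        refine ⟨by omega, by omega, fun hym => ⟨by omega, by omega, ?_⟩, fun hym => ⟨by omega,
          fun _ => ⟨by omega, by omega, q1 (by omega)⟩, fun h => absurd h3 h⟩⟩
        rw [hA y (by omega), hB (y + d) (by omega)]
        exact ⟨fun heq => ⟨by omega, fun _ => ⟨by omega, by omega, q2 hym heq⟩, fun h => absurd h3 h⟩,
          fun hne => ⟨by omega, by omega, by omega, fun h => ⟨by omega, by omega, q3 hym hne h⟩,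
            fun h => ⟨by omega, q4 hym hne h⟩⟩⟩
      have hbudget : 0 < if bad then m - x else 3 - c := by split_ifs <;> omega
      generalize hy : min a (b - d) = y at *
      by_cases hym : y < m
      · obtain ⟨k1, k2, k3⟩ := hskip y (by omega) le_rfl hym.le
        have hdev : Deviates gA π y ∨ Deviates gB π (y + d) := by
          rcases Nat.le_total a (b - d) with h | h
          · left
            rw [show y = a by omega]
            exact ha.deviates (by omega)
          · right
            rw [show y + d = b by omega]
            exact hb.deviates (by omega)
        have hm1 : ∀ z, mismatches gA gB d (z + 1) = mismatches gA gB d z +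
            if gA z ≠ gB (z + d) then 1 else 0 := fun z => by
          unfold mismatches; rw [Nat.count_succ]
        -- Without early collisions the count equals the number of deviations passed on both sides
        -- together. As it is below three, a common deviation at `y` would be an early collision.
        have hboth : ¬ bad → ¬ (Deviates gA π y ∧ Deviates gB π (y + d)) := by
          rintro hnb ⟨d1, d2⟩
          have := h4 hnb
          exact hnb ⟨y, hym, d1, d2, by omega, by omega⟩
        have hgood : ¬ bad → gA y ≠ gB (y + d) ∧ Nat.count (Deviates gA π) (y + 1) +
            Nat.count (Deviates gB π) (y + 1 + d) = c + 1 := by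
          intro hnb
          have h5 := h4 hnb
          have h6 := hboth hnb
          have h7 := hR y hym
          rw [show y + 1 + d = y + d + 1 by omega, Nat.count_succ, Nat.count_succ, k2, k3]
          rcases hdev with hdev | hdev
          · have h8 : ¬ Deviates gB π (y + d) := fun h => h6 ⟨hdev, h⟩
            rw [if_pos hdev, if_neg h8]
            refine ⟨fun heq => hdev ?_, by omega⟩
            rw [h7, heq]
            exact not_not.1 h8
          · have h8 : ¬ Deviates gA π y := fun h => h6 ⟨h, hdev⟩
            rw [if_neg h8, if_pos hdev]
            refine ⟨fun heq => hdev ?_, by omega⟩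
            rw [← h7, ← heq]
            exact not_not.1 h8
        by_cases heq : gA y = gB (y + d)
        · have hb' : bad := by
            by_contra hnb
            exact (hgood hnb).1 heq
          refine ⟨95, 100 * (if bad then m - (y + 1) else 3 - c) + 1, ?_, hwp _ ?_ ?_ ?_ ?_⟩
          · rw [if_pos hb', if_pos hb']
            change 95 + _ + 5 ≤ _
            omega
          · intro h; omega
          · intro _ _
            left
            simp only [HState.setV_var, if_true, reduceCtorEq, if_false]
            exact ⟨by omega, by rw [hm1, k1, if_neg (not_not.2 heq)]; rfl, h3, fun h => absurd hb' h, rfl⟩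
          · intro _ h; exact absurd heq h
          · intro _ h; exact absurd heq h
        · by_cases hc3 : c + 1 < 3
          · refine ⟨95, 100 * (if bad then m - (y + 1) else 3 - (c + 1)) + 1, ?_, hwp _ ?_ ?_ ?_ ?_⟩
            · change 95 + _ + 5 ≤ _
              split_ifs <;> omega
            · intro h; omega
            · intro _ h; exact absurd h heq
            · intro _ _ _
              left
              simp only [HState.setV_var, if_true, reduceCtorEq, if_false]
              exact ⟨by omega, by rw [hm1, k1, if_pos heq], hc3, fun h => (hgood h).2.symm, trivial⟩
            · intro _ _ h; exact absurd hc3 h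
          · refine ⟨95, 1, ?_, hwp _ ?_ ?_ ?_ ?_⟩
            · change 95 + _ + 5 ≤ _
              omega
            · intro h; omega
            · intro _ h; exact absurd h heq
            · intro _ _ h; exact absurd h hc3
            · intro _ _ _
              right
              simp only [HState.setV_var, if_true, reduceCtorEq, if_false]
              have h5 := hm1 y
              rw [if_pos heq, k1] at h5
              have h6 : mismatches gA gB d (y + 1) ≤ mismatches gA gB d m :=
                Nat.count_monotone _ (by omega)
              exact ⟨le_rfl, by omega, by omega, trivial⟩
      · refine ⟨95, 1, ?_, hwp _ ?_ ?_ ?_ ?_⟩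
        · change 95 + _ + 5 ≤ _
          omega
        · intro _
          right
          simp only [HState.setV_var, if_true, reduceCtorEq, if_false]
          obtain ⟨k1, -, -⟩ := hskip m (by omega) (by omega) le_rfl
          exact ⟨by omega, by omega, by omega, trivial⟩
        · intro h; omega
        · intro h; omega
        · intro h; omega
    · simp only [Exp.eval_var, e1] at hnlt
      rcases hI with ⟨h1, h2, h3, h4, rfl⟩ | ⟨h1, -, h2, rfl⟩
      · have : s'.var .x = m := by omega
        rw [this] at h2
        exact ⟨by omega, by omega⟩
      · exact ⟨le_rfl, h2⟩
  · left
    rw [hx, hcnt]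
    refine ⟨Nat.zero_le _, by simp [mismatches], by norm_num, fun _ => ?_, rfl⟩
    -- The letters of `gB` before `d` do not deviate, so both deviation counts start from zero.
    rw [← count_eq_of_forall_not (Nat.zero_le _) (fun y _ h => hrun y (by omega))]
    simp
  · have hc : Exp.cost ⇡Var.x + Exp.cost ⇡Var.lim = 4 := rfl
    rw [hc]
    omega

theorem eq_of_count_eq {p : ℕ → Prop} [DecidablePred p] {x y : ℕ} (hx : p x) (hy : p y)
    (h : Nat.count p x = Nat.count p y) : x = y := by
  rcases lt_trichotomy x y with hlt | heq | hgt
  · exact absurd h (Nat.count_strict_mono hx hlt).ne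
  · exact heq
  · exact absurd h (Nat.count_strict_mono hy hgt).ne'

/-- There are at most nine shifts with an early collision. -/
theorem card_le_of_earlyCollision {gA gB : ℕ → ℕ} {π : ℕ} (m : ℕ → ℕ) (S : Finset ℕ)
    (h : ∀ d ∈ S, EarlyCollision gA gB π d (m d)) : S.card ≤ 9 := by
  classical
  have h' : ∀ d, ∃ x, d ∈ S → Deviates gA π x ∧ Deviates gB π (x + d) ∧
      Nat.count (Deviates gA π) x < 3 ∧ Nat.count (Deviates gB π) (x + d) < 3 := by
    intro d
    by_cases hd : d ∈ S
    · obtain ⟨x, -, hx⟩ := h d hd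
      exact ⟨x, fun _ => hx⟩
    · exact ⟨0, fun h => absurd h hd⟩
  choose x hx using h'
  have : S.card ≤ (Finset.range 3 ×ˢ Finset.range 3).card := by
    -- The ranks of the two deviations that meet are below three; they determine `x` and `x + d`,
    -- hence `d`.
    refine Finset.card_le_card_of_injOn
      (fun d => (Nat.count (Deviates gA π) (x d), Nat.count (Deviates gB π) (x d + d))) ?_ ?_
    · intro d hd
      have := hx d hd
      simp [this.2.2.1, this.2.2.2]
    · intro d hd d' hd' heq
      simp only [Prod.mk.injEq] at heq
      have h1 := hx d hd
      have h2 := hx d' hd'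
      have h3 := eq_of_count_eq h1.1 h2.1 heq.1
      have h4 := eq_of_count_eq h1.2.1 h2.2.1 heq.2
      omega
  simpa using this

open Stmt in
/-- Set up the comparison of the block with its occurrence number `i`. -/
def comparisonSetup : Stmt :=
  -- Subtraction is truncated, so one summand is `0` and the sum is the distance from the anchor.
  .d ≔ (⇡.i - ⇡.anc) + (⇡.anc - ⇡.i) ;; .lim ≔ Exp.min ⇡.la (⇡.lb - ⇡.d) ;; .cnt ≔ 0 ;; .x ≔ 0

open Stmt in
/-- Add up the mismatches on one side of the block, for all its occurrences. -/
def comparisonLoop : Stmt :=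
  count .i .hh (ifLt (.get .Z (⇡.q + ⇡.i)) ⇡.q skip
    (comparisonSetup ;; countMismatches ;; put .Cnt ⇡.i (.get .Cnt ⇡.i + ⇡.cnt)))

-- Each occurrence costs a constant, except for those with an early collision, which cost order
-- `la`. There are at most nine of the latter, as the distances of the occurrences from the anchor
-- are pairwise different.
open Classical in
theorem comparisonLoop_spec (M : Machine) (s : HState) {gA gB δ m : ℕ → ℕ}
    (hδ : ∀ i, δ i = (i - s.var .anc) + (s.var .anc - i))
    (hm : ∀ i, m i = min (s.var .la) (s.var .lb - δ i))
    (hla : s.var .la < M.D) (hlb : s.var .lb < M.D)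
    (hA : ∀ x < s.var .la, s.arr .A x = gA x) (hB : ∀ x < s.var .lb, s.arr .B x = gB x)
    (hNA : ∀ x ≤ s.var .la, IsNextDeviation gA (s.var .per) (s.var .la) x (s.arr .NA x))
    (hNB : ∀ x ≤ s.var .lb, IsNextDeviation gB (s.var .per) (s.var .lb) x (s.arr .NB x))
    (hanc : s.var .anc < s.var .hh) (hD : s.var .q + s.var .hh ≤ M.D)
    (hmono : (∀ i < s.var .hh, s.var .q ≤ s.arr .Z (s.var .q + i) → s.var .anc ≤ i) ∨
      ∀ i < s.var .hh, s.var .q ≤ s.arr .Z (s.var .q + i) → i ≤ s.var .anc)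
    (hocc : ∀ i < s.var .hh, s.var .q ≤ s.arr .Z (s.var .q + i) → δ i ≤ s.var .lb ∧
      (∀ y < δ i, ¬ Deviates gB (s.var .per) y) ∧
      ∀ x < m i, gA (x % s.var .per) = gB ((x + δ i) % s.var .per))
    (hCnt : ∀ i < s.var .hh, s.var .q ≤ s.arr .Z (s.var .q + i) → s.arr .Cnt i ≤ 3) :
    HT M comparisonLoop s (1000 * s.var .la + 1000 * s.var .hh + 8)
      (fun s' => ∀ i < s.var .hh, s.var .q ≤ s.arr .Z (s.var .q + i) →
        s'.arr .Cnt i = s.arr .Cnt i + min 3 (mismatches gA gB (δ i) (m i))) := by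
  have hW := M.word
  have hD0 := M.pos
  set occ : ℕ → Prop := fun i => s.var .q ≤ s.arr .Z (s.var .q + i) with hoccdef
  set bad : ℕ → Prop := fun i => occ i ∧ EarlyCollision gA gB (s.var .per) (δ i) (m i) with hbad
  refine (HT.count (fun i s' => (∀ j, i ≤ j → s'.arr .Cnt j = s.arr .Cnt j) ∧
      ∀ j < i, occ j → s'.arr .Cnt j = s.arr .Cnt j + min 3 (mismatches gA gB (δ j) (m j)))
      (fun i => 400 + if bad i then 100 * s.var .la else 0) (by decide) rfl rfl
      (fun _ _ _ h => h) ?_ ⟨fun _ _ => rfl, by simp⟩).mono ?_ fun s' _ h => h.2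
  · intro i hi s' hF hi' ⟨hI1, hI2⟩
    have e1 : s'.var .anc = s.var .anc := hF.1 _ rfl
    have e2 : s'.var .q = s.var .q := hF.1 _ rfl
    have e3 : s'.var .la = s.var .la := hF.1 _ rfl
    have e4 : s'.var .lb = s.var .lb := hF.1 _ rfl
    have e5 : s'.arr .Z = s.arr .Z := hF.2 _ rfl
    refine (HT.ifLt (T := (if bad i then 100 * s.var .la else 0) + 386) ?_ ?_ (fun hlt => ?_)
      (fun hnlt => ?_)).mono ?_ (fun _ _ h => h)
    · simp [e2, hi']; omega
    · trivial
    · refine (HT.skip ?_).mono (by omega) fun _ _ h => h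
      simp only [Exp.eval_get, Exp.eval_add, Exp.eval_var, e2, e5, hi'] at hlt
      refine ⟨fun j hj => hI1 j (by omega), fun j hj hj' => hI2 j ?_ hj'⟩
      by_contra hc
      obtain rfl : j = i := by omega
      simp only [occ] at hj'
      omega
    · simp only [Exp.eval_get, Exp.eval_add, Exp.eval_var, e2, e5, hi', not_lt] at hnlt
      obtain ⟨h1, h2, h3⟩ := hocc i hi hnlt
      have h4 : δ i < s.var .hh := by rw [hδ]; omega
      have h5 := hm i
      refine (HT.seq (T := 36) (T' := (if bad i then 100 * s.var .la else 0) + 350)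
        (R := fun s₁ => s₁.var .d = δ i ∧ s₁.var .lim = m i ∧ s₁.var .cnt = 0 ∧
        s₁.var .x = 0) (HT.of_wp_le ?_ (Nat.le_of_ble_eq_true rfl))
        fun s₁ hF₁ ⟨d1, d2, d3, d4⟩ => ?_).mono (by omega) fun _ _ h => h
      · simp only [comparisonSetup, Stmt.wp, Exp.ok_add, Exp.ok_sub, Exp.ok_min, Exp.ok_var,
          Exp.ok_ofNat, Exp.eval_add, Exp.eval_sub, Exp.eval_min, Exp.eval_var, Exp.eval_ofNat,
          HState.setV_var, if_true, reduceCtorEq, if_false, e1, e3, e4, hi', ← hδ, ← h5, true_and, and_true]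
        have := hδ i
        omega
      · have k1 : ∀ k, k ≠ .Cnt → s₁.arr k = s.arr k := fun k hk =>
          (hF₁.2 k rfl).trans (hF.2 k (by simpa [Stmt.count, Stmt.puts, comparisonLoop, comparisonSetup, countMismatches] using hk))
        have k2 : s₁.var .per = s.var .per := (hF₁.1 _ rfl).trans (hF.1 _ rfl)
        have k3 : s₁.var .i = i := (hF₁.1 _ rfl).trans hi'
        have k4 : s₁.arr .Cnt = s'.arr .Cnt := hF₁.2 _ rfl
        refine (HT.seq (countMismatches_spec M s₁ (gA := gA) (gB := gB) (π := s.var .per) hla hlb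
          (by rw [d2]; omega) (by rw [d1, d2]; omega) (by simpa [k1] using hA)
          (by simpa [k1] using hB) (by simpa [k1] using hNA) (by simpa [k1] using hNB) d4 d3
          (by rwa [d1]) (by rwa [d1, d2])) (T' := 30) fun s₂ hF₂ h₂ => HT.of_wp_le ?_ (Nat.le_of_ble_eq_true rfl)).mono ?_
          fun _ _ h => h
        · have l1 : s₂.var .i = i := (hF₂.1 _ rfl).trans k3
          have l2 : s₂.arr .Cnt = s'.arr .Cnt := (hF₂.2 _ rfl).trans k4
          have l3 := hCnt i hi hnlt
          have l4 := hI1 i le_rfl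
          rw [d1, d2] at h₂
          simp only [Stmt.wp, Exp.ok_add, Exp.ok_get, Exp.ok_var, Exp.eval_add, Exp.eval_get,
            Exp.eval_var, HState.setA_arr_self, l1, l2, h₂, l4, true_and]
          refine ⟨⟨by omega, by omega⟩, by omega, fun j hj => ?_, fun j hj hj' => ?_⟩
          · rw [if_neg (by omega)]; exact hI1 j (by omega)
          · split_ifs with hji
            · rw [hji]
            · exact hI2 j (by omega) hj'
        · rw [d1, d2]
          by_cases hb : EarlyCollision gA gB (s.var .per) (δ i) (m i)
          · rw [if_pos hb, if_pos ⟨hnlt, hb⟩]; omega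
          · rw [if_neg hb]; omega
    · change 9 + 2 + 1 + _ ≤ _
      omega
  · rw [Finset.sum_add_distrib, ← Finset.sum_filter, Finset.sum_const, Finset.sum_const]
    have hcard : ∀ [DecidablePred bad], ((Finset.range (s.var .hh)).filter bad).card ≤ 9 := by
      intro inst
      -- All occurrences lie on one side of the anchor, so the distance determines `i`.
      have hinj : Set.InjOn δ ((Finset.range (s.var .hh)).filter bad : Finset ℕ) := by
        intro i hi j hj hij
        simp only [Finset.coe_filter, Finset.mem_range, Set.mem_ofPred_eq] at hi hj
        have hi1 := hi.2.1
        have hj1 := hj.2.1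
        rw [hδ, hδ] at hij
        rcases hmono with h | h
        · have := h i hi.1 hi1
          have := h j hj.1 hj1
          omega
        · have := h i hi.1 hi1
          have := h j hj.1 hj1
          omega
      rw [← Finset.card_image_of_injOn hinj]
      refine card_le_of_earlyCollision (gA := gA) (gB := gB) (π := s.var .per)
        (fun d => s.var .la) _ ?_
      intro d hd
      simp only [Finset.mem_image, Finset.mem_filter] at hd
      obtain ⟨i, hi, rfl⟩ := hd
      obtain ⟨x, hx, hx'⟩ := hi.2.2
      have := hm i
      exact ⟨x, by omega, hx'⟩
    simp only [smul_eq_mul, Finset.card_range]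
    have hsum : ∀ k ≤ 9, s.var .hh * 400 + k * (100 * s.var .la) + 11 * s.var .hh + 8 ≤
        1000 * s.var .la + 1000 * s.var .hh + 8 := by
      intro k hk
      have := Nat.mul_le_mul_right (100 * s.var .la) hk
      omega
    exact hsum _ hcard

open Stmt in
/-- Compare the surroundings of the block and of its occurrences, on one side. -/
def comparisonPass : Stmt :=
  copySegment .A .ua .la ;; copySegment .B .ub .lb ;; nextDeviation .A .NA .la ;;
  nextDeviation .B .NB .lb ;; comparisonLoop

theorem comparisonPass_spec (M : Machine) (s : HState) {gA gB δ m : ℕ → ℕ}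
    (hgA : ∀ x, gA x = s.arr .F (s.var .ua + s.var .up * x - s.var .dn * x))
    (hgB : ∀ x, gB x = s.arr .F (s.var .ub + s.var .up * x - s.var .dn * x))
    (hδ : ∀ i, δ i = (i - s.var .anc) + (s.var .anc - i))
    (hm : ∀ i, m i = min (s.var .la) (s.var .lb - δ i))
    (hla : s.var .la < M.D) (hlb : s.var .lb < M.D)
    (hup : s.var .up ≤ 1) (hdn : s.var .dn ≤ 1)
    (hua : ∀ x < s.var .la, s.var .ua + s.var .up * x < M.D)
    (hub : ∀ x < s.var .lb, s.var .ub + s.var .up * x < M.D)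
    (hanc : s.var .anc < s.var .hh) (hD : s.var .q + s.var .hh ≤ M.D)
    (hmono : (∀ i < s.var .hh, s.var .q ≤ s.arr .Z (s.var .q + i) → s.var .anc ≤ i) ∨
      ∀ i < s.var .hh, s.var .q ≤ s.arr .Z (s.var .q + i) → i ≤ s.var .anc)
    (hocc : ∀ i < s.var .hh, s.var .q ≤ s.arr .Z (s.var .q + i) → δ i ≤ s.var .lb ∧
      (∀ y < δ i, ¬ Deviates gB (s.var .per) y) ∧
      ∀ x < m i, gA (x % s.var .per) = gB ((x + δ i) % s.var .per))
    (hCnt : ∀ i < s.var .hh, s.var .q ≤ s.arr .Z (s.var .q + i) → s.arr .Cnt i ≤ 3) :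
    HT M comparisonPass s (1100 * s.var .la + 100 * s.var .lb + 1000 * s.var .hh + 208)
      (fun s' => ∀ i < s.var .hh, s.var .q ≤ s.arr .Z (s.var .q + i) →
        s'.arr .Cnt i = s.arr .Cnt i + min 3 (mismatches gA gB (δ i) (m i))) := by
  refine ((copySegment_spec M .A .ua .la s (by decide) (by decide) (by decide) hla hup hdn hua).seq
    (T' := 1060 * s.var .la + 100 * s.var .lb + 1000 * s.var .hh + 168)
    fun s₁ hF₁ h₁ => ?_).mono (by omega) fun _ _ h => h
  have a1 : s₁.var .lb = s.var .lb := hF₁.1 _ rfl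
  have a2 : s₁.var .ub = s.var .ub := hF₁.1 _ rfl
  have a3 : s₁.var .up = s.var .up := hF₁.1 _ rfl
  have a4 : s₁.var .dn = s.var .dn := hF₁.1 _ rfl
  have a5 : s₁.arr .F = s.arr .F := hF₁.2 _ rfl
  have h₂ := copySegment_spec M .B .ub .lb s₁ (by decide) (by decide) (by decide)
    (by rwa [a1]) (by rwa [a3]) (by rwa [a4]) (by rwa [a1, a2, a3])
  rw [a1, a2, a3, a4, a5] at h₂
  refine (h₂.seq (T' := 1060 * s.var .la + 60 * s.var .lb + 1000 * s.var .hh + 128)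
    fun s₂ hF₂ h₂ => ?_).mono (by omega) fun _ _ h => h
  have b1 : s₂.var .la = s.var .la := (hF₂.1 _ rfl).trans (hF₁.1 _ rfl)
  have b2 : s₂.var .lb = s.var .lb := (hF₂.1 _ rfl).trans (hF₁.1 _ rfl)
  have b3 : s₂.var .per = s.var .per := (hF₂.1 _ rfl).trans (hF₁.1 _ rfl)
  have b4 : s₂.arr .A = s₁.arr .A := hF₂.2 _ rfl
  have h₃ := nextDeviation_spec M .A .NA .la s₂ (by decide) (by rwa [b1]) (g := gA)
    (fun x hx => by rw [b4, h₁ x (by rwa [← b1]), hgA])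
  rw [b1, b3] at h₃
  refine (h₃.seq (T' := 1000 * s.var .la + 60 * s.var .lb + 1000 * s.var .hh + 68)
    fun s₃ hF₃ h₃ => ?_).mono (by omega) fun _ _ h => h
  have c1 : s₃.var .lb = s.var .lb := (hF₃.1 _ rfl).trans b2
  have c2 : s₃.var .per = s.var .per := (hF₃.1 _ rfl).trans b3
  have c3 : s₃.arr .B = s₂.arr .B := hF₃.2 _ rfl
  have h₄ := nextDeviation_spec M .B .NB .lb s₃ (by decide) (by rwa [c1]) (g := gB)
    (fun x hx => by rw [c3, h₂ x (by rwa [← c1]), hgB])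
  rw [c1, c2] at h₄
  refine (h₄.seq (T' := 1000 * s.var .la + 1000 * s.var .hh + 8)
    fun s₄ hF₄ h₄ => ?_).mono (by omega) fun _ _ h => h
  have hv : ∀ v, v ≠ .x → s₄.var v = s.var v := fun v hv =>
    (hF₄.1 v (by simp [nextDeviation, Stmt.writes, hv])).trans <|
    (hF₃.1 v (by simp [nextDeviation, Stmt.writes, hv])).trans <|
    (hF₂.1 v (by simp [copySegment, Stmt.count, Stmt.writes, hv])).trans <|
    hF₁.1 v (by simp [copySegment, Stmt.count, Stmt.writes, hv])
  have hZ : s₄.arr .Z = s.arr .Z :=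
    (hF₄.2 _ rfl).trans <| (hF₃.2 _ rfl).trans <| (hF₂.2 _ rfl).trans <| hF₁.2 _ rfl
  have hC : s₄.arr .Cnt = s.arr .Cnt :=
    (hF₄.2 _ rfl).trans <| (hF₃.2 _ rfl).trans <| (hF₂.2 _ rfl).trans <| hF₁.2 _ rfl
  have hA : s₄.arr .A = s₁.arr .A := (hF₄.2 _ rfl).trans <| (hF₃.2 _ rfl).trans b4
  have hB : s₄.arr .B = s₂.arr .B := (hF₄.2 _ rfl).trans c3
  have hNA : s₄.arr .NA = s₃.arr .NA := hF₄.2 _ rfl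
  have key := comparisonLoop_spec M s₄ (gA := gA) (gB := gB) (δ := δ) (m := m)
  simp only [hv _ (show Var.anc ≠ .x by decide), hv _ (show Var.la ≠ .x by decide),
    hv _ (show Var.lb ≠ .x by decide), hv _ (show Var.per ≠ .x by decide),
    hv _ (show Var.hh ≠ .x by decide), hv _ (show Var.q ≠ .x by decide), hZ, hC] at key
  exact key hδ hm hla hlb (fun x hx => by rw [hA, h₁ x hx, hgA])
    (fun x hx => by rw [hB, h₂ x hx, hgB]) (by rwa [hNA]) h₄ hanc hD hmono hocc hCnt

/-! ### Prefix matches by the Z-algorithm -/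

/-- `z` is the length of the longest common prefix of `g[0..N)` and `g[k..N)`. -/
structure IsPrefixMatch (g : ℕ → ℕ) (N k z : ℕ) : Prop where
  le : k + z ≤ N
  eq : ∀ y < z, g y = g (k + y)
  ne : k + z < N → g z ≠ g (k + z)

namespace IsPrefixMatch

variable {g : ℕ → ℕ} {N k z : ℕ}

theorem le_of_eq (h : IsPrefixMatch g N k z) {y : ℕ} (hy : k + y ≤ N)
    (heq : ∀ j < y, g j = g (k + j)) : y ≤ z := by
  by_contra hc
  exact h.ne (by omega) (heq z (by omega))

theorem exists_of_le (hk : k ≤ N) : ∃ z, IsPrefixMatch g N k z := by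
  classical
  have hex : ∃ z, N ≤ k + z ∨ g z ≠ g (k + z) := ⟨N, Or.inl (by omega)⟩
  have h1 : ∀ y < Nat.find hex, k + y < N ∧ g y = g (k + y) := by
    intro y hy
    have := Nat.find_min hex hy
    push Not at this
    exact this
  refine ⟨Nat.find hex, ?_, fun y hy => (h1 y hy).2, fun hlt => ?_⟩
  · rcases Nat.eq_zero_or_pos (Nat.find hex) with h0 | h0
    · omega
    · have := h1 (Nat.find hex - 1) (by omega)
      omega
  · exact (Nat.find_spec hex).resolve_left (by omega)

end IsPrefixMatch

open Stmt in
/-- Extend the match at `k` letter by letter. -/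
def extendMatch : Stmt :=
  loop 0 ⇡.go
    (ifLt (⇡.k + ⇡.z) ⇡.len
      (ifEq (.get .W ⇡.z) (.get .W (⇡.k + ⇡.z)) (.z ≔ ⇡.z + 1) (.go ≔ 0))
      (.go ≔ 0))

theorem extendMatch_spec (M : Machine) (s : HState) {zf : ℕ} (hlen : s.var .len < M.D)
    (hzf : IsPrefixMatch (s.arr .W) (s.var .len) (s.var .k) zf) (hz : s.var .z ≤ zf)
    (hgo : s.var .go = 1 ∨ s.var .go = 0 ∧ s.var .z = zf) :
    HT M extendMatch s (60 * (zf - s.var .z) + 70) (fun s' => s'.var .z = zf) := by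
  have hW := M.word
  have hD := M.pos
  have hle := hzf.le
  refine (HT.loop (fun T s' => s'.var .z ≤ zf ∧ ((s'.var .go = 1 ∧ 60 * (zf - s'.var .z) + 60 ≤ T) ∨
    (s'.var .go = 0 ∧ s'.var .z = zf ∧ 1 ≤ T))) (T := 60 * (zf - s.var .z) + 60) ?_ ?_
    (Q := fun s' => s'.var .z = zf)).mono ?_ fun _ _ h => h
  · rintro T s' hF ⟨hz', hI⟩
    have e1 : s'.var .len = s.var .len := hF.1 _ rfl
    have e2 : s'.var .k = s.var .k := hF.1 _ rfl
    have e3 : s'.arr .W = s.arr .W := hF.2 _ rfl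
    refine ⟨show 0 < M.W by omega, trivial, fun hlt => ?_, fun hnlt => ?_⟩
    · have hgo' : s'.var .go = 1 ∧ 60 * (zf - s'.var .z) + 60 ≤ T := by
        rcases hI with hI | hI
        · exact hI
        · simp [hI.1] at hlt
      have hwp : ∀ Q : HState → Prop, (s'.var .z < zf → Q (s'.setV .z (s'.var .z + 1))) →
          (s'.var .z = zf → Q (s'.setV .go 0)) → HT M (Stmt.ifLt (⇡.k + ⇡.z) ⇡.len
      (.ifEq (.get .W ⇡.z) (.get .W (⇡.k + ⇡.z)) (.z ≔ ⇡.z + 1) (.go ≔ 0)) (.go ≔ 0)) s' 45 Q := by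
        intro Q q1 q2
        refine HT.of_wp_le ?_ (Nat.le_of_ble_eq_true rfl)
        simp only [Stmt.wp, Exp.ok_add, Exp.ok_get, Exp.ok_var, Exp.ok_ofNat, Exp.eval_add,
          Exp.eval_get, Exp.eval_var, Exp.eval_ofNat, e1, e2, e3, true_and]
        refine ⟨by omega, fun hlt' => ⟨by omega, by omega, fun heq => ⟨by omega, by omega, q1 ?_⟩,
          fun hne => ⟨by omega, by omega, q2 ?_⟩⟩, fun hnlt => ⟨by omega, by omega, q2 (by omega)⟩⟩
        · by_contra hc
          have hzz : s'.var .z = zf := by omega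
          rw [hzz] at heq
          exact hzf.ne (by omega) heq
        · by_contra hc
          exact hne (hzf.eq _ (by omega))
      by_cases hzz : s'.var .z < zf
      · refine ⟨45, 60 * (zf - (s'.var .z + 1)) + 60, ?_, hwp _ (fun _ => ?_) fun h => ?_⟩
        · change 45 + _ + 4 ≤ _
          omega
        · simp only [HState.setV_var, if_true, reduceCtorEq, if_false]
          exact ⟨by omega, Or.inl ⟨hgo'.1, le_rfl⟩⟩
        · omega
      · refine ⟨45, 1, ?_, hwp _ (fun _ => ?_) fun h => ?_⟩
        · change 45 + _ + 4 ≤ _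
          omega
        · omega
        · simp only [HState.setV_var, if_true, reduceCtorEq, if_false]
          exact ⟨hz', Or.inr ⟨trivial, h, le_rfl⟩⟩
    · rcases hI with hI | hI
      · simp [hI.1] at hnlt
      · exact ⟨by omega, hI.2.1⟩
  · exact ⟨hz, hgo.imp (fun h => ⟨h, le_rfl⟩) fun h => ⟨h.1, h.2, by omega⟩⟩
  · have hc : Exp.cost 0 + Exp.cost ⇡Var.go = 3 := rfl
    rw [hc]
    omega

open Stmt in
/-- The part of the match that is known from earlier ones. -/
def startMatch : Stmt :=
  .go ≔ 1 ;; .z ≔ ⇡.r - ⇡.k ;;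
  ifLt ⇡.k ⇡.r (ifLt (.get .Z (⇡.k - ⇡.l)) (⇡.r - ⇡.k)
    (.z ≔ .get .Z (⇡.k - ⇡.l) ;; .go ≔ 0) skip) skip

open Stmt in
/-- Store the match and go on. -/
def finishMatch : Stmt :=
  put .Z ⇡.k ⇡.z ;; ifLt ⇡.r (⇡.k + ⇡.z) (.l ≔ ⇡.k ;; .r ≔ ⇡.k + ⇡.z) skip ;; .k ≔ ⇡.k + 1

open Stmt in
/-- The table of the prefix matches of `W[0..len)`. -/
def prefixMatches : Stmt :=
  (.l ≔ 0 ;; .r ≔ 0 ;; .k ≔ 1) ;;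
  loop ⇡.k ⇡.len (startMatch ;; extendMatch ;; finishMatch)

/-- The interval from `l` to `r` is the match found so far that reaches farthest, and its letters
repeat a prefix of the word. A successful comparison of letters in `extendMatch` pushes the end of
the current match beyond `r`, so the term `60 * (N - r)` of the budget pays for the comparisons and
`200 * (N - k)` for the rest of each round. -/
theorem prefixMatches_spec (M : Machine) (s : HState) (hlen : s.var .len < M.D)
    (hlen' : 1 ≤ s.var .len) :
    HT M prefixMatches s (400 * s.var .len + 100) (fun s' => ∀ j, 1 ≤ j → j < s.var .len →
      IsPrefixMatch (s.arr .W) (s.var .len) j (s'.arr .Z j)) := by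
  have hW := M.word
  have hD := M.pos
  set N := s.var .len with hN
  set g := s.arr .W with hg
  refine (HT.seq (T := 20) (R := fun s₁ => s₁.var .l = 0 ∧ s₁.var .r = 0 ∧ s₁.var .k = 1)
    (HT.of_wp_le ?_ (Nat.le_of_ble_eq_true rfl)) fun s₁ hF₁ ⟨h1, h2, h3⟩ =>
    HT.loop (fun T s' => 1 ≤ s'.var .k ∧ s'.var .k ≤ N ∧ s'.var .r ≤ N ∧
      (s'.var .r = 0 ∨ 1 ≤ s'.var .l ∧ s'.var .l < s'.var .k) ∧
      (∀ y, s'.var .l + y < s'.var .r → g y = g (s'.var .l + y)) ∧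
      (∀ j, 1 ≤ j → j < s'.var .k → IsPrefixMatch g N j (s'.arr .Z j)) ∧
      200 * (N - s'.var .k) + 60 * (N - s'.var .r) + 1 ≤ T)
      (T := 200 * N + 60 * N + 1) ?_ ?_).mono ?_ fun _ _ h => h
  · simp only [Stmt.wp, Exp.ok_ofNat, Exp.eval_ofNat, HState.setV_var, if_true, reduceCtorEq,
      if_false, and_true]
    omega
  · rintro T s' hF ⟨hk1, hkN, hrN, hlr, hbox, hZ, hT⟩
    have e1 : s'.var .len = N := (hF.1 _ rfl).trans (hF₁.1 _ rfl)
    have e2 : s'.arr .W = g := (hF.2 _ rfl).trans (hF₁.2 _ rfl)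
    refine ⟨trivial, trivial, fun hlt => ?_, fun hnlt => ?_⟩
    · simp only [Exp.eval_var, e1] at hlt
      obtain ⟨zf, hzf⟩ := IsPrefixMatch.exists_of_le (g := g) hkN
      have hle := hzf.le
      have hr' : s'.var .r ≤ max (s'.var .r) (s'.var .k + zf) := le_max_left _ _
      have hr'' : s'.var .k + zf ≤ max (s'.var .r) (s'.var .k + zf) := le_max_right _ _
      have hrN' : max (s'.var .r) (s'.var .k + zf) ≤ N := max_le hrN hle
      have hzr : s'.var .r - s'.var .k ≤ zf ∨ (zf < s'.var .r - s'.var .k) := by omega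
      refine ⟨55 + (60 * (zf - (s'.var .r - s'.var .k)) + 70 + 45), 200 * (N - (s'.var .k + 1)) +
        60 * (N - max (s'.var .r) (s'.var .k + zf)) + 1, ?_, ?_⟩
      · change _ + _ + 5 ≤ _
        omega
      refine HT.seq (R := fun s₂ => s₂.var .z ≤ zf ∧ (s₂.var .go = 1 ∧ s'.var .r - s'.var .k ≤ s₂.var .z ∨
        s₂.var .go = 0 ∧ s₂.var .z = zf)) (HT.of_wp_le ?_ (Nat.le_of_ble_eq_true rfl)) fun s₂ hF₂ h₂ => ?_
      · simp only [startMatch, Stmt.wp, Exp.ok_sub, Exp.ok_get, Exp.ok_var,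
          Exp.ok_ofNat, Exp.eval_sub, Exp.eval_get, Exp.eval_var, Exp.eval_ofNat,
          HState.setV_var, HState.setV_arr, if_true, reduceCtorEq, if_false, true_and]
        have hcopy : ∀ y, y < s'.var .r - s'.var .k → g (s'.var .k - s'.var .l + y) = g (s'.var .k + y) := by
          intro y hy
          have h5 := hbox (s'.var .k - s'.var .l + y) (by omega)
          rw [h5]; congr 1; omega
        refine ⟨by omega, by omega, by omega, by omega, fun hkr => ⟨by omega, by omega, fun hzlt => ?_,
          fun hznlt => ?_⟩, fun hkr => ?_⟩
        -- The match at `k - l` ends strictly inside the known interval, so its mismatch is repeated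
        -- at `k` and the value is final.
        · have h5 := hZ (s'.var .k - s'.var .l) (by omega) (by omega)
          have h6 : s'.arr .Z (s'.var .k - s'.var .l) = zf := by
            apply le_antisymm
            · refine hzf.le_of_eq (by omega) fun j hj => ?_
              rw [h5.eq j hj, hcopy j (by omega)]
            · by_contra hc
              refine h5.ne (by omega) ?_
              rw [hzf.eq _ (by omega), hcopy _ hzlt]
          exact ⟨by omega, by omega, by omega, by omega, by omega, Or.inr h6⟩
        · have h5 := hZ (s'.var .k - s'.var .l) (by omega) (by omega)
          refine ⟨hzf.le_of_eq (by omega) fun j hj => ?_, Or.inl le_rfl⟩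
          rw [h5.eq j (by omega), hcopy j hj]
        · exact ⟨by omega, Or.inl le_rfl⟩
      · have f1 : s₂.var .k = s'.var .k := hF₂.1 _ rfl
        have f2 : s₂.var .r = s'.var .r := hF₂.1 _ rfl
        have f3 : s₂.var .l = s'.var .l := hF₂.1 _ rfl
        have f4 : s₂.arr .Z = s'.arr .Z := hF₂.2 _ rfl
        have f5 : s₂.var .len = N := (hF₂.1 _ rfl).trans e1
        have f6 : s₂.arr .W = g := (hF₂.2 _ rfl).trans e2
        refine (HT.seq (extendMatch_spec M s₂ (zf := zf) (by rwa [f5]) (by rwa [f5, f6, f1]) h₂.1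
          (h₂.2.imp (fun h => h.1) fun h => h)) (T' := 45) fun s₃ hF₃ h₃ =>
          HT.of_wp_le ?_ (Nat.le_of_ble_eq_true rfl)).mono (by omega) fun _ _ h => h
        have g1 : s₃.var .k = s'.var .k := (hF₃.1 _ rfl).trans f1
        have g2 : s₃.var .r = s'.var .r := (hF₃.1 _ rfl).trans f2
        have g3 : s₃.var .l = s'.var .l := (hF₃.1 _ rfl).trans f3
        have g4 : s₃.arr .Z = s'.arr .Z := (hF₃.2 _ rfl).trans f4
        have hZ' : ∀ j, 1 ≤ j → j < s'.var .k + 1 →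
            IsPrefixMatch g N j (if j = s'.var .k then zf else s'.arr .Z j) := by
          intro j hj1 hj2
          split_ifs with hj
          · rwa [hj]
          · exact hZ j hj1 (by omega)
        simp only [finishMatch, Stmt.wp, Exp.ok_add, Exp.ok_var, Exp.ok_ofNat, Exp.eval_add,
          Exp.eval_var, Exp.eval_ofNat, HState.setV_var, HState.setV_arr, HState.setA_var,
          HState.setA_arr_self, if_true, reduceCtorEq, if_false, g1, g2, g3, g4, h₃, true_and]
        refine ⟨by omega, by omega, fun hrk => ⟨by omega, by omega, by omega, by omega, by omega,
          by omega, by omega, by omega, by omega, ?_, hZ', ?_⟩, fun hrk => ⟨by omega, by omega, by omega,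
          by omega, by omega, by omega, hbox, hZ', ?_⟩⟩
        · intro y hy
          exact hzf.eq y (by omega)
        · rw [max_eq_right (by omega)]
        · rw [max_eq_left (by omega)]
    · simp only [Exp.eval_var, e1] at hnlt
      exact ⟨by omega, fun j hj1 hj2 => hZ j hj1 (by omega)⟩
  · refine ⟨by omega, by omega, by omega, Or.inl h2, fun y hy => by omega, fun j hj1 hj2 => by omega, by omega⟩
  · change 20 + (_ + 4) ≤ _
    omega

/-! ### Periods and mismatches -/

/-- `π` is the least period of `b[0..q)`. -/
structure IsLeastPeriod (b : ℕ → ℕ) (q π : ℕ) : Prop where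
  pos : 1 ≤ π
  le : π ≤ q
  eq : ∀ x, x + π < q → b x = b (x + π)
  least : ∀ k, 1 ≤ k → k < π → ∃ x, x + k < q ∧ b x ≠ b (x + k)

/-- The least period divides every period that is not too long. -/
theorem IsLeastPeriod.dvd {b : ℕ → ℕ} {q π : ℕ} (h : IsLeastPeriod b q π) {δ : ℕ}
    (hδ : ∀ x, x + δ < q → b x = b (x + δ)) (hle : δ + π ≤ q) : π ∣ δ := by
  induction δ using Nat.strong_induction_on with
  | _ δ ih =>
    have hpos := h.pos
    rcases Nat.eq_zero_or_pos δ with rfl | h0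
    · exact dvd_zero _
    rcases lt_or_ge δ π with hlt | hge
    · obtain ⟨x, hx, hne⟩ := h.least δ h0 hlt
      exact absurd (hδ x hx) hne
    · have := ih (δ - π) (by omega) (fun x hx => ?_) (by omega)
      · exact (Nat.dvd_sub_iff_left hge dvd_rfl).1 this
      -- `δ - π` is a period again: near the left end go right by `δ` and then back by `π`;
      -- elsewhere go back first.
      · rcases lt_or_ge x π with hx' | hx'
        · rw [hδ x (by omega), h.eq (x + (δ - π)) (by omega)]
          congr 1; omega
        · have h1 := h.eq (x - π) (by omega)
          have h2 := hδ (x - π) (by omega)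
          rw [Nat.sub_add_cancel hx'] at h1
          rw [← h1, h2]
          congr 1; omega

/-- If `δ + π` exceeded `q`, then `2 * δ < q` would give `δ < π`, and `δ` would be a period below
the least one. -/
theorem IsLeastPeriod.dvd_of_lt {b : ℕ → ℕ} {q π : ℕ} (h : IsLeastPeriod b q π) {δ : ℕ}
    (hδ : ∀ x, x + δ < q → b x = b (x + δ)) (hle : 2 * δ < q) : π ∣ δ := by
  rcases Nat.eq_zero_or_pos δ with rfl | h0
  · exact dvd_zero _
  refine h.dvd hδ ?_
  by_contra hc
  obtain ⟨x, hx, hne⟩ := h.least δ h0 (by omega)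
  exact hne (hδ x hx)

theorem eq_mod_of_period {b : ℕ → ℕ} {q π : ℕ} (h : ∀ x, x + π < q → b x = b (x + π)) {y : ℕ}
    (hy : y < q) : b y = b (y % π) := by
  induction y using Nat.strong_induction_on with
  | _ y ih =>
    rcases Nat.eq_zero_or_pos π with rfl | h0
    · rw [Nat.mod_zero]
    rcases lt_or_ge y π with hlt | hge
    · rw [Nat.mod_eq_of_lt hlt]
    · rw [Nat.mod_eq_sub_mod hge, ← ih (y - π) (by omega) (by omega), h (y - π) (by omega),
        Nat.sub_add_cancel hge]

/-- Two words that start with the same periodic block, and a shift by a multiple of the period. -/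
theorem not_deviates_and_eq_of_period {gA gB : ℕ → ℕ} {q π δ : ℕ} (hpos : 1 ≤ π) (hle : π ≤ q)
    (h : ∀ x, x + π < q → gB x = gB (x + π)) (hAB : ∀ x < q, gA x = gB x) (hdvd : π ∣ δ)
    (hδ : δ ≤ q) :
    (∀ y < δ, ¬ Deviates gB π y) ∧ ∀ x, gA (x % π) = gB ((x + δ) % π) := by
  refine ⟨fun y hy => not_not.2 (eq_mod_of_period h (by omega)), fun x => ?_⟩
  obtain ⟨t, rfl⟩ := hdvd
  rw [Nat.add_mul_mod_self_left]
  exact hAB _ ((Nat.mod_lt _ hpos).trans_le hle)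

theorem count_reflect (p : ℕ → Prop) [DecidablePred p] (m : ℕ) :
    Nat.count (fun x => p (m - 1 - x)) m = Nat.count p m := by
  simp only [Nat.count_eq_card_filter_range, Finset.card_filter]
  exact Finset.sum_range_reflect (fun x => if p x then 1 else 0) m

/-- The mismatches to the right and to the left of a matching block. -/
theorem count_add_count_of_block {p : ℕ → Prop} [DecidablePred p] {c q l : ℕ} (hl : c + q ≤ l)
    (h : ∀ x < q, ¬ p (c + x)) :
    Nat.count (fun x => p (c + x)) (l - c) + Nat.count (fun x => p (c + q - 1 - x)) (c + q) =
      Nat.count p l := by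
  rw [count_reflect, ← count_eq_of_forall_not (p := p) (Nat.le_add_right c q), add_comm, ← Nat.count_add]
  · congr 1; omega
  · intro y h1 h2
    have := h (y - c) (by omega)
    rwa [Nat.add_sub_cancel' h1] at this

theorem twoErrorShift_iff_mismatches {f : ℕ → ℕ} {n p : ℕ} :
    TwoErrorShift f n p ↔ mismatches f f p (n - p) = 2 := by
  rw [mismatches, Nat.count_eq_card_filter_range, Finset.card_eq_two]
  constructor
  · rintro ⟨i, j, hij, hj, hi', hj', h⟩
    refine ⟨i, j, hij.ne, ?_⟩
    ext x
    simp only [Finset.mem_filter, Finset.mem_range, Finset.mem_insert, Finset.mem_singleton]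
    constructor
    · rintro ⟨h1, h2⟩
      by_contra hc
      push Not at hc
      exact h2 (h x (by omega) hc.1 hc.2)
    · rintro (rfl | rfl)
      · exact ⟨by omega, hi'⟩
      · exact ⟨by omega, hj'⟩
  · rintro ⟨i, j, hij, h⟩
    have h' : ∀ x, (x + p < n ∧ f x ≠ f (x + p)) ↔ x = i ∨ x = j := by
      intro x
      have := Finset.ext_iff.1 h x
      simp only [Finset.mem_filter, Finset.mem_range, Finset.mem_insert, Finset.mem_singleton] at this
      rw [← this]
      exact and_congr_left fun _ => by omega
    have hi := (h' i).2 (Or.inl rfl)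
    have hj := (h' j).2 (Or.inr rfl)
    have h'' : ∀ x, x + p < n → x ≠ i → x ≠ j → f x = f (x + p) := by
      intro x hx h1 h2
      by_contra hc
      rcases (h' x).1 ⟨hx, hc⟩ with h3 | h3 <;> contradiction
    rcases lt_or_gt_of_ne hij with hlt | hgt
    · exact ⟨i, j, hlt, hj.1, hi.2, hj.2, h''⟩
    · exact ⟨j, i, hgt, hi.1, hj.2, hi.2, fun x h1 h2 h3 => h'' x h1 h3 h2⟩

/-- One of three consecutive blocks has no error. -/
theorem TwoErrorShift.exists_block {f : ℕ → ℕ} {n p q : ℕ} (h : TwoErrorShift f n p)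
    (hq : 3 * q + p ≤ n) : ∃ t < 3, ∀ x < q, f (q * t + x) = f (q * t + x + p) := by
  obtain ⟨i, j, -, -, -, -, h⟩ := h
  by_contra hc
  push Not at hc
  obtain ⟨x, hx, h0⟩ := hc 0 (by norm_num)
  obtain ⟨y, hy, h1⟩ := hc 1 (by norm_num)
  obtain ⟨z, hz, h2⟩ := hc 2 (by norm_num)
  have k0 : q * 0 + x = i ∨ q * 0 + x = j := by
    by_contra hk; push Not at hk; exact h0 (h _ (by omega) hk.1 hk.2)
  have k1 : q * 1 + y = i ∨ q * 1 + y = j := by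
    by_contra hk; push Not at hk; exact h1 (h _ (by omega) hk.1 hk.2)
  have k2 : q * 2 + z = i ∨ q * 2 + z = j := by
    by_contra hk; push Not at hk; exact h2 (h _ (by omega) hk.1 hk.2)
  omega

theorem not_twoErrorShift_zero {f : ℕ → ℕ} {n : ℕ} : ¬ TwoErrorShift f n 0 := by
  rintro ⟨i, j, -, -, h, -⟩
  exact h rfl

theorem twoErrorShift_of_add_two {f : ℕ → ℕ} {n p : ℕ} (hp : p + 2 = n) :
    TwoErrorShift f n p ↔ f 0 ≠ f p ∧ f 1 ≠ f (1 + p) := by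
  constructor
  · rintro ⟨i, j, hij, hj, hi', hj', -⟩
    obtain rfl : i = 0 := by omega
    obtain rfl : j = 1 := by omega
    rw [zero_add] at hi'
    exact ⟨hi', hj'⟩
  · rintro ⟨h0, h1⟩
    exact ⟨0, 1, by norm_num, by omega, by rwa [zero_add], h1, fun x hx h2 h3 => by omega⟩

theorem TwoErrorShift.add_two_le {f : ℕ → ℕ} {n p : ℕ} (h : TwoErrorShift f n p) : p + 2 ≤ n := by
  obtain ⟨i, j, hij, hj, -⟩ := h
  omega

/-! ### One block and one window of shifts -/

/-- The word in which the occurrences of the block at `c` are searched: the block, followed by the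
part of the input between the positions `c + p0` and `c + p0 + hh + q - 1`. -/
def windowWord (f : ℕ → ℕ) (q c p0 x : ℕ) : ℕ := if x < q then f (c + x) else f (c + p0 + (x - q))

open Stmt in
/-- Build the window and compute its prefix matches. -/
def windowMatches : Stmt :=
  .len ≔ ⇡.q + ⇡.q + ⇡.hh - 1 ;;
  count .x .len (ifLt ⇡.x ⇡.q (put .W ⇡.x (.get .F (⇡.c + ⇡.x)))
    (put .W ⇡.x (.get .F (⇡.c + ⇡.p0 + (⇡.x - ⇡.q))))) ;;
  prefixMatches

/-- The size conditions on a window. -/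
structure WindowFits (M : Machine) (s : HState) : Prop where
  one_le_q : 1 ≤ s.var .q
  one_le_hh : 1 ≤ s.var .hh
  hh_le : 2 * s.var .hh ≤ s.var .q + 1
  fits : s.var .c + s.var .q + s.var .p0 + s.var .hh ≤ M.D
  len_le : 2 * s.var .q + s.var .hh ≤ M.D

theorem WindowFits.of_frame {M : Machine} {s s' : HState} {P : Stmt} (h : WindowFits M s)
    (hF : Frame P s s') (hw : ∀ v ∈ [Var.q, .hh, .c, .p0], P.writes v = false) : WindowFits M s' := by
  have h1 := hF.1 .q (hw _ (by decide))
  have h2 := hF.1 .hh (hw _ (by decide))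
  have h3 := hF.1 .c (hw _ (by decide))
  have h4 := hF.1 .p0 (hw _ (by decide))
  exact ⟨h1 ▸ h.1, h2 ▸ h.2, h1 ▸ h2 ▸ h.3, h1 ▸ h2 ▸ h3 ▸ h4 ▸ h.4, h1 ▸ h2 ▸ h.5⟩

theorem windowMatches_spec (M : Machine) (s : HState) (h : WindowFits M s) :
    HT M windowMatches s (2000 * s.var .q + 2000) (fun s' =>
      ∀ j, 1 ≤ j → j < 2 * s.var .q + s.var .hh - 1 →
        IsPrefixMatch (windowWord (s.arr .F) (s.var .q) (s.var .c) (s.var .p0))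
          (2 * s.var .q + s.var .hh - 1) j (s'.arr .Z j)) := by
  have hW := M.word
  have hD := M.pos
  obtain ⟨h1, h2, h3, h4, h5⟩ := h
  set N := 2 * s.var .q + s.var .hh - 1 with hN
  set g := windowWord (s.arr .F) (s.var .q) (s.var .c) (s.var .p0) with hg
  refine (HT.seq (T := 20) (R := fun s₁ => s₁.var .len = N) (HT.of_wp_le ?_ (Nat.le_of_ble_eq_true rfl))
    (T' := 40 * N + 30 + (400 * N + 100)) fun s₁ hF₁ h₁ => ?_).mono (by omega) fun _ _ h => h
  · simp only [Stmt.wp, Exp.ok_add, Exp.ok_sub, Exp.ok_var, Exp.ok_ofNat, Exp.eval_add, Exp.eval_sub,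
      Exp.eval_var, Exp.eval_ofNat, HState.setV_var, if_true, true_and]
    omega
  have hcount := HT.count (M := M) (s := s₁) (v := .x) (N := .len)
    (P := (Stmt.ifLt ⇡.x ⇡.q (.put .W ⇡.x (.get .F (⇡.c + ⇡.x)))
    (.put .W ⇡.x (.get .F (⇡.c + ⇡.p0 + (⇡.x - ⇡.q))))))
    (fun i s' => ∀ x < i, s'.arr .W x = g x) (fun _ => 29) (by decide) rfl rfl
    (fun _ _ _ h => h) ?_ (fun x hx => absurd hx (Nat.not_lt_zero x))
  · refine HT.seq (hcount.mono ?_ fun _ _ h => h) fun s₂ hF₂ h₂ => ?_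
    · rw [h₁]; simp; omega
    · have e1 : s₂.var .len = N := (hF₂.1 _ rfl).trans h₁
      have h₃ := prefixMatches_spec M s₂ (by rw [e1]; omega) (by rw [e1]; omega)
      rw [e1] at h₃
      rw [h₁] at h₂
      refine h₃.mono le_rfl fun s' _ h j hj1 hj2 => ?_
      obtain ⟨k1, k2, k3⟩ := h j hj1 hj2
      refine ⟨k1, fun y hy => ?_, fun hlt => ?_⟩
      · have := k2 y hy
        rwa [h₂ _ (by omega), h₂ _ (by omega)] at this
      · have := k3 hlt
        rwa [h₂ _ (by omega), h₂ _ hlt] at this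
  · intro i hi s' hF hx hI
    rw [h₁] at hi
    have e1 : s'.var .q = s.var .q := (hF.1 _ rfl).trans (hF₁.1 _ rfl)
    have e2 : s'.var .c = s.var .c := (hF.1 _ rfl).trans (hF₁.1 _ rfl)
    have e3 : s'.var .p0 = s.var .p0 := (hF.1 _ rfl).trans (hF₁.1 _ rfl)
    have e4 : s'.arr .F = s.arr .F := (hF.2 _ rfl).trans (hF₁.2 _ rfl)
    refine HT.of_wp_le ?_ (Nat.le_of_ble_eq_true rfl)
    simp only [Stmt.wp, Exp.ok_add, Exp.ok_sub, Exp.ok_get, Exp.ok_var, Exp.eval_add, Exp.eval_sub,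
      Exp.eval_get, Exp.eval_var, HState.setA_arr_self, e1, e2, e3, e4, hx, true_and]
    refine ⟨fun hlt => ⟨by omega, by omega, fun x hx => ?_⟩,
      fun hnlt => ⟨by omega, by omega, fun x hx => ?_⟩⟩
    all_goals
      split_ifs with hxi
      · subst hxi
        simp only [hg, windowWord]
        first | rw [if_pos hlt] | rw [if_neg hnlt]
      · exact hI x (by omega)

/-- The block at `c` occurs at the position `c + p0 + i`. -/
def OccursShifted (f : ℕ → ℕ) (q c p0 i : ℕ) : Prop := ∀ x < q, f (c + x) = f (c + p0 + i + x)

/-- No separator is needed after the block, because a longer match does no harm: its first `q`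
letters compare the block with the window. -/
theorem IsPrefixMatch.occursShifted_iff {f : ℕ → ℕ} {q c p0 N i z : ℕ}
    (h : IsPrefixMatch (windowWord f q c p0) N (q + i) z) (hN : q + i + q ≤ N) :
    q ≤ z ↔ OccursShifted f q c p0 i := by
  have hw : ∀ y < q, (windowWord f q c p0 y = windowWord f q c p0 (q + i + y) ↔
      f (c + y) = f (c + p0 + i + y)) := by
    intro y hy
    rw [windowWord, windowWord, if_pos hy, if_neg (by omega),
      show c + p0 + (q + i + y - q) = c + p0 + i + y by omega]
  constructor
  · intro hz x hx
    exact (hw x hx).1 (h.eq x (by omega))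
  · intro ho
    exact h.le_of_eq hN fun j hj => (hw j hj).2 (ho j hj)

open Stmt in
/-- The least period of the block. -/
def blockPeriod : Stmt :=
  .per ≔ 1 ;; loop (.get .Z ⇡.per + ⇡.per) ⇡.q (.per ≔ ⇡.per + 1)

/-- A number is a period of the block exactly when the match there reaches position `q`; the search
stops at `q` at the latest. -/
theorem blockPeriod_spec (M : Machine) (s : HState) {f : ℕ → ℕ} {c p0 N : ℕ}
    (hq : 1 ≤ s.var .q) (hN : s.var .q < N) (hNM : N ≤ M.D)
    (hZ : ∀ j, 1 ≤ j → j < N →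
      IsPrefixMatch (windowWord f (s.var .q) c p0) N j (s.arr .Z j)) :
    HT M blockPeriod s (20 * s.var .q + 20)
      (fun s' => IsLeastPeriod (fun x => f (c + x)) (s.var .q) (s'.var .per)) := by
  have hW := M.word
  have hD := M.pos
  set q := s.var .q with hqdef
  have hw : ∀ y < q, windowWord f q c p0 y = f (c + y) := fun y hy => if_pos hy
  refine (HT.seq (T := 3) (R := fun s₁ => s₁.var .per = 1) (HT.of_wp_le ?_ (Nat.le_of_ble_eq_true rfl))
    fun s₁ hF₁ h₁ => HT.loop (fun T s' => 1 ≤ s'.var .per ∧ s'.var .per ≤ q ∧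
      (∀ k, 1 ≤ k → k < s'.var .per → ∃ x, x + k < q ∧ f (c + x) ≠ f (c + (x + k))) ∧
      20 * (q - s'.var .per) + 1 ≤ T) (T := 20 * q + 1) ?_ ?_).mono ?_ fun _ _ h => h
  · simp only [Stmt.wp, Exp.ok_ofNat, Exp.eval_ofNat, HState.setV_var, if_true, and_true]
    omega
  · rintro T s' hF ⟨hp1, hpq, hI, hT⟩
    have e1 : s'.var .q = q := (hF.1 _ rfl).trans (hF₁.1 _ rfl)
    have e2 : s'.arr .Z = s.arr .Z := (hF.2 _ rfl).trans (hF₁.2 _ rfl)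
    have hZ' := hZ _ hp1 (by omega)
    have hle := hZ'.le
    simp only [Exp.ok_add, Exp.ok_get, Exp.ok_var, Exp.eval_add, Exp.eval_get, Exp.eval_var, e1, e2,
      true_and]
    refine ⟨by omega, fun hlt => ⟨6, 20 * (q - (s'.var .per + 1)) + 1, ?_, HT.of_wp_le ?_ le_rfl⟩,
      fun hnlt => ⟨by omega, hp1, hpq, fun x hx => ?_, hI⟩⟩
    · change 6 + _ + 12 ≤ _
      omega
    · simp only [Stmt.wp, Exp.ok_add, Exp.ok_var, Exp.ok_ofNat, Exp.eval_add, Exp.eval_var,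
        Exp.eval_ofNat, HState.setV_var, if_true, true_and]
      refine ⟨by omega, by omega, by omega, by omega, fun k hk1 hk2 => ?_, le_rfl⟩
      rcases Nat.lt_succ_iff_lt_or_eq.1 hk2 with hk | rfl
      · exact hI k hk1 hk
      · refine ⟨s.arr .Z (s'.var .per), hlt, ?_⟩
        have := hZ'.ne (by omega)
        rwa [hw _ (by omega), hw _ (by omega), add_comm (s'.var .per)] at this
    · have := hZ'.eq x (by omega)
      rwa [hw _ (by omega), hw _ (by omega), add_comm (s'.var .per)] at this
  · exact ⟨by omega, by omega, fun k hk1 hk2 => by omega, by omega⟩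
  · change 3 + (_ + 10) ≤ _
    omega

open Stmt in
/-- Find the first and the last occurrence of the block. -/
def findOccurrences : Stmt :=
  .found ≔ 0 ;;
  count .i .hh (ifLt (.get .Z (⇡.q + ⇡.i)) ⇡.q skip
    (.lst ≔ ⇡.i ;; ifEq ⇡.found 0 (.fst ≔ ⇡.i ;; .found ≔ 1) skip))

theorem findOccurrences_spec (M : Machine) (s : HState) (hD : s.var .q + s.var .hh ≤ M.D) :
    HT M findOccurrences s (60 * s.var .hh + 20) (fun s' =>
      s'.var .found = 0 ∧ (∀ i < s.var .hh, ¬ s.var .q ≤ s.arr .Z (s.var .q + i)) ∨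
      s'.var .found = 1 ∧ s'.var .fst < s.var .hh ∧ s'.var .lst < s.var .hh ∧
        s.var .q ≤ s.arr .Z (s.var .q + s'.var .fst) ∧ s.var .q ≤ s.arr .Z (s.var .q + s'.var .lst) ∧
        ∀ i < s.var .hh, s.var .q ≤ s.arr .Z (s.var .q + i) → s'.var .fst ≤ i ∧ i ≤ s'.var .lst) := by
  have hW := M.word
  have hD0 := M.pos
  set occ : ℕ → Prop := fun i => s.var .q ≤ s.arr .Z (s.var .q + i) with hocc
  refine (HT.seq (T := 3) (R := fun s₁ => s₁.var .found = 0)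
    (HT.of_wp_le ?_ (Nat.le_of_ble_eq_true rfl)) (T' := 51 * s.var .hh + 8)
    fun s₁ hF₁ h₁ => ?_).mono (by omega) fun _ _ h => h
  · simp only [Stmt.wp, Exp.ok_ofNat, Exp.eval_ofNat, HState.setV_var, if_true, and_true]
    omega
  have e3 : s₁.var .hh = s.var .hh := hF₁.1 _ rfl
  have hcount := HT.count (M := M) (s := s₁) (v := .i) (N := .hh)
    (P := .ifLt (.get .Z (⇡.q + ⇡.i)) ⇡.q .skip
      (.lst ≔ ⇡.i ;; .ifEq ⇡.found 0 (.fst ≔ ⇡.i ;; .found ≔ 1) .skip))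
    (fun n s' => s'.var .found = 0 ∧ (∀ i < n, ¬ occ i) ∨
      s'.var .found = 1 ∧ s'.var .fst < n ∧ s'.var .lst < n ∧ occ (s'.var .fst) ∧
        occ (s'.var .lst) ∧ ∀ i < n, occ i → s'.var .fst ≤ i ∧ i ≤ s'.var .lst) (fun _ => 40)
      (by decide) rfl rfl (fun _ _ _ h => by simpa using h) ?_
      (Or.inl ⟨h₁, fun i hi => absurd hi (Nat.not_lt_zero i)⟩)
  · rw [e3] at hcount
    refine hcount.mono ?_ fun s' _ h => h
    simp; omega
  · intro i hi s' hF hx hI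
    have e1 : s'.var .q = s.var .q := (hF.1 _ rfl).trans (hF₁.1 _ rfl)
    have e2 : s'.arr .Z = s.arr .Z := (hF.2 _ rfl).trans (hF₁.2 _ rfl)
    rw [e3] at hi
    have hnew : ∀ {j}, j < i + 1 → j < i ∨ j = i := fun h => Nat.lt_succ_iff_lt_or_eq.1 h
    refine HT.of_wp_le ?_ (Nat.le_of_ble_eq_true rfl)
    simp only [Stmt.wp, Exp.ok_add, Exp.ok_get, Exp.ok_var, Exp.ok_ofNat, Exp.eval_add, Exp.eval_get,
      Exp.eval_var, Exp.eval_ofNat, HState.setV_var, if_true, reduceCtorEq, if_false, e1, e2, hx, true_and]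
    refine ⟨by omega, fun hlt => ?_, fun hnlt => ⟨by omega, by omega, fun h0 => ⟨by omega, by omega, ?_⟩,
      fun h0 => ?_⟩⟩
    · have hno : ¬ occ i := not_le.2 hlt
      rcases hI with ⟨h1, h2⟩ | ⟨h1, h2, h3, h4, h5, h6⟩
      · refine Or.inl ⟨h1, fun j hj => ?_⟩
        rcases hnew hj with hj | rfl
        exacts [h2 j hj, hno]
      · refine Or.inr ⟨h1, by omega, by omega, h4, h5, fun j hj hoj => ?_⟩
        rcases hnew hj with hj | rfl
        exacts [h6 j hj hoj, absurd hoj hno]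
    · have hyes : occ i := not_lt.1 hnlt
      rcases hI with ⟨h1, h2⟩ | ⟨h1, -⟩
      · refine ⟨by omega, Or.inr ⟨by omega, by omega, hyes, hyes, fun j hj hoj => ?_⟩⟩
        rcases hnew hj with hj | rfl
        exacts [absurd hoj (h2 j hj), ⟨le_rfl, le_rfl⟩]
      · omega
    · have hyes : occ i := not_lt.1 hnlt
      rcases hI with ⟨h1, -⟩ | ⟨h1, h2, h3, h4, h5, h6⟩
      · exact absurd h1 h0
      · refine Or.inr ⟨h1, by omega, by omega, h4, hyes, fun j hj hoj => ?_⟩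
        rcases hnew hj with hj | rfl
        · have := h6 j hj hoj
          omega
        · exact ⟨by omega, le_rfl⟩

open Stmt in
/-- Go through the letters to the right of the block. -/
def rightPass : Stmt :=
  (.up ≔ 1 ;; .dn ≔ 0 ;; .ua ≔ ⇡.c ;; .ub ≔ ⇡.c + ⇡.p0 + ⇡.fst ;; .la ≔ ⇡.n - ⇡.p0 - ⇡.c ;;
    .lb ≔ ⇡.n - ⇡.c - ⇡.p0 - ⇡.fst ;; .anc ≔ ⇡.fst) ;; comparisonPass

open Stmt in
/-- Go through the letters to the left of the block. -/
def leftPass : Stmt :=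
  (.up ≔ 0 ;; .dn ≔ 1 ;; .ua ≔ ⇡.c + ⇡.q - 1 ;; .ub ≔ ⇡.c + ⇡.q - 1 + ⇡.p0 + ⇡.lst ;;
    .la ≔ ⇡.c + ⇡.q ;; .lb ≔ ⇡.c + ⇡.q + ⇡.lst ;; .anc ≔ ⇡.lst) ;; comparisonPass

open Stmt in
/-- Reset the numbers of mismatches. -/
def resetCounts : Stmt := count .i .hh (put .Cnt ⇡.i 0)

open Stmt in
/-- Register the occurrences with two mismatches. -/
def updateResult : Stmt :=
  count .i .hh (ifLt (.get .Z (⇡.q + ⇡.i)) ⇡.q skip (ifEq (.get .Cnt ⇡.i) 2 (.res ≔ 0) skip))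

/-- The state in which the occurrences of the block are compared with it. -/
structure OccurrencesFound (M : Machine) (s : HState) : Prop where
  fits : WindowFits M s
  stride : s.var .n + 1 = M.D
  period : IsLeastPeriod (fun x => s.arr .F (s.var .c + x)) (s.var .q) (s.var .per)
  occ : ∀ i < s.var .hh, s.var .q ≤ s.arr .Z (s.var .q + i) ↔
    OccursShifted (s.arr .F) (s.var .q) (s.var .c) (s.var .p0) i
  fst_lt : s.var .fst < s.var .hh
  lst_lt : s.var .lst < s.var .hh
  occ_fst : s.var .q ≤ s.arr .Z (s.var .q + s.var .fst)
  occ_lst : s.var .q ≤ s.arr .Z (s.var .q + s.var .lst)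
  between : ∀ i < s.var .hh, s.var .q ≤ s.arr .Z (s.var .q + i) → s.var .fst ≤ i ∧ i ≤ s.var .lst

theorem OccurrencesFound.of_frame {M : Machine} {s s' : HState} {P : Stmt}
    (h : OccurrencesFound M s) (hF : Frame P s s')
    (hw : ∀ v ∈ [Var.q, .hh, .c, .p0, .n, .per, .fst, .lst], P.writes v = false)
    (hk : ∀ k ∈ [Arr.F, .Z], P.puts k = false) : OccurrencesFound M s' := by
  have h1 := hF.1 .q (hw _ (by decide))
  have h2 := hF.1 .hh (hw _ (by decide))
  have h3 := hF.1 .c (hw _ (by decide))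
  have h4 := hF.1 .p0 (hw _ (by decide))
  have h5 := hF.1 .n (hw _ (by decide))
  have h6 := hF.1 .per (hw _ (by decide))
  have h7 := hF.1 .fst (hw _ (by decide))
  have h8 := hF.1 .lst (hw _ (by decide))
  have k1 := hF.2 .F (hk _ (by decide))
  have k2 := hF.2 .Z (hk _ (by decide))
  obtain ⟨a1, a2, a3, a4, a5, a6, a7, a8, a9⟩ := h
  refine ⟨a1.of_frame hF fun v hv => hw v ?_, ?_, ?_, ?_, ?_, ?_, ?_, ?_, ?_⟩
  · simp only [List.mem_cons, List.not_mem_nil, or_false] at hv ⊢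
    tauto
  all_goals simp only [h1, h2, h3, h4, h5, h6, h7, h8, k1, k2]; assumption

/-- Two occurrences of the same block make their distance a period of it. The condition `2 * hh ≤ q
+ 1` keeps twice the distance below `q`, as `IsLeastPeriod.dvd_of_lt` requires. -/
theorem OccurrencesFound.dvd {M : Machine} {s : HState} (h : OccurrencesFound M s) {i j : ℕ}
    (hj : j < s.var .hh) (hij : i ≤ j) (hi' : s.var .q ≤ s.arr .Z (s.var .q + i))
    (hj' : s.var .q ≤ s.arr .Z (s.var .q + j)) : s.var .per ∣ j - i := by
  have h1 := h.fits.hh_le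
  have h2 := h.fits.one_le_q
  refine h.period.dvd_of_lt (fun x hx => ?_) (by omega)
  have k1 := (h.occ i (by omega)).1 hi' (x + (j - i)) hx
  have k2 := (h.occ j hj).1 hj' x (by omega)
  rw [k1, k2]
  congr 1; omega

/-- The second word starts at the first occurrence, and the others start further to the right in it,
so one table of deviations serves them all. The letters passed over on the way to their starts lie
inside the block and do not deviate. -/
theorem rightPass_spec (M : Machine) (s : HState) (h : OccurrencesFound M s)
    (hCnt : ∀ i < s.var .hh, s.var .q ≤ s.arr .Z (s.var .q + i) → s.arr .Cnt i ≤ 3) :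
    HT M rightPass s (1200 * (s.var .n - s.var .p0) + 1000 * s.var .hh + 308)
      (fun s' => ∀ i < s.var .hh, s.var .q ≤ s.arr .Z (s.var .q + i) →
        s'.arr .Cnt i = s.arr .Cnt i + min 3 (Nat.count
          (fun x => s.arr .F (s.var .c + x) ≠ s.arr .F (s.var .c + x + (s.var .p0 + i)))
          (s.var .n - (s.var .p0 + i) - s.var .c))) := by
  have hW := M.word
  have hD0 := M.pos
  obtain ⟨f1, f2, f3, f4, f5⟩ := h.fits
  have hst := h.stride
  have hfst := h.fst_lt
  refine (HT.seq (T := 100) (R := fun s₁ => s₁.var .up = 1 ∧ s₁.var .dn = 0 ∧ s₁.var .ua = s.var .c ∧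
    s₁.var .ub = s.var .c + s.var .p0 + s.var .fst ∧ s₁.var .la = s.var .n - s.var .p0 - s.var .c ∧
    s₁.var .lb = s.var .n - s.var .c - s.var .p0 - s.var .fst ∧ s₁.var .anc = s.var .fst)
    (HT.of_wp_le ?_ (Nat.le_of_ble_eq_true rfl)) (T' := 1200 * (s.var .n - s.var .p0) +
      1000 * s.var .hh + 208) fun s₁ hF₁ ⟨h1, h2, h3, h4, h5, h6, h7⟩ => ?_).mono (by omega) fun _ _ h => h
  · simp only [Stmt.wp, Exp.ok_add, Exp.ok_sub, Exp.ok_var, Exp.ok_ofNat, Exp.eval_add, Exp.eval_sub,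
      Exp.eval_var, Exp.eval_ofNat, HState.setV_var, if_true, reduceCtorEq, if_false, true_and, and_true]
    omega
  have e1 : s₁.var .q = s.var .q := hF₁.1 _ rfl
  have e2 : s₁.var .hh = s.var .hh := hF₁.1 _ rfl
  have e3 : s₁.var .per = s.var .per := hF₁.1 _ rfl
  have e4 : s₁.arr .F = s.arr .F := hF₁.2 _ rfl
  have e5 : s₁.arr .Z = s.arr .Z := hF₁.2 _ rfl
  have e6 : s₁.arr .Cnt = s.arr .Cnt := hF₁.2 _ rfl
  set gA : ℕ → ℕ := fun x => s.arr .F (s.var .c + x) with hgA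
  set gB : ℕ → ℕ := fun x => s.arr .F (s.var .c + s.var .p0 + s.var .fst + x) with hgB
  have hAB : ∀ x < s.var .q, gA x = gB x := (h.occ _ hfst).1 h.occ_fst
  have hpass := comparisonPass_spec M s₁ (gA := gA) (gB := gB)
    (δ := fun i => (i - s.var .fst) + (s.var .fst - i))
    (m := fun i => min (s.var .n - s.var .p0 - s.var .c) (s.var .n - s.var .c - s.var .p0 -
      s.var .fst - ((i - s.var .fst) + (s.var .fst - i))))
    (by simp [hgA, e4, h1, h2, h3]) (by simp [hgB, e4, h1, h2, h4]) (by simp [h7]) (by simp [h5, h6])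
    (by omega) (by omega) (by omega) (by omega) (by rw [h1]; omega) (by rw [h1]; omega)
    (by omega) (by omega)
    (Or.inl fun i hi ho => by
      rw [h7]
      rw [e2] at hi
      rw [e1, e5] at ho
      exact (h.between i hi ho).1)
    (fun i hi ho => by
      rw [e2] at hi
      rw [e1, e5] at ho
      have hb := h.between i hi ho
      have hdvd := h.dvd hi hb.1 h.occ_fst ho
      rw [Nat.sub_eq_zero_of_le hb.1, add_zero]
      have := not_deviates_and_eq_of_period (gA := gA) (gB := gB) h.period.pos h.period.le
        (fun x hx => by
          rw [← hAB _ hx, ← hAB _ (by omega)]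
          exact h.period.eq x hx) hAB hdvd (by omega)
      rw [e3]
      exact ⟨by omega, this.1, fun x _ => this.2 x⟩)
    (by rw [e1, e2, e5, e6]; exact hCnt)
  rw [h5, h6, e1, e2, e5, e6] at hpass
  refine hpass.mono (by omega) fun s' _ hs' i hi ho => ?_
  rw [hs' i hi ho, mismatches]
  have hb := h.between i hi ho
  congr 3
  · funext x
    simp only [hgA, hgB]
    rw [show s.var .c + s.var .p0 + s.var .fst + (x + (i - s.var .fst + (s.var .fst - i))) =
      s.var .c + x + (s.var .p0 + i) by omega]
  · omega

/-- The mirror image of the right pass: both words are read leftwards from the last letter of the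
block, so the anchor is the last occurrence. For every occurrence all `c + q` letters down to
position `0` are compared. -/
theorem leftPass_spec (M : Machine) (s : HState) (h : OccurrencesFound M s)
    (hCnt : ∀ i < s.var .hh, s.var .q ≤ s.arr .Z (s.var .q + i) → s.arr .Cnt i ≤ 3) :
    HT M leftPass s (1200 * (s.var .c + s.var .q) + 1100 * s.var .hh + 308)
      (fun s' => ∀ i < s.var .hh, s.var .q ≤ s.arr .Z (s.var .q + i) →
        s'.arr .Cnt i = s.arr .Cnt i + min 3 (Nat.count
          (fun x => s.arr .F (s.var .c + s.var .q - 1 - x) ≠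
            s.arr .F (s.var .c + s.var .q - 1 - x + (s.var .p0 + i)))
          (s.var .c + s.var .q))) := by
  have hW := M.word
  have hD0 := M.pos
  obtain ⟨f1, f2, f3, f4, f5⟩ := h.fits
  have hst := h.stride
  have hlst := h.lst_lt
  refine (HT.seq (T := 100) (R := fun s₁ => s₁.var .up = 0 ∧ s₁.var .dn = 1 ∧
    s₁.var .ua = s.var .c + s.var .q - 1 ∧
    s₁.var .ub = s.var .c + s.var .q - 1 + s.var .p0 + s.var .lst ∧ s₁.var .la = s.var .c + s.var .q ∧
    s₁.var .lb = s.var .c + s.var .q + s.var .lst ∧ s₁.var .anc = s.var .lst)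
    (HT.of_wp_le ?_ (Nat.le_of_ble_eq_true rfl)) (T' := 1200 * (s.var .c + s.var .q) +
      1100 * s.var .hh + 208) fun s₁ hF₁ ⟨h1, h2, h3, h4, h5, h6, h7⟩ => ?_).mono (by omega) fun _ _ h => h
  · simp only [Stmt.wp, Exp.ok_add, Exp.ok_sub, Exp.ok_var, Exp.ok_ofNat, Exp.eval_add, Exp.eval_sub,
      Exp.eval_var, Exp.eval_ofNat, HState.setV_var, if_true, reduceCtorEq, if_false, true_and, and_true]
    omega
  have e1 : s₁.var .q = s.var .q := hF₁.1 _ rfl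
  have e2 : s₁.var .hh = s.var .hh := hF₁.1 _ rfl
  have e3 : s₁.var .per = s.var .per := hF₁.1 _ rfl
  have e4 : s₁.arr .F = s.arr .F := hF₁.2 _ rfl
  have e5 : s₁.arr .Z = s.arr .Z := hF₁.2 _ rfl
  have e6 : s₁.arr .Cnt = s.arr .Cnt := hF₁.2 _ rfl
  set gA : ℕ → ℕ := fun x => s.arr .F (s.var .c + s.var .q - 1 - x) with hgA
  set gB : ℕ → ℕ := fun x => s.arr .F (s.var .c + s.var .q - 1 + s.var .p0 + s.var .lst - x) with hgB
  have hA : ∀ x < s.var .q, gA x = s.arr .F (s.var .c + (s.var .q - 1 - x)) := by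
    intro x hx
    simp only [hgA]
    congr 1; omega
  have hAB : ∀ x < s.var .q, gA x = gB x := by
    intro x hx
    rw [hA x hx, (h.occ _ hlst).1 h.occ_lst _ (by omega)]
    simp only [hgB]
    congr 1; omega
  have hpass := comparisonPass_spec M s₁ (gA := gA) (gB := gB)
    (δ := fun i => (i - s.var .lst) + (s.var .lst - i))
    (m := fun i => min (s.var .c + s.var .q) (s.var .c + s.var .q + s.var .lst -
      ((i - s.var .lst) + (s.var .lst - i))))
    (by simp [hgA, e4, h1, h2, h3]) (by simp [hgB, e4, h1, h2, h4]) (by simp [h7]) (by simp [h5, h6])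
    (by omega) (by omega) (by omega) (by omega) (by rw [h1]; omega) (by rw [h1]; omega)
    (by omega) (by omega)
    (Or.inr fun i hi ho => by
      rw [h7]
      rw [e2] at hi
      rw [e1, e5] at ho
      exact (h.between i hi ho).2)
    (fun i hi ho => by
      rw [e2] at hi
      rw [e1, e5] at ho
      have hb := h.between i hi ho
      have hdvd := h.dvd hlst hb.2 ho h.occ_lst
      rw [Nat.sub_eq_zero_of_le hb.2, zero_add]
      have := not_deviates_and_eq_of_period (gA := gA) (gB := gB) h.period.pos h.period.le
        (fun x hx => by
          rw [← hAB _ hx, ← hAB _ (by omega), hA _ hx, hA _ (by omega)]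
          have := h.period.eq (s.var .q - 1 - (x + s.var .per)) (by omega)
          rw [this]
          congr 1; omega) hAB hdvd (by omega)
      rw [e3]
      exact ⟨by omega, this.1, fun x _ => this.2 x⟩)
    (by rw [e1, e2, e5, e6]; exact hCnt)
  rw [h5, h6, e1, e2, e5, e6] at hpass
  refine hpass.mono (by omega) fun s' _ hs' i hi ho => ?_
  rw [hs' i hi ho, mismatches]
  have hb := h.between i hi ho
  rw [show min (s.var .c + s.var .q) (s.var .c + s.var .q + s.var .lst -
    (i - s.var .lst + (s.var .lst - i))) = s.var .c + s.var .q by omega]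
  simp only [Nat.count_eq_card_filter_range]
  congr 3
  apply Finset.filter_congr
  intro x hx
  rw [Finset.mem_range] at hx
  simp only [hgA, hgB]
  rw [show s.var .c + s.var .q - 1 + s.var .p0 + s.var .lst - (x + (i - s.var .lst + (s.var .lst - i))) =
      s.var .c + s.var .q - 1 - x + (s.var .p0 + i) by omega]

theorem resetCounts_spec (M : Machine) (s : HState) (h : s.var .hh ≤ M.D) :
    HT M resetCounts s (40 * s.var .hh + 8) (fun s' => ∀ i < s.var .hh, s'.arr .Cnt i = 0) := by
  have hW := M.word
  have hD0 := M.pos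
  refine (HT.count (fun n s' => ∀ i < n, s'.arr .Cnt i = 0) (fun _ => 20) (by decide) rfl rfl
    (fun _ _ _ h => h) ?_ (fun i hi => absurd hi (Nat.not_lt_zero i))).mono ?_ fun _ _ h => h
  · intro i hi s' hF hx hI
    refine HT.of_wp_le ?_ (Nat.le_of_ble_eq_true rfl)
    simp only [Stmt.wp, Exp.ok_var, Exp.ok_ofNat, Exp.eval_var, Exp.eval_ofNat,
      HState.setA_arr_self, hx, true_and]
    refine ⟨by omega, by omega, fun j hj => ?_⟩
    split_ifs with hji
    · rfl
    · exact hI j (by omega)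
  · simp; omega

open Classical in
theorem updateResult_spec (M : Machine) (s : HState) (h : s.var .q + s.var .hh ≤ M.D) :
    HT M updateResult s (60 * s.var .hh + 8) (fun s' => s'.var .res =
      if ∃ i < s.var .hh, s.var .q ≤ s.arr .Z (s.var .q + i) ∧ s.arr .Cnt i = 2 then 0
      else s.var .res) := by
  have hW := M.word
  have hD0 := M.pos
  set bad : ℕ → Prop := fun i => s.var .q ≤ s.arr .Z (s.var .q + i) ∧ s.arr .Cnt i = 2 with hbad
  have hsucc : ∀ n, (∃ i < n + 1, bad i) ↔ (∃ i < n, bad i) ∨ bad n := by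
    intro n
    constructor
    · rintro ⟨i, hi, h⟩
      rcases Nat.lt_succ_iff_lt_or_eq.1 hi with hi | rfl
      exacts [Or.inl ⟨i, hi, h⟩, Or.inr h]
    · rintro (⟨i, hi, h⟩ | h)
      exacts [⟨i, by omega, h⟩, ⟨n, by omega, h⟩]
  refine (HT.count (fun n s' => s'.var .res = if ∃ i < n, bad i then 0 else s.var .res)
    (fun _ => 40) (by decide) rfl rfl (fun _ _ _ h => by simpa using h) ?_ (by simp)).mono ?_ fun _ _ h => h
  · intro i hi s' hF hx hI
    have e1 : s'.var .q = s.var .q := hF.1 _ rfl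
    have e2 : s'.arr .Z = s.arr .Z := hF.2 _ rfl
    have e3 : s'.arr .Cnt = s.arr .Cnt := hF.2 _ rfl
    refine HT.of_wp_le ?_ (Nat.le_of_ble_eq_true rfl)
    simp only [Stmt.wp, Exp.ok_add, Exp.ok_get, Exp.ok_var, Exp.ok_ofNat, Exp.eval_add, Exp.eval_get,
      Exp.eval_var, Exp.eval_ofNat, HState.setV_var, if_true, e1, e2, e3, hx, true_and, hsucc]
    refine ⟨by omega, fun hlt => ?_, fun hnlt => ⟨by omega, by omega, fun h2 => ⟨by omega, by omega, ?_⟩,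
      fun h2 => ?_⟩⟩
    · rw [hI]
      have : ¬ bad i := fun hb => absurd hb.1 (not_le.2 hlt)
      simp [this]
    · rw [if_pos (Or.inr ⟨not_lt.1 hnlt, h2⟩)]
    · rw [hI]
      have : ¬ bad i := fun hb => h2 hb.2
      simp [this]
  · simp; omega

open Stmt in
/-- Test the shifts `p0 + i`, with `i < hh`, for which the block at `c` matches. -/
def checkWindow : Stmt :=
  windowMatches ;; blockPeriod ;; findOccurrences ;;
  ifLt 0 ⇡.found (resetCounts ;; rightPass ;; leftPass ;; updateResult) skip

open Classical in
theorem checkWindow_spec (M : Machine) (s : HState) (hfit : WindowFits M s)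
    (hst : s.var .n + 1 = M.D) (hc : s.var .c ≤ 2 * s.var .q)
    (hn : s.var .n - s.var .p0 ≤ 5 * s.var .q + 5) :
    HT M checkWindow s (50000 * s.var .q) (fun s' => s'.var .res =
      if ∃ i < s.var .hh, OccursShifted (s.arr .F) (s.var .q) (s.var .c) (s.var .p0) i ∧
        TwoErrorShift (s.arr .F) (s.var .n) (s.var .p0 + i) then 0 else s.var .res) := by
  have hW := M.word
  have hD0 := M.pos
  obtain ⟨f1, f2, f3, f4, f5⟩ := id hfit
  refine ((windowMatches_spec M s hfit).seq (T' := (20 * s.var .q + 20) + ((60 * s.var .hh + 20) +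
    (20000 * s.var .q + 6700))) fun s₁ hF₁ h₁ => ?_).mono (by omega) fun _ _ h => h
  have a1 : s₁.var .q = s.var .q := hF₁.1 _ rfl
  have a2 : s₁.var .hh = s.var .hh := hF₁.1 _ rfl
  have hper := blockPeriod_spec M s₁ (f := s.arr .F) (c := s.var .c) (p0 := s.var .p0)
    (N := 2 * s.var .q + s.var .hh - 1) (by omega) (by omega) (by omega) (by rwa [a1])
  rw [a1] at hper
  refine hper.seq fun s₂ hF₂ h₂ => ?_
  have b1 : s₂.var .q = s.var .q := (hF₂.1 _ rfl).trans a1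
  have b2 : s₂.var .hh = s.var .hh := (hF₂.1 _ rfl).trans a2
  have b3 : s₂.arr .Z = s₁.arr .Z := hF₂.2 _ rfl
  have hfind := findOccurrences_spec M s₂ (by omega)
  rw [b1, b2, b3] at hfind
  refine hfind.seq fun s₃ hF₃ h₃ => ?_
  have c1 : s₃.var .q = s.var .q := (hF₃.1 _ rfl).trans b1
  have c2 : s₃.var .hh = s.var .hh := (hF₃.1 _ rfl).trans b2
  have c3 : s₃.arr .Z = s₁.arr .Z := (hF₃.2 _ rfl).trans b3
  have c4 : s₃.var .per = s₂.var .per := hF₃.1 _ rfl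
  have c5 : s₃.var .n = s.var .n := ((hF₃.1 _ rfl).trans (hF₂.1 _ rfl)).trans (hF₁.1 _ rfl)
  have c6 : s₃.var .c = s.var .c := ((hF₃.1 _ rfl).trans (hF₂.1 _ rfl)).trans (hF₁.1 _ rfl)
  have c7 : s₃.var .p0 = s.var .p0 := ((hF₃.1 _ rfl).trans (hF₂.1 _ rfl)).trans (hF₁.1 _ rfl)
  have c8 : s₃.arr .F = s.arr .F := ((hF₃.2 _ rfl).trans (hF₂.2 _ rfl)).trans (hF₁.2 _ rfl)
  have c9 : s₃.var .res = s.var .res := ((hF₃.1 _ rfl).trans (hF₂.1 _ rfl)).trans (hF₁.1 _ rfl)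
  have hocc : ∀ i < s.var .hh, s.var .q ≤ s₁.arr .Z (s.var .q + i) ↔
      OccursShifted (s.arr .F) (s.var .q) (s.var .c) (s.var .p0) i := fun i hi =>
    (h₁ (s.var .q + i) (by omega) (by omega)).occursShifted_iff (by omega)
  refine (HT.ifLt (a := 0) (b := ⇡.found) (T := 20000 * s.var .q + 6690) (show 0 < M.W by omega) trivial
    (fun hfound => ?_) fun hfound => ?_).mono (T := Exp.cost 0 + Exp.cost ⇡.found + 1 + (20000 * s.var .q + 6690)) ?_
    fun _ _ h => h
  · rcases h₃ with ⟨h3, -⟩ | ⟨-, h3, h4, h5, h6, h7⟩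
    · simp [h3] at hfound
    have hO : OccurrencesFound M s₃ := by
      refine ⟨⟨?_, ?_, ?_, ?_, ?_⟩, ?_, ?_, ?_, ?_, ?_, ?_, ?_, ?_⟩ <;>
        simp only [c1, c2, c3, c4, c5, c6, c7, c8] <;> assumption
    have hr := resetCounts_spec M s₃ (by omega)
    rw [c2] at hr
    refine (hr.seq (T' := (1200 * (s.var .n - s.var .p0) + 1000 * s.var .hh + 308) +
      ((1200 * (s.var .c + s.var .q) + 1100 * s.var .hh + 308) + (60 * s.var .hh + 8)))
      fun s₄ hF₄ h₄ => ?_).mono (by omega) fun _ _ h => h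
    have hO₄ := hO.of_frame hF₄ (by decide) (by decide)
    have d1 : s₄.var .hh = s.var .hh := (hF₄.1 _ rfl).trans c2
    have hright := rightPass_spec M s₄ hO₄ (by
      rw [d1]
      intro i hi
      rw [h₄ i hi]
      omega)
    have d2 : s₄.var .n = s.var .n := (hF₄.1 _ rfl).trans c5
    have d3 : s₄.var .p0 = s.var .p0 := (hF₄.1 _ rfl).trans c7
    have d4 : s₄.var .c = s.var .c := (hF₄.1 _ rfl).trans c6
    have d5 : s₄.var .q = s.var .q := (hF₄.1 _ rfl).trans c1
    have d6 : s₄.arr .Z = s₁.arr .Z := (hF₄.2 _ rfl).trans c3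
    have d7 : s₄.arr .F = s.arr .F := (hF₄.2 _ rfl).trans c8
    rw [d1, d2, d3, d4, d5, d6, d7] at hright
    refine hright.seq fun s₅ hF₅ h₅ => ?_
    have hO₅ := hO₄.of_frame hF₅ (by decide) (by decide)
    have e1 : s₅.var .hh = s.var .hh := (hF₅.1 _ rfl).trans d1
    have e2 : s₅.var .p0 = s.var .p0 := (hF₅.1 _ rfl).trans d3
    have e3 : s₅.var .c = s.var .c := (hF₅.1 _ rfl).trans d4
    have e4 : s₅.var .q = s.var .q := (hF₅.1 _ rfl).trans d5
    have e5 : s₅.arr .Z = s₁.arr .Z := (hF₅.2 _ rfl).trans d6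
    have e6 : s₅.arr .F = s.arr .F := (hF₅.2 _ rfl).trans d7
    have hleft := leftPass_spec M s₅ hO₅ (by
      rw [e1, e4, e5]
      intro i hi ho
      rw [h₅ i hi ho, h₄ i hi]
      omega)
    rw [e1, e2, e3, e4, e5, e6] at hleft
    refine hleft.seq fun s₆ hF₆ h₆ => ?_
    have g1 : s₆.var .hh = s.var .hh := (hF₆.1 _ rfl).trans e1
    have g2 : s₆.var .q = s.var .q := (hF₆.1 _ rfl).trans e4
    have g3 : s₆.arr .Z = s₁.arr .Z := (hF₆.2 _ rfl).trans e5
    have g4 : s₆.var .res = s.var .res :=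
      (hF₆.1 _ rfl).trans <| (hF₅.1 _ rfl).trans <| (hF₄.1 _ rfl).trans c9
    have hupd := updateResult_spec M s₆ (by omega)
    rw [g1, g2, g3, g4] at hupd
    refine hupd.mono le_rfl fun s' _ hs' => ?_
    rw [hs']
    refine if_congr (exists_congr fun i => and_congr_right fun hi => ?_) rfl rfl
    rw [← hocc i hi]
    refine and_congr_right fun ho => ?_
    -- The block is read in both passes, but it matches, so nothing is counted twice.
    have hcnt := count_add_count_of_block
      (p := fun x => s.arr .F x ≠ s.arr .F (x + (s.var .p0 + i))) (c := s.var .c) (q := s.var .q)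
      (l := s.var .n - (s.var .p0 + i)) (by omega) (fun x hx => by
        rw [not_not, (hocc i hi).1 ho x hx]
        congr 1; omega)
    -- Cutting both counts off at `3` does not affect whether their sum is `2`.
    rw [h₆ i hi ho, h₅ i hi ho, h₄ i hi, twoErrorShift_iff_mismatches, mismatches, ← hcnt]
    omega
  · rcases h₃ with ⟨h3, h4⟩ | ⟨h3, -⟩
    · refine (HT.skip ?_).mono (by omega) fun _ _ h => h
      rw [c9, if_neg]
      rintro ⟨i, hi, ho, -⟩
      exact h4 i hi ((hocc i hi).2 ho)
    · simp [h3] at hfound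
  · change 1 + 2 + 1 + _ ≤ _
    omega

theorem ite_or_eq {α : Type*} (P Q : Prop) [Decidable P] [Decidable Q] [Decidable (P ∨ Q)] (x y : α) :
    (if P ∨ Q then x else y) = if P then x else if Q then x else y := by
  by_cases hP : P <;> by_cases hQ : Q <;> simp [hP, hQ]

open Stmt in
/-- Test the shifts `p0 + i`, with `i < hh`. -/
def checkShifts : Stmt := .c ≔ 0 ;; loop ⇡.c (3 * ⇡.q) (checkWindow ;; .c ≔ ⇡.c + ⇡.q)

-- The three blocks at `0`, `q` and `2 * q` suffice by `TwoErrorShift.exists_block`: a shift with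
-- two errors leaves one of them intact.
open Classical in
theorem checkShifts_spec (M : Machine) (s : HState) (hst : s.var .n + 1 = M.D)
    (hq : 1 ≤ s.var .q) (hh : 1 ≤ s.var .hh) (hhq : 2 * s.var .hh ≤ s.var .q + 1)
    (hp0 : 3 * s.var .q + s.var .p0 + s.var .hh ≤ M.D)
    (hn : s.var .n - s.var .p0 ≤ 5 * s.var .q + 5) :
    HT M checkShifts s (150100 * s.var .q) (fun s' => s'.var .res =
      if ∃ i < s.var .hh, TwoErrorShift (s.arr .F) (s.var .n) (s.var .p0 + i) then 0
      else s.var .res) := by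
  have hW := M.word
  have hD0 := M.pos
  set E : ℕ → ℕ → Prop := fun t i => OccursShifted (s.arr .F) (s.var .q) (s.var .q * t) (s.var .p0) i ∧
    TwoErrorShift (s.arr .F) (s.var .n) (s.var .p0 + i) with hE
  refine (HT.seq (T := 3) (R := fun s₁ => s₁.var .c = 0) (HT.of_wp_le ?_ (Nat.le_of_ble_eq_true rfl))
    fun s₁ hF₁ h₁ => HT.loop_range 3 (fun t s' => s'.var .c = s.var .q * t ∧
      s'.var .res = if ∃ u < t, ∃ i < s.var .hh, E u i then 0 else s.var .res)
      (fun _ => 50000 * s.var .q + 7) ?_ ?_ ?_).mono ?_ fun s' _ h => ?_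
  · simp only [Stmt.wp, Exp.ok_ofNat, Exp.eval_ofNat, HState.setV_var, if_true, and_true]
    omega
  · rintro t ht s' hF ⟨hc, hI⟩
    have e1 : s'.var .q = s.var .q := (hF.1 _ rfl).trans (hF₁.1 _ rfl)
    have e2 : s'.var .hh = s.var .hh := (hF.1 _ rfl).trans (hF₁.1 _ rfl)
    have e3 : s'.var .p0 = s.var .p0 := (hF.1 _ rfl).trans (hF₁.1 _ rfl)
    have e4 : s'.var .n = s.var .n := (hF.1 _ rfl).trans (hF₁.1 _ rfl)
    have e5 : s'.arr .F = s.arr .F := (hF.2 _ rfl).trans (hF₁.2 _ rfl)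
    have hqt : s.var .q * t ≤ 2 * s.var .q := by nlinarith
    refine ⟨trivial, ?_, ?_, ?_⟩
    · simp only [Exp.ok_mul, Exp.ok_ofNat, Exp.ok_var, Exp.eval_ofNat, Exp.eval_var, e1, true_and]
      omega
    · simp only [Exp.eval_mul, Exp.eval_var, Exp.eval_ofNat, e1, hc]
      omega
    have hwin := checkWindow_spec M s' ⟨by omega, by omega, by omega, by omega, by omega⟩
      (by omega) (by omega) (by omega)
    rw [e1, e2, e3, e4, e5, hc, hI] at hwin
    refine hwin.seq (T' := 7) fun s'' hF' h' => HT.of_wp_le ?_ le_rfl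
    have g1 : s''.var .c = s.var .q * t := (hF'.1 _ rfl).trans hc
    have g2 : s''.var .q = s.var .q := (hF'.1 _ rfl).trans e1
    simp only [Stmt.wp, Exp.ok_add, Exp.ok_var, Exp.eval_add, Exp.eval_var, HState.setV_var, if_true,
      reduceCtorEq, if_false, g1, g2, true_and, mul_add, mul_one, h']
    refine ⟨by omega, by omega, ?_⟩
    have hsucc : (∃ u < t + 1, ∃ i < s.var .hh, E u i) ↔
        (∃ i < s.var .hh, E t i) ∨ ∃ u < t, ∃ i < s.var .hh, E u i := by
      constructor
      · rintro ⟨u, hu, h⟩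
        rcases Nat.lt_succ_iff_lt_or_eq.1 hu with hu | rfl
        exacts [Or.inr ⟨u, hu, h⟩, Or.inl h]
      · rintro (h | ⟨u, hu, h⟩)
        exacts [⟨t, by omega, h⟩, ⟨u, by omega, h⟩]
    rw [if_congr hsucc rfl rfl, ite_or_eq]
  · rintro s' hF ⟨hc, -⟩
    have e1 : s'.var .q = s.var .q := (hF.1 _ rfl).trans (hF₁.1 _ rfl)
    refine ⟨trivial, ?_, ?_⟩
    · simp only [Exp.ok_mul, Exp.ok_ofNat, Exp.ok_var, Exp.eval_ofNat, Exp.eval_var, e1, true_and]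
      omega
    · simp only [Exp.eval_mul, Exp.eval_var, Exp.eval_ofNat, e1, hc]
      omega
  · refine ⟨by simp [h₁], ?_⟩
    rw [if_neg (by simp)]
    exact hF₁.1 _ rfl
  · simp only [Finset.sum_const, Finset.card_range, smul_eq_mul]
    change 3 + (_ + (3 + 1) * 7) ≤ _
    omega
  · rw [h.2]
    refine if_congr ?_ rfl rfl
    constructor
    · rintro ⟨u, -, i, hi, -, h⟩
      exact ⟨i, hi, h⟩
    · rintro ⟨i, hi, h⟩
      obtain ⟨t, ht, hb⟩ := h.exists_block (q := s.var .q) (by omega)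
      refine ⟨t, ht, i, hi, fun x hx => ?_, h⟩
      rw [hb x hx]
      congr 1; omega

/-! ### All shifts in linear time -/

open Stmt in
/-- Test all shifts with an overlap of at least three. -/
def checkLongOverlaps : Stmt :=
  .l0 ≔ 3 ;;
  loop ⇡.l0 ⇡.n
    ((.q ≔ ⇡.l0 / 3 ;; .hh ≔ Exp.min ((⇡.q + 1) / 2) (⇡.n - ⇡.l0) ;;
      .p0 ≔ ⇡.n + 1 - (⇡.l0 + ⇡.hh)) ;;
    checkShifts ;; .l0 ≔ ⇡.l0 + ⇡.hh)

-- The shifts `p0, ..., p0 + hh - 1` are those with overlaps `l0, ..., l0 + hh - 1`. A group costs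
-- order `q` and advances `l0` by at least `q / 2`, so its cost is charged to the advance. Only a
-- group cut off at `n` can advance less, and this is the last one.
open Classical in
theorem checkLongOverlaps_spec (M : Machine) (s : HState) (hst : s.var .n + 1 = M.D)
    (hres : s.var .res = if ∃ p, s.var .n < p + 3 ∧ TwoErrorShift (s.arr .F) (s.var .n) p then 0 else 1) :
    HT M checkLongOverlaps s (500000 * s.var .n + 20) (fun s' => s'.var .res =
      if ∃ p, TwoErrorShift (s.arr .F) (s.var .n) p then 0 else 1) := by
  have hW := M.word
  set n := s.var .n with hn
  set f := s.arr .F with hf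
  refine (HT.seq (T := 3) (R := fun s₁ => s₁.var .l0 = 3) (HT.of_wp_le ?_ (Nat.le_of_ble_eq_true rfl))
    fun s₁ hF₁ h₁ => HT.loop (fun T s' => 3 ≤ s'.var .l0 ∧
      s'.var .res = (if ∃ p, n < p + s'.var .l0 ∧ TwoErrorShift f n p then 0 else 1) ∧
      300300 * (n - s'.var .l0) + (if s'.var .l0 < n then 150200 * n else 0) + 1 ≤ T)
      (T := 300300 * n + 150200 * n + 1) ?_ ?_).mono ?_ fun s' _ h => h
  · simp only [Stmt.wp, Exp.ok_ofNat, Exp.eval_ofNat, HState.setV_var, if_true, and_true]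
    omega
  · rintro T s' hF ⟨hl, hI, hT⟩
    have e1 : s'.var .n = n := (hF.1 _ rfl).trans (hF₁.1 _ rfl)
    have e2 : s'.arr .F = f := (hF.2 _ rfl).trans (hF₁.2 _ rfl)
    simp only [Exp.ok_var, Exp.eval_var, e1, true_and]
    refine ⟨fun hlt => ?_, fun hnlt => ⟨by omega, ?_⟩⟩
    · rw [if_pos hlt] at hT
      set l := s'.var .l0 with hldef
      set q := l / 3 with hq
      set h := min ((q + 1) / 2) (n - l) with hh
      refine ⟨50 + (150100 * q + 7), 300300 * (n - (l + h)) + (if l + h < n then 150200 * n else 0) + 1,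
        ?_, ?_⟩
      · change _ + _ + 5 ≤ _
        -- If `l + h < n`, the group is complete and `q ≤ 2 * h` pays for it; otherwise it is the
        -- last one and uses up the reserve `150200 * n`.
        split_ifs with hc <;> omega
      refine HT.seq (R := fun s₂ => s₂.var .q = q ∧ s₂.var .hh = h ∧ s₂.var .p0 = n + 1 - (l + h))
        (HT.of_wp_le ?_ (Nat.le_of_ble_eq_true rfl)) fun s₂ hF₂ ⟨h2, h3, h4⟩ => ?_
      · simp only [Stmt.wp, Exp.ok_add, Exp.ok_sub, Exp.ok_div, Exp.ok_min, Exp.ok_var, Exp.ok_ofNat,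
          Exp.eval_add, Exp.eval_sub, Exp.eval_div, Exp.eval_min, Exp.eval_var, Exp.eval_ofNat,
          HState.setV_var, if_true, reduceCtorEq, if_false, e1, ← hldef, ← hq, ← hh, true_and, and_true]
        omega
      have f1 : s₂.var .n = n := (hF₂.1 _ rfl).trans e1
      have f2 : s₂.arr .F = f := (hF₂.2 _ rfl).trans e2
      have f3 : s₂.var .l0 = l := hF₂.1 _ rfl
      have f4 : s₂.var .res = s'.var .res := hF₂.1 _ rfl
      have hcheck := checkShifts_spec M s₂ (by omega) (by omega) (by omega) (by omega) (by omega) (by omega)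
      rw [h2, h3, h4, f1, f2, f4] at hcheck
      refine hcheck.seq fun s₃ hF₃ h₅ => HT.of_wp_le ?_ le_rfl
      have g1 : s₃.var .l0 = l := (hF₃.1 _ rfl).trans f3
      have g2 : s₃.var .hh = h := (hF₃.1 _ rfl).trans h3
      simp only [Stmt.wp, Exp.ok_add, Exp.ok_var, Exp.eval_add, Exp.eval_var, HState.setV_var, if_true,
        reduceCtorEq, if_false, g1, g2, true_and, h₅]
      refine ⟨by omega, by omega, by omega, ?_, le_rfl⟩
      rw [hI, ← ite_or_eq]
      refine if_congr ⟨?_, ?_⟩ rfl rfl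
      · rintro (⟨i, hi, he⟩ | ⟨p, hp, he⟩)
        exacts [⟨_, by omega, he⟩, ⟨p, by omega, he⟩]
      · rintro ⟨p, hp, he⟩
        by_cases hpl : n < p + l
        · exact Or.inr ⟨p, hpl, he⟩
        · refine Or.inl ⟨p - (n + 1 - (l + h)), by omega, ?_⟩
          rwa [Nat.add_sub_cancel' (by omega)]
    · rw [hI]
      refine if_congr (exists_congr fun p => and_iff_right_of_imp fun he => ?_) rfl rfl
      have : p ≠ 0 := by
        rintro rfl
        exact not_twoErrorShift_zero he
      omega
  · refine ⟨by omega, ?_, ?_⟩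
    · rw [show s₁.var .res = s.var .res from hF₁.1 _ rfl, hres, h₁]
    · split_ifs <;> omega
  · change 3 + (_ + 4) ≤ _
    omega

open Stmt in
/-- The whole test; its result is left in the variable `res`. -/
def checkAll : Stmt :=
  (.res ≔ 1 ;;
    ifLt 2 ⇡.n (ifEq (.get .F 0) (.get .F (⇡.n - 2)) skip
      (ifEq (.get .F 1) (.get .F (⇡.n - 1)) skip (.res ≔ 0))) skip) ;;
  checkLongOverlaps

open Classical in
theorem checkAll_spec (M : Machine) (s : HState) (hst : s.var .n + 1 = M.D) :
    HT M checkAll s (500000 * s.var .n + 100) (fun s' => s'.var .res =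
      if ∃ p, TwoErrorShift (s.arr .F) (s.var .n) p then 0 else 1) := by
  have hW := M.word
  refine (HT.seq (T := 60) (R := fun s₁ => s₁.var .res =
    if ∃ p, s.var .n < p + 3 ∧ TwoErrorShift (s.arr .F) (s.var .n) p then 0 else 1)
    (HT.of_wp_le ?_ (Nat.le_of_ble_eq_true rfl)) fun s₁ hF₁ h₁ => ?_).mono
    (T := 60 + (500000 * s.var .n + 20)) (by omega) fun _ _ h => h
  -- Two errors need an overlap of at least two, so `p = n - 2` is the only short case; the shift
  -- `0` has no errors, so `2 < n`.
  · have hshort : (∃ p, s.var .n < p + 3 ∧ TwoErrorShift (s.arr .F) (s.var .n) p) ↔ 2 < s.var .n ∧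
        s.arr .F 0 ≠ s.arr .F (s.var .n - 2) ∧ s.arr .F 1 ≠ s.arr .F (s.var .n - 1) := by
      constructor
      · rintro ⟨p, hp, he⟩
        have h2 := he.add_two_le
        have h0 : p ≠ 0 := by
          rintro rfl
          exact not_twoErrorShift_zero he
        have := (twoErrorShift_of_add_two (by omega)).1 he
        rw [show p = s.var .n - 2 by omega] at this
        rw [show s.var .n - 1 = 1 + (s.var .n - 2) by omega]
        exact ⟨by omega, this⟩
      · rintro ⟨h2, h⟩
        rw [show s.var .n - 1 = 1 + (s.var .n - 2) by omega] at h
        exact ⟨s.var .n - 2, by omega, (twoErrorShift_of_add_two (by omega)).2 h⟩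
    simp only [Stmt.wp, Exp.ok_sub, Exp.ok_get, Exp.ok_var, Exp.ok_ofNat, Exp.eval_sub, Exp.eval_get,
      Exp.eval_var, Exp.eval_ofNat, HState.setV_var, HState.setV_arr, if_true, reduceCtorEq, if_false,
      true_and, hshort]
    refine ⟨by omega, by omega, by omega, fun h2 => ⟨by omega, by omega, fun he => ?_,
      fun hne => ⟨by omega, by omega, fun he => ?_, fun hne' => ⟨by omega, by omega, ?_⟩⟩⟩, fun h2 => ?_⟩
    · rw [if_neg fun h => h.2.1 he]
    · rw [if_neg fun h => h.2.2 he]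
    · rw [if_pos ⟨h2, hne, hne'⟩]
    · rw [if_neg fun h => h2 h.1]
  · have e1 : s₁.var .n = s.var .n := hF₁.1 _ rfl
    have e2 : s₁.arr .F = s.arr .F := hF₁.2 _ rfl
    have := checkLongOverlaps_spec M s₁ (by omega) (by rw [e1, e2]; exact h₁)
    rwa [e1, e2] at this

/-! ### From the test to the random access machine -/

theorem twoErrorShift_congr {A B : Type*} {f : ℕ → A} {g : ℕ → B} {n p : ℕ}
    (h : ∀ x < n, ∀ y < n, f x = f y ↔ g x = g y) : TwoErrorShift f n p ↔ TwoErrorShift g n p := by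
  refine exists_congr fun i => exists_congr fun j => and_congr_right fun hij => and_congr_right fun hj => ?_
  refine and_congr (not_congr (h _ (by omega) _ (by omega)))
    (and_congr (not_congr (h _ (by omega) _ hj)) ?_)
  exact forall_congr' fun x => forall_congr' fun hx => imp_congr_right fun _ => imp_congr_right fun _ =>
    h _ (by omega) _ hx

theorem isHammingIsometric_iff_ramInput {A : Type*} {k : ℕ} (e : A ≃ Fin k) (w : List A) :
    IsHammingIsometric w ↔ ¬ ∃ p, TwoErrorShift (ramInput e w).mem w.length p := by
  rw [not_exists]
  cases isEmpty_or_nonempty A with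
  | inl h =>
    -- Over the empty alphabet there are no words of positive length, and `w` is empty.
    refine iff_of_true (fun n hn u => isEmptyElim (u ⟨0, hn⟩)) fun p hp => ?_
    have := hp.add_two_le
    cases w with
    | nil => simp at this
    | cons a => exact isEmptyElim a
  | inr h =>
    let F : ℕ → A := fun x => if h : x < w.length then w[x] else Classical.arbitrary A
    rw [isHammingIsometric_iff (F := F) fun x hx => by simp [F, hx]]
    refine forall_congr' fun p => not_congr (twoErrorShift_congr fun x hx y hy => ?_)
    simp [F, ramInput, hx, hy, Fin.val_inj]

/-- Initialize the stride and the length, run the test and put its result into register `0`. -/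
def checkProgram : RamProg :=
  .seq (.const 62 1) <| .seq (.arith .add 1 0 62) <| .seq (.const 62 0) <|
  .seq (.arith .add Var.n.idx 0 62) <| .seq checkAll.compile <| .seq (.const 62 0) <|
  .arith .add 0 Var.res.idx 62

-- The input already lies in place as the array `F`, which has number `0`. The stride `n + 1` is
-- positive even for the empty word.
open Classical in
theorem checkProgram_spec (M : Machine) {n : ℕ} (hst : n + 1 = M.D) (mem : ℕ → ℕ) :
    ∃ σ t, RamExec M.W M.S checkProgram ⟨fun r => if r = 0 then n else 0, mem⟩ σ t ∧
      t ≤ 500000 * n + 106 ∧ σ.reg 0 = if ∃ p, TwoErrorShift mem n p then 0 else 1 := by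
  have hW := M.word
  let σ₀ : RamState := ⟨fun r => if r = 0 then n else 0, mem⟩
  let σ₁ := σ₀.setReg 62 1
  let σ₂ := σ₁.setReg 1 (n + 1)
  let σ₃ := σ₂.setReg 62 0
  let σ₄ := σ₃.setReg Var.n.idx n
  let s : HState := ⟨fun v => if v = .n then n else 0, fun k i => mem (k.idx * M.D + i)⟩
  have e₂ : RamExec M.W M.S (.arith .add 1 0 62) σ₁ σ₂ 1 :=
    RamExec.arith σ₁ .add 1 0 62 (show n + 1 < M.W by omega)
  have e₄ : RamExec M.W M.S (.arith .add Var.n.idx 0 62) σ₃ σ₄ 1 :=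
    RamExec.arith σ₃ .add Var.n.idx 0 62 (show n + 0 < M.W by omega)
  have hs : Represents M σ₄ s := by
    refine ⟨hst, fun v => ?_, fun v => ?_, fun k i _ => rfl⟩
    · have h1 := v.two_le_idx
      have h2 := v.idx_lt
      simp only [σ₄, σ₃, σ₂, σ₁, σ₀, s, RamState.setReg_reg]
      by_cases hv : v = .n
      · rw [if_pos (by rw [hv]), if_pos hv]
      · rw [if_neg fun h => hv (Var.idx_injective h), if_neg (by omega), if_neg (by omega),
          if_neg (by omega), if_neg (by omega), if_neg hv]
    · simp only [s]
      split_ifs <;> omega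
  obtain ⟨σ₅, t, s', e₅, ht, hσ₅, -, hs'⟩ := checkAll_spec M s hst σ₄ hs
  have hval : RamOp.add.eval ((σ₅.setReg 62 0).reg Var.res.idx) ((σ₅.setReg 62 0).reg 62) = s'.var .res := by
    have := Var.idx_lt .res
    simp only [RamOp.eval, RamState.setReg_reg]
    rw [if_neg (by omega), if_true, hσ₅.var, add_zero]
  have e₆ := RamExec.arith (W := M.W) (S := M.S) (σ₅.setReg 62 0) .add 0 Var.res.idx 62
    (by rw [hval]; exact hσ₅.lt _)
  rw [hval] at e₆
  refine ⟨_, 1 + (1 + (1 + (1 + (t + (1 + 1))))), .seq _ _ _ _ _ _ _ (.const _ _ _ (by omega))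
    (.seq _ _ _ _ _ _ _ e₂ (.seq _ _ _ _ _ _ _ (.const _ _ _ (by omega)) (.seq _ _ _ _ _ _ _ e₄
    (.seq _ _ _ _ _ _ _ e₅ (.seq _ _ _ _ _ _ _ (.const _ _ _ (by omega)) e₆))))), ?_, ?_⟩
  · have : s.var .n = n := rfl
    omega
  · have h1 : s.var .n = n := rfl
    have h2 : s.arr .F = mem := by
      funext i
      change mem (0 * M.D + i) = mem i
      rw [zero_mul, zero_add]
    rw [h1, h2] at hs'
    simp [RamState.setReg_reg, hs']

theorem checkableInLinearTimeAndSpace_isHammingIsometric (A : Type*) [Fintype A] :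
    CheckableInLinearTimeAndSpace (fun f : List A => IsHammingIsometric f) := by
  classical
  intro e
  -- The summand `Fintype.card A` makes the words large enough for the numbers of the letters; the
  -- other summand bounds the steps per unit of `n + 1`.
  refine ⟨checkProgram, Fintype.card A + 500106, fun w => ?_⟩
  set n := w.length
  set C := Fintype.card A + 500106 with hC
  have hpow : (n + 2) ^ 4 ≤ (n + 2) ^ C := Nat.pow_le_pow_right (by omega) (by omega)
  have hcube : 2 ^ 3 ≤ (n + 2) ^ 3 := Nat.pow_le_pow_left (by omega) 3
  -- The eight arrays of length `n + 1` have to be addressable.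
  have hW : 8 * (n + 1) ≤ (n + 2) ^ C := by
    calc 8 * (n + 1) ≤ 2 ^ 3 * (n + 2) := by omega
      _ ≤ (n + 2) ^ 3 * (n + 2) := Nat.mul_le_mul_right _ hcube
      _ = (n + 2) ^ 4 := (pow_succ _ _).symm
      _ ≤ _ := hpow
  have hcard : Fintype.card A ≤ (n + 2) ^ C := by
    have h1 : C < (n + 2) ^ C := Nat.lt_pow_self (by omega)
    omega
  have hCn : 500106 * (n + 1) ≤ C * (n + 1) := Nat.mul_le_mul_right _ (by omega)
  refine ⟨⟨by omega, hcard, by omega⟩, ?_⟩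
  obtain ⟨σ, t, hrun, ht, hres⟩ := checkProgram_spec ⟨(n + 2) ^ C, C * (n + 1), n + 1, by omega, hW, by omega⟩
    rfl (ramInput e w).mem
  refine ⟨σ, t, hrun, by omega, fun hL => ?_, fun hL => ?_⟩
  · rw [hres, if_neg ((isHammingIsometric_iff_ramInput e w).1 hL)]
  · rw [hres, if_pos (not_not.1 (mt (isHammingIsometric_iff_ramInput e w).2 hL))]

theorem mainTheorem2 :
    (∀ (A : Type*) [Fintype A],
      CheckableInLinearTimeAndSpace (fun f : List A => IsHammingIsometric f)) ∧
    (∀ f : List (ZMod 2), IsLeeIsometric 2 f ↔ IsHammingIsometric f) ∧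
    CheckableInLinearTimeAndSpace (fun f : List (ZMod 2) => IsLeeIsometric 2 f) := by
  refine ⟨fun A _ => checkableInLinearTimeAndSpace_isHammingIsometric A, isLeeIsometric_two_iff, ?_⟩
  simp only [isLeeIsometric_two_iff]
  exact checkableInLinearTimeAndSpace_isHammingIsometric (ZMod 2)
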